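/- **Setting.** Points lie in complex projective spaces $\mathbb P^3,\mathbb P^2$. A camera is a real $3\times4$ matrix of rank 3, defined up to scale and viewed as a projection $\mathbb P^3\dashrightarrow\mathbb P^2$; its centre is its kernel. All pairs of cameras $(P_1,P_2)$ are assumed to have distinct centres $p_1\ne p_2$. The fundamental matrix $F_P$ is the real $3\times 3$ matrix, considered up to scale, with $\mathbf x^TF_P\mathbf y=\det\begin{bmatrix}P_1&\mathbf x&0\\P_2&0&\mathbf y\end{bmatrix}$. We say that $(u,v)\in\mathbb P^2\times\mathbb P^2$ is an image of $x\in\mathbb P^3$ under $(P_1,P_2)$ if $(x,(u,v))$ lies in the closure of the graph of $x\mapsto(P_1x,P_2x)$, i.e. if $P_1x$ is proportional to $u$ or zero and $P_2x$ is proportional to $v$ or zero. A configuration $(P_1,P_2,X)$ with $X\subseteq\mathbb P^3$ is a reconstruction of $\Sigma\subseteq\mathbb P^2\times\mathbb P^2$ if every $x\in X$ has an image in $\Sigma$ and every element of $\Sigma$ is an image of some $x\in X$. Two configurations $(P_1,P_2,X)$, $(Q_1,Q_2,Y)$ are equivalent if some $H\in\mathrm{PGL}(4,\mathbb R)$ satisfies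 $H(X)=Y$ and $P_iH^{-1}=Q_i$ up to scale for $i=1,2$; they are conjugate if they are nonequivalent reconstructions of a common set $\Sigma$. The conjugate is non-trivial if $F_P\neq F_Q$ (up to scale), and $(P_1,P_2,X)$ is non-trivially critical if it has a non-trivial conjugate. The set of critical points of $(P_1,P_2)$ with respect to $(Q_1,Q_2)$ is the set of $x\in\mathbb P^3$ having an image under $(P_1,P_2)$ which is also an image of some $y\in\mathbb P^3$ under $(Q_1,Q_2)$. A quadric is given by a nonzero real symmetric $4\times4$ matrix; it is identified with its set of complex points where no multiplicity matters. It is smooth, a cone, two planes (real or complex conjugate), or a double plane if the rank is $4,3,2,1$; its singular locus is the kernel of the matrix (the vertex of a cone, the singular line of two planes). It is ruled if it contains a real line. A quadric $S$ is a *critical quadric* with respect to $(P_1,P_2)$ if it contains $p_1,p_2$ and is of one of the following types, where "on a line" means that the line $\overline{p_1p_2}$ is contained in $S$: | | Type of $S$ | Type of conjugate quadrics | Number of conjugates | |---|---|---|---| | 1 | smooth ruled, centres not on a line | 1 | $2$ | | 2 | smooth ruled, centres on a line | 3 | $1$ | | 3 | cone, centres not on a line | 2 | $1$ | | 4 | cone,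 exactly one centre at the vertex | 4 | $\infty$ | | 5 | two planes, centres in the same plane, neither on the singular line | 5 | $\infty$ | | 6 | two planes, exactly one centre on the singular line | 6 | $\infty$ | | 7 | two planes, both centres on the singular line | 7 | $\infty$ | | 8 | double plane, centres in the plane | 8 | $\infty$ | A *conjugate* of a critical quadric $S$ is a configuration $(Q_1,Q_2,Y)$ with $F_Q\ne F_P$ such that $S$ is the set of critical points of $(P_1,P_2)$ with respect to $(Q_1,Q_2)$ and $Y$ is the set of critical points of $(Q_1,Q_2)$ with respect to $(P_1,P_2)$. **Theorem.** Let $(P_1,P_2)$ be a pair of cameras. 1. For every $X\subseteq\mathbb P^3$, the configuration $(P_1,P_2,X)$ is non-trivially critical if and only if there is a critical quadric (with respect to $P_1,P_2$) containing both camera centres and all of $X$. 2. Let $S$ be a critical quadric. Every conjugate $(Q_1,Q_2,Y)$ of $S$ is a non-trivial conjugate of the configuration $(P_1,P_2,S)$, and $Y$ is a quadric whose type with respect to $(Q_1,Q_2)$ is the one given in the third column of the table. If $S$ is not a double plane, then every non-trivial conjugate $(Q_1,Q_2,Y')$ of the configuration $(P_1,P_2,S)$ satisfies $Y'\subseteq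 Y$ for a conjugate $(Q_1,Q_2,Y)$ of $S$ with the same cameras. The number of conjugates of $S$ up to equivalence is the one given in the last column. -/

import Mathlib

open scoped LinearAlgebra.Projectivization Matrix MatrixGroups

namespace TwoView

noncomputable section

/-- Space points: complex projective 3-space. -/
abbrev Space : Type := ℙ ℂ (Fin 4 → ℂ)

/-- Image points: the complex projective plane. -/
abbrev Image : Type := ℙ ℂ (Fin 3 → ℂ)

/-- A real matrix regarded as a complex one. -/
abbrev cx {m n : Type*} (A : Matrix m n ℝ) : Matrix m n ℂ := A.map (algebraMap ℝ ℂ)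

/-! ### Cameras -/

/-- A camera: a real `3 × 4` matrix of full rank. -/
structure Camera where
  mat : Matrix (Fin 3) (Fin 4) ℝ
  full_rank : mat.rank = 3

lemma Camera.exists_right_inverse (C : Camera) :
    ∃ R : Matrix (Fin 4) (Fin 3) ℝ, C.mat * R = 1 := by
  have hs : Function.Surjective C.mat.mulVecLin := by
    rw [← LinearMap.range_eq_top]
    apply Submodule.eq_top_of_finrank_eq
    have := C.full_rank
    rw [Matrix.rank] at this
    simpa using this
  choose g hg using hs
  refine ⟨Matrix.of fun i j => g (Pi.single j 1) i, ?_⟩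
  ext i j
  have := congrFun (hg (Pi.single j 1)) i
  simpa [Matrix.mul_apply, Matrix.mulVec, dotProduct, Matrix.one_apply, Pi.single_apply] using this

lemma Camera.finrank_ker (C : Camera) :
    Module.finrank ℂ (LinearMap.ker (cx C.mat).mulVecLin) = 1 := by
  obtain ⟨R, hR⟩ := C.exists_right_inverse
  have hR' : cx C.mat * cx R = 1 := by
    rw [← Matrix.map_mul, hR]
    simp
  have hs : LinearMap.range (cx C.mat).mulVecLin = ⊤ := by
    rw [LinearMap.range_eq_top]
    intro v
    exact ⟨cx R *ᵥ v, by simp [hR']⟩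
  have h := LinearMap.finrank_range_add_finrank_ker (cx C.mat).mulVecLin
  rw [hs] at h
  simp at h
  omega

/-- The camera centre: the kernel of the camera matrix, a point of space. -/
def Camera.center (C : Camera) : Space :=
  Projectivization.mk'' (LinearMap.ker (cx C.mat).mulVecLin) C.finrank_ker

/-- `C.Sees x u`: the space point `x` lies on the back-projected line of the image point `u`,
i.e. on the closure of the preimage of `u` under the projection. If `x` is not the centre, this
says that `u` is the image of `x`; the centre lies on all back-projected lines. -/
def Camera.Sees (C : Camera) (x : Space) (u : Image) : Prop :=
  cx C.mat *ᵥ x.rep ∈ u.submodule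

/-- A pair of cameras with distinct centres. -/
structure CameraPair where
  fst : Camera
  snd : Camera
  center_ne : fst.center ≠ snd.center

/-- The closure of the graph of the joint camera map `x ↦ (P₁ x, P₂ x)`. As the two centres are
distinct, it is given by the two conditions `x ∈ closure (Pᵢ⁻¹ (sᵢ))`; outside the two centres it is
the graph itself. -/
def CameraPair.Sees (P : CameraPair) (x : Space) (s : Image × Image) : Prop :=
  P.fst.Sees x s.1 ∧ P.snd.Sees x s.2

/-- The `6 × 6` matrix with block rows `(P₁, x, 0)` and `(P₂, 0, y)`. -/
def CameraPair.jointMatrix (P : CameraPair) (x y : Fin 3 → ℝ) : Matrix (Fin 6) (Fin 6) ℝ :=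
  Matrix.reindex finSumFinEquiv finSumFinEquiv
    (Matrix.fromBlocks P.fst.mat (Matrix.of fun i => ![x i, 0])
      P.snd.mat (Matrix.of fun i => ![0, y i]))

/-- The fundamental matrix: the matrix of the bilinear form `(x, y) ↦ det (P.jointMatrix x y)`. -/
def CameraPair.fundamentalMatrix (P : CameraPair) : Matrix (Fin 3) (Fin 3) ℝ :=
  Matrix.of fun i j => (P.jointMatrix (Pi.single i 1) (Pi.single j 1)).det

/-- Equality of the fundamental matrices as matrices defined up to scale. -/
def CameraPair.SameFundamental (P Q : CameraPair) : Prop :=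
  ∃ c : ℝ, c ≠ 0 ∧ Q.fundamentalMatrix = c • P.fundamentalMatrix

/-! ### Configurations -/

/-- A configuration of two cameras and a set of space points. -/
@[ext]
structure Configuration where
  cameras : CameraPair
  points : Set Space

/-- The configuration `c` is a reconstruction of the set `S` of pairs of image points:
every point of `c` has an image in `S` and every member of `S` is an image of a point of `c`. -/
def Configuration.IsReconstruction (c : Configuration) (S : Set (Image × Image)) : Prop :=
  (∀ x ∈ c.points, ∃ s ∈ S, c.cameras.Sees x s) ∧ (∀ s ∈ S, ∃ x ∈ c.points, c.cameras.Sees x s)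

lemma cx_mul {l m n : Type*} [Fintype m] (A : Matrix l m ℝ) (B : Matrix m n ℝ) :
    cx (A * B) = cx A * cx B := Matrix.map_mul

lemma cx_one {n : Type*} [DecidableEq n] : cx (1 : Matrix n n ℝ) = 1 := by simp

lemma cx_mulVec_injective (H : GL (Fin 4) ℝ) :
    Function.Injective (cx (H : Matrix (Fin 4) (Fin 4) ℝ)).mulVecLin := by
  apply Function.LeftInverse.injective (g := (cx (↑H⁻¹ : Matrix (Fin 4) (Fin 4) ℝ)).mulVecLin)
  intro v
  simp only [Matrix.mulVecLin_apply, Matrix.mulVec_mulVec]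
  rw [← cx_mul, ← Units.val_mul, inv_mul_cancel, Units.val_one, cx_one, Matrix.one_mulVec]

/-- The real projective transformation of space given by an invertible real matrix. -/
def projAct (H : GL (Fin 4) ℝ) : Space → Space :=
  Projectivization.map (cx (H : Matrix (Fin 4) (Fin 4) ℝ)).mulVecLin (cx_mulVec_injective H)

lemma projAct_one : projAct 1 = id := by
  funext x
  induction x using Projectivization.ind with
  | h v hv =>
    simp only [projAct, Projectivization.map_mk, id]
    congr 1
    simp

lemma projAct_mul (H K : GL (Fin 4) ℝ) : projAct (H * K) = projAct H ∘ projAct K := by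
  funext x
  induction x using Projectivization.ind with
  | h v hv =>
    simp only [projAct, Projectivization.map_mk, Function.comp]
    congr 1
    simp only [Matrix.mulVecLin_apply, Matrix.mulVec_mulVec, Units.val_mul, cx_mul]

/-- Equivalence of configurations under `PGL(4)`: `H(X) = Y` and `Pᵢ H⁻¹ = Qᵢ` up to scale. -/
def Configuration.Equivalent (c d : Configuration) : Prop :=
  ∃ H : GL (Fin 4) ℝ, projAct H '' c.points = d.points ∧
    (∃ a : ℝ, a ≠ 0 ∧
      c.cameras.fst.mat * (↑H⁻¹ : Matrix (Fin 4) (Fin 4) ℝ) = a • d.cameras.fst.mat) ∧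
    (∃ b : ℝ, b ≠ 0 ∧
      c.cameras.snd.mat * (↑H⁻¹ : Matrix (Fin 4) (Fin 4) ℝ) = b • d.cameras.snd.mat)

lemma scale_symm {A B : Matrix (Fin 3) (Fin 4) ℝ} {H : GL (Fin 4) ℝ}
    (h : ∃ a : ℝ, a ≠ 0 ∧ A * (↑H⁻¹ : Matrix (Fin 4) (Fin 4) ℝ) = a • B) :
    ∃ a : ℝ, a ≠ 0 ∧ B * (↑(H⁻¹)⁻¹ : Matrix (Fin 4) (Fin 4) ℝ) = a • A := by
  obtain ⟨a, ha, h⟩ := h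
  refine ⟨a⁻¹, inv_ne_zero ha, ?_⟩
  have hB : B = a⁻¹ • (A * (↑H⁻¹ : Matrix (Fin 4) (Fin 4) ℝ)) := by
    rw [h, smul_smul, inv_mul_cancel₀ ha, one_smul]
  rw [hB, inv_inv, Matrix.smul_mul, Matrix.mul_assoc, ← Units.val_mul, inv_mul_cancel,
    Units.val_one, Matrix.mul_one]

lemma scale_trans {A B C : Matrix (Fin 3) (Fin 4) ℝ} {H K : GL (Fin 4) ℝ}
    (h : ∃ a : ℝ, a ≠ 0 ∧ A * (↑H⁻¹ : Matrix (Fin 4) (Fin 4) ℝ) = a • B)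
    (k : ∃ a : ℝ, a ≠ 0 ∧ B * (↑K⁻¹ : Matrix (Fin 4) (Fin 4) ℝ) = a • C) :
    ∃ a : ℝ, a ≠ 0 ∧ A * (↑(K * H)⁻¹ : Matrix (Fin 4) (Fin 4) ℝ) = a • C := by
  obtain ⟨a, ha, h⟩ := h
  obtain ⟨b, hb, k⟩ := k
  refine ⟨a * b, mul_ne_zero ha hb, ?_⟩
  rw [mul_inv_rev, Units.val_mul, ← Matrix.mul_assoc, h, Matrix.smul_mul, k, smul_smul]

/-- Configurations up to the action of `PGL(4)`. -/
instance configurationSetoid : Setoid Configuration where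
  r := Configuration.Equivalent
  iseqv :=
    { refl := fun c => ⟨1, by simp [projAct_one], ⟨1, by simp⟩, ⟨1, by simp⟩⟩
      symm := by
        rintro c d ⟨H, hX, h₁, h₂⟩
        refine ⟨H⁻¹, ?_, scale_symm h₁, scale_symm h₂⟩
        rw [← hX, ← Set.image_comp, ← projAct_mul, inv_mul_cancel, projAct_one, Set.image_id]
      trans := by
        rintro c d e ⟨H, hX, h₁, h₂⟩ ⟨K, kX, k₁, k₂⟩
        refine ⟨K * H, ?_, scale_trans h₁ k₁, scale_trans h₂ k₂⟩
        rw [projAct_mul, Set.image_comp, hX, kX] }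

/-- Conjugate configurations: nonequivalent reconstructions of the same set. -/
def Configuration.Conjugate (c d : Configuration) : Prop :=
  (∃ S : Set (Image × Image), c.IsReconstruction S ∧ d.IsReconstruction S) ∧ ¬ c.Equivalent d

/-- A conjugate whose fundamental matrix is different (up to scale). -/
def Configuration.NontrivialConjugate (c d : Configuration) : Prop :=
  c.Conjugate d ∧ ¬ c.cameras.SameFundamental d.cameras

/-- A non-trivial critical configuration. -/
def Configuration.NontriviallyCritical (c : Configuration) : Prop :=
  ∃ d : Configuration, c.NontrivialConjugate d

/-- The set of critical points of `P` with respect to `Q`. -/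
def criticalPoints (P Q : CameraPair) : Set Space :=
  {x | ∃ y : Space, ∃ s : Image × Image, P.Sees x s ∧ Q.Sees y s}

/-! ### Quadrics -/

/-- A real quadric surface, given by a nonzero real symmetric matrix. -/
structure Quadric where
  mat : Matrix (Fin 4) (Fin 4) ℝ
  symm : mat.IsSymm
  ne_zero : mat ≠ 0

/-- The complex points of a quadric. -/
def Quadric.points (S : Quadric) : Set Space :=
  {x | x.rep ⬝ᵥ (cx S.mat *ᵥ x.rep) = 0}

/-- The singular locus of a quadric: empty, a point, a line or a plane if the rank of the matrix is
`4`, `3`, `2` or `1`. -/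
def Quadric.singularLocus (S : Quadric) : Set Space :=
  {x | cx S.mat *ᵥ x.rep = 0}

/-- A quadric is ruled if it contains a real line. -/
def Quadric.IsRuled (S : Quadric) : Prop :=
  ∃ W : Submodule ℝ (Fin 4 → ℝ), Module.finrank ℝ W = 2 ∧ ∀ w ∈ W, w ⬝ᵥ (S.mat *ᵥ w) = 0

def Quadric.IsSmooth (S : Quadric) : Prop := S.mat.rank = 4

def Quadric.IsCone (S : Quadric) : Prop := S.mat.rank = 3

/-- Two distinct planes, possibly complex conjugates. -/
def Quadric.IsTwoPlanes (S : Quadric) : Prop := S.mat.rank = 2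

def Quadric.IsDoublePlane (S : Quadric) : Prop := S.mat.rank = 1

/-- The line spanned by two distinct points. -/
def lineThrough (p q : Space) : Set Space :=
  {x | x.submodule ≤ p.submodule ⊔ q.submodule}

/-- The plane with equation `l`. -/
def plane (l : Fin 4 → ℂ) : Set Space := {x | l ⬝ᵥ x.rep = 0}

/-- The (distinct) points `p` and `q` lie on a common line of the quadric. -/
def Quadric.OnCommonLine (S : Quadric) (p q : Space) : Prop := lineThrough p q ⊆ S.points

/-- The points `p` and `q` lie in a common plane of the quadric. -/
def Quadric.InCommonPlane (S : Quadric) (p q : Space) : Prop :=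
  ∃ l : Fin 4 → ℂ, l ≠ 0 ∧ plane l ⊆ S.points ∧ p ∈ plane l ∧ q ∈ plane l

/-- The rows of the table of critical quadrics. -/
inductive QuadricType
  /-- smooth ruled quadric, camera centres not on a line -/
  | smoothNotOnLine
  /-- smooth ruled quadric, camera centres on a line -/
  | smoothOnLine
  /-- cone, camera centres not on a line -/
  | coneNotOnLine
  /-- cone, one camera centre at the vertex, the other one not -/
  | coneVertex
  /-- two planes, camera centres in the same plane, neither on the singular line -/
  | planesSamePlane
  /-- two planes, exactly one camera centre on the singular line -/
  | planesOneSingular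
  /-- two planes, both camera centres on the singular line -/
  | planesBothSingular
  /-- a double plane, camera centres in the plane -/
  | doublePlane

/-- The quadric `S` and the camera centres of `P` (which lie on `S`) are of the given type. -/
def Quadric.HasType (S : Quadric) (P : CameraPair) (t : QuadricType) : Prop :=
  P.fst.center ∈ S.points ∧ P.snd.center ∈ S.points ∧
  match t with
  | .smoothNotOnLine =>
      S.IsSmooth ∧ S.IsRuled ∧ ¬ S.OnCommonLine P.fst.center P.snd.center
  | .smoothOnLine =>
      S.IsSmooth ∧ S.IsRuled ∧ S.OnCommonLine P.fst.center P.snd.center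
  | .coneNotOnLine =>
      S.IsCone ∧ ¬ S.OnCommonLine P.fst.center P.snd.center
  | .coneVertex =>
      S.IsCone ∧ Xor (P.fst.center ∈ S.singularLocus) (P.snd.center ∈ S.singularLocus)
  | .planesSamePlane =>
      S.IsTwoPlanes ∧ S.InCommonPlane P.fst.center P.snd.center ∧
        P.fst.center ∉ S.singularLocus ∧ P.snd.center ∉ S.singularLocus
  | .planesOneSingular =>
      S.IsTwoPlanes ∧ Xor (P.fst.center ∈ S.singularLocus) (P.snd.center ∈ S.singularLocus)
  | .planesBothSingular =>
      S.IsTwoPlanes ∧ P.fst.center ∈ S.singularLocus ∧ P.snd.center ∈ S.singularLocus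
  | .doublePlane => S.IsDoublePlane

/-- A critical quadric with respect to a pair of cameras. -/
def Quadric.IsCritical (S : Quadric) (P : CameraPair) : Prop :=
  ∃ t : QuadricType, S.HasType P t

/-- The type of the conjugate quadrics. -/
def QuadricType.conjugate : QuadricType → QuadricType
  | .smoothOnLine => .coneNotOnLine
  | .coneNotOnLine => .smoothOnLine
  | t => t

/-- The number of conjugates. -/
def QuadricType.numConjugates : QuadricType → ℕ∞
  | .smoothNotOnLine => 2
  | .smoothOnLine => 1
  | .coneNotOnLine => 1
  | _ => ⊤

/-- The conjugates of the quadric `S` with respect to the cameras `P`: the configurations `(Q, Y)`,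
with a fundamental matrix different from that of `P`, for which `S` is the set of critical points of
`P` with respect to `Q` and `Y` is the set of critical points of `Q` with respect to `P`. -/
def Quadric.conjugates (S : Quadric) (P : CameraPair) : Set Configuration :=
  {d | ¬ P.SameFundamental d.cameras ∧ S.points = criticalPoints P d.cameras ∧
    d.points = criticalPoints d.cameras P}

/-- The number of conjugates of the quadric `S`, where equivalent configurations are identified. -/
def Quadric.conjugateCount (S : Quadric) (P : CameraPair) : ℕ∞ :=
  (Quotient.mk configurationSetoid '' S.conjugates P).encard

end

end TwoView

/-! A pair (u, v) is an image under Q exactly when uᵀ F_Q v = 0, because a common preimage is a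
kernel vector of the joint matrix (`CameraPair.epipolar_iff`). Hence the critical points of P with
respect to Q form the quadric (P₁x)ᵀ F_Q (P₂x) = 0 with matrix `P.quadMat` of F_Q. The linear map
`P.quadMat` sends 3×3 matrices onto the symmetric matrices of quadrics through both centres, and its
kernel is the line spanned by F_P (`CameraPair.quadMat_eq_zero_iff`). Since the complex points
determine the matrix of a quadric up to scale (`Quadric.exists_smul_of_points_eq`), the conjugates
of a quadric S with matrix `P.quadMat F` have, up to scale, the fundamental matrices of rank two
among F + x F_P. Every real matrix of rank two is a fundamental matrix (`exists_cameraPair`) and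
determines its cameras up to a projective transformation
(`CameraPair.SameFundamental.exists_projective`). So conjugates up to equivalence correspond to such
values of x (`conjugateCount_eq`).

In coordinates that turn the cameras into coordinate projections, F_P becomes a multiple of the skew
matrix `stdFund`, and det (g + x `stdFund`) is a polynomial in x of degree at most two. Its leading
coefficient vanishes exactly when the line of centres lies on S, and its discriminant is det S up to
a positive factor. It has two roots for a smooth ruled quadric off the line of centres, one root if
that line lies on the smooth quadric, and a double root for a cone not containing the line. In the
other rows of the table it vanishes identically; rank one is possible only at roots of a monic
quadratic in x, so infinitely many values remain.

The type of S depends only on the pencil spanned by F_P and F_Q: on the mixed coefficients of det (a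
F_P + b F_Q), on common kernel vectors, and on members of rank one (`hasType_of_pencilType`). The
quadric Y comes from the same pencil with the two matrices exchanged. This swaps the two mixed
coefficients and preserves everything else, which gives the third column of the table
(`PencilType.swap`). -/

namespace TwoView

noncomputable section

/-! ### Real vectors as complex vectors, and representatives of projective points -/

/-- A real vector regarded as a complex one. -/
def cxv {n : Type*} (v : n → ℝ) : n → ℂ := fun i => (v i : ℂ)

lemma cxv_ne_zero {n : Type*} {v : n → ℝ} (hv : v ≠ 0) : cxv v ≠ 0 := by
  contrapose! hv
  funext i
  have := congrFun hv i
  simpa [cxv] using this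

lemma cx_mulVec_cxv {m n : Type*} [Fintype n] (A : Matrix m n ℝ) (v : n → ℝ) :
    cx A *ᵥ cxv v = cxv (A *ᵥ v) := by
  funext i
  simp [Matrix.mulVec, dotProduct, cxv]

lemma cxv_dotProduct_cxv {n : Type*} [Fintype n] (u v : n → ℝ) :
    cxv u ⬝ᵥ cxv v = ((u ⬝ᵥ v : ℝ) : ℂ) := by
  simp [dotProduct, cxv]

lemma cx_transpose {m n : Type*} (A : Matrix m n ℝ) : cx Aᵀ = (cx A)ᵀ := rfl

lemma cx_add {m n : Type*} (A B : Matrix m n ℝ) : cx (A + B) = cx A + cx B := by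
  ext i j; simp

lemma cx_smul {m n : Type*} (c : ℝ) (A : Matrix m n ℝ) : cx (c • A) = (c : ℂ) • cx A := by
  ext i j; simp

lemma cx_injective {m n : Type*} : Function.Injective (cx : Matrix m n ℝ → Matrix m n ℂ) := by
  intro A B h
  ext i j
  have := congrFun (congrFun h i) j
  simpa using this

lemma exists_rep_mk {n : Type*} (v : n → ℂ) (hv : v ≠ 0) :
    ∃ a : ℂ, a ≠ 0 ∧ (Projectivization.mk ℂ v hv).rep = a • v := by
  obtain ⟨a, ha⟩ := Projectivization.exists_smul_eq_mk_rep ℂ v hv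
  exact ⟨a, a.ne_zero, ha.symm⟩

lemma Quadric.mk_mem_points (S : Quadric) {v : Fin 4 → ℂ} (hv : v ≠ 0) :
    Projectivization.mk ℂ v hv ∈ S.points ↔ v ⬝ᵥ (cx S.mat *ᵥ v) = 0 := by
  obtain ⟨a, ha, h⟩ := exists_rep_mk v hv
  simp only [Quadric.points, Set.mem_ofPred_eq, h, Matrix.mulVec_smul, dotProduct_smul,
    smul_dotProduct, smul_eq_mul, mul_eq_zero, ha, false_or]

lemma Quadric.mk_mem_singularLocus (S : Quadric) {v : Fin 4 → ℂ} (hv : v ≠ 0) :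
    Projectivization.mk ℂ v hv ∈ S.singularLocus ↔ cx S.mat *ᵥ v = 0 := by
  obtain ⟨a, ha, h⟩ := exists_rep_mk v hv
  simp only [Quadric.singularLocus, Set.mem_ofPred_eq, h, Matrix.mulVec_smul, smul_eq_zero, ha,
    false_or]

lemma mk_mem_plane (l : Fin 4 → ℂ) {v : Fin 4 → ℂ} (hv : v ≠ 0) :
    Projectivization.mk ℂ v hv ∈ plane l ↔ l ⬝ᵥ v = 0 := by
  obtain ⟨a, ha, h⟩ := exists_rep_mk v hv
  simp only [plane, Set.mem_ofPred_eq, h, dotProduct_smul, smul_eq_mul, mul_eq_zero, ha, false_or]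

lemma mk_mem_lineThrough {p q v : Fin 4 → ℂ} (hp : p ≠ 0) (hq : q ≠ 0) (hv : v ≠ 0) :
    Projectivization.mk ℂ v hv ∈
      lineThrough (Projectivization.mk ℂ p hp) (Projectivization.mk ℂ q hq) ↔
      ∃ a b : ℂ, a • p + b • q = v := by
  simp only [lineThrough, Set.mem_ofPred_eq, Projectivization.submodule_mk,
    Submodule.span_singleton_le_iff_mem, ← Submodule.span_union, Set.singleton_union]
  rw [Submodule.mem_span_pair]

lemma Camera.center_eq (C : Camera) {v : Fin 4 → ℂ} (hv : v ≠ 0) (h : cx C.mat *ᵥ v = 0) :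
    C.center = Projectivization.mk ℂ v hv := by
  apply Projectivization.submodule_injective
  rw [Camera.center, Projectivization.submodule_mk'', Projectivization.submodule_mk]
  symm
  apply Submodule.eq_of_le_of_finrank_eq
  · rw [Submodule.span_singleton_le_iff_mem]
    simpa using h
  · rw [C.finrank_ker, finrank_span_singleton hv]

lemma Camera.sees_iff (C : Camera) (x : Space) (u : Image) :
    C.Sees x u ↔ ∃ a : ℂ, cx C.mat *ᵥ x.rep = a • u.rep := by
  rw [Camera.Sees, Projectivization.submodule_eq, Submodule.mem_span_singleton]
  simp only [eq_comm]

lemma Camera.sees_mk_iff (C : Camera) {z : Fin 4 → ℂ} (hz : z ≠ 0) (u : Image) :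
    C.Sees (Projectivization.mk ℂ z hz) u ↔ ∃ a : ℂ, cx C.mat *ᵥ z = a • u.rep := by
  obtain ⟨c, hc, h⟩ := exists_rep_mk z hz
  rw [C.sees_iff, h, Matrix.mulVec_smul]
  constructor
  · rintro ⟨a, ha⟩
    exact ⟨c⁻¹ * a, by rw [mul_smul, ← ha, inv_smul_smul₀ hc]⟩
  · rintro ⟨a, ha⟩
    exact ⟨c * a, by rw [ha, mul_smul]⟩

/-! ### The fundamental matrix as a bilinear form -/

/-- The row indices of the joint matrix. -/
def rowIdx : Fin 3 ⊕ Fin 3 ≃ Fin 6 := finSumFinEquiv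

/-- The column indices of the joint matrix. -/
def colIdx : Fin 4 ⊕ Fin 2 ≃ Fin 6 := finSumFinEquiv

/-- The matrix with block rows `(A, x, 0)` and `(B, 0, y)` over any ring. -/
def joint {K : Type*} [CommRing K] (A B : Matrix (Fin 3) (Fin 4) K) (x y : Fin 3 → K) :
    Matrix (Fin 6) (Fin 6) K :=
  Matrix.reindex rowIdx colIdx
    (Matrix.fromBlocks A (Matrix.of fun i => ![x i, 0]) B (Matrix.of fun i => ![0, y i]))

section joint

variable {K : Type*} [CommRing K] (A B : Matrix (Fin 3) (Fin 4) K)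

/-- Only one column depends on `x`, so the determinant is linear in `x`. -/
lemma joint_eq_updateCol_left (x y : Fin 3 → K) :
    joint A B x y = (joint A B 0 y).updateCol (colIdx (Sum.inr 0))
      (fun i => Sum.elim x (0 : Fin 3 → K) (rowIdx.symm i)) := by
  ext i j
  obtain ⟨i, rfl⟩ := rowIdx.surjective i
  obtain ⟨j, rfl⟩ := colIdx.surjective j
  simp only [Matrix.updateCol_apply, Equiv.apply_eq_iff_eq]
  rcases i with i | i <;> rcases j with j | j
  · simp [joint]
  · fin_cases j <;> simp [joint]
  · simp [joint]
  · fin_cases j <;> simp [joint]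

lemma joint_eq_updateCol_right (x y : Fin 3 → K) :
    joint A B x y = (joint A B x 0).updateCol (colIdx (Sum.inr 1))
      (fun i => Sum.elim (0 : Fin 3 → K) y (rowIdx.symm i)) := by
  ext i j
  obtain ⟨i, rfl⟩ := rowIdx.surjective i
  obtain ⟨j, rfl⟩ := colIdx.surjective j
  simp only [Matrix.updateCol_apply, Equiv.apply_eq_iff_eq]
  rcases i with i | i <;> rcases j with j | j
  · simp [joint]
  · fin_cases j <;> simp [joint]
  · simp [joint]
  · fin_cases j <;> simp [joint]

/-- The determinant of the joint matrix as a bilinear form. -/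
def jointForm : (Fin 3 → K) →ₗ[K] (Fin 3 → K) →ₗ[K] K :=
  LinearMap.mk₂ K (fun x y => (joint A B x y).det)
    (fun x x' y => by
      rw [joint_eq_updateCol_left A B (_ + _) y, joint_eq_updateCol_left A B x y,
        joint_eq_updateCol_left A B x' y, ← Matrix.det_updateCol_add]
      congr 2
      funext i
      obtain ⟨i, rfl⟩ := rowIdx.surjective i
      rcases i with i | i <;> simp)
    (fun c x y => by
      rw [joint_eq_updateCol_left A B (_ • _) y, joint_eq_updateCol_left A B x y,
        smul_eq_mul, ← Matrix.det_updateCol_smul]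
      congr 2
      funext i
      obtain ⟨i, rfl⟩ := rowIdx.surjective i
      rcases i with i | i <;> simp)
    (fun x y y' => by
      rw [joint_eq_updateCol_right A B x (_ + _), joint_eq_updateCol_right A B x y,
        joint_eq_updateCol_right A B x y', ← Matrix.det_updateCol_add]
      congr 2
      funext i
      obtain ⟨i, rfl⟩ := rowIdx.surjective i
      rcases i with i | i <;> simp)
    (fun c x y => by
      rw [joint_eq_updateCol_right A B x (_ • _), joint_eq_updateCol_right A B x y,
        smul_eq_mul, ← Matrix.det_updateCol_smul]
      congr 2
      funext i
      obtain ⟨i, rfl⟩ := rowIdx.surjective i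
      rcases i with i | i <;> simp)

lemma jointForm_apply (x y : Fin 3 → K) : jointForm A B x y = (joint A B x y).det := by
  rw [jointForm, LinearMap.mk₂_apply]

end joint

lemma CameraPair.fundamentalMatrix_apply (P : CameraPair) (i j : Fin 3) :
    P.fundamentalMatrix i j =
      (joint P.fst.mat P.snd.mat (Pi.single i 1) (Pi.single j 1)).det := by
  rw [CameraPair.fundamentalMatrix, Matrix.of_apply, CameraPair.jointMatrix, joint, rowIdx, colIdx]

lemma CameraPair.cx_fundamentalMatrix (P : CameraPair) :
    cx P.fundamentalMatrix = LinearMap.toMatrix₂' ℂ (jointForm (cx P.fst.mat) (cx P.snd.mat)) := by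
  ext i j
  rw [LinearMap.toMatrix₂'_apply]
  rw [jointForm_apply, cx, Matrix.map_apply, P.fundamentalMatrix_apply, RingHom.map_det]
  congr 1
  ext k l
  obtain ⟨k, rfl⟩ := rowIdx.surjective k
  obtain ⟨l, rfl⟩ := colIdx.surjective l
  rcases k with k | k <;> rcases l with l | l
  · simp [joint]
  · fin_cases l <;> simp [joint, Pi.single_apply, apply_ite]
  · simp [joint]
  · fin_cases l <;> simp [joint, Pi.single_apply, apply_ite]

/-- The determinant is bilinear in `u` and `v`, and the entries of the fundamental matrix are its
values on basis vectors. -/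
lemma CameraPair.det_joint (P : CameraPair) (u v : Fin 3 → ℂ) :
    (joint (cx P.fst.mat) (cx P.snd.mat) u v).det = u ⬝ᵥ (cx P.fundamentalMatrix *ᵥ v) := by
  rw [← Matrix.toLinearMap₂'_apply', P.cx_fundamentalMatrix, Matrix.toLinearMap₂'_toMatrix',
    jointForm_apply]

/-- Kernel vectors of the joint matrix encode space points projecting to `u` and `v`; the last two
coordinates are minus the scale factors. -/
lemma joint_mulVec (A B : Matrix (Fin 3) (Fin 4) ℂ) (u v : Fin 3 → ℂ) (z : Fin 4 → ℂ) (a b : ℂ) :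
    joint A B u v *ᵥ (Sum.elim z ![a, b] ∘ colIdx.symm) = 0 ↔
      A *ᵥ z + a • u = 0 ∧ B *ᵥ z + b • v = 0 := by
  have h₁ : (Matrix.of fun i => ![u i, 0]) *ᵥ ![a, b] = a • u := by
    funext i; simp [Matrix.mulVec, dotProduct, Fin.sum_univ_two, mul_comm]
  have h₂ : (Matrix.of fun i => ![0, v i]) *ᵥ ![a, b] = b • v := by
    funext i; simp [Matrix.mulVec, dotProduct, Fin.sum_univ_two, mul_comm]
  rw [joint, Matrix.reindex_apply, Matrix.submatrix_mulVec_equiv, Matrix.fromBlocks_mulVec]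
  have hc : (Sum.elim z ![a, b] ∘ colIdx.symm) ∘
      (colIdx.symm).symm = Sum.elim z ![a, b] := by
    funext i; simp
  rw [hc, Sum.elim_comp_inl, Sum.elim_comp_inr, h₁, h₂]
  constructor
  · intro h
    constructor
    · funext i
      simpa using congrFun h (rowIdx (Sum.inl i))
    · funext i
      simpa using congrFun h (rowIdx (Sum.inr i))
  · rintro ⟨h, h'⟩
    rw [h, h']
    funext i
    obtain ⟨i, rfl⟩ := rowIdx.surjective i
    rcases i with i | i <;> simp

/-- A pair of image points satisfies the epipolar constraint if and only if it is an image. -/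
lemma CameraPair.epipolar_iff (P : CameraPair) {u v : Fin 3 → ℂ} (hu : u ≠ 0) (hv : v ≠ 0) :
    u ⬝ᵥ (cx P.fundamentalMatrix *ᵥ v) = 0 ↔
      ∃ z : Fin 4 → ℂ, z ≠ 0 ∧ (∃ a : ℂ, cx P.fst.mat *ᵥ z = a • u) ∧
        ∃ b : ℂ, cx P.snd.mat *ᵥ z = b • v := by
  rw [← P.det_joint, ← Matrix.exists_mulVec_eq_zero_iff]
  constructor
  · rintro ⟨w, hw, h⟩
    obtain ⟨z, a, b, rfl⟩ : ∃ z a b, w = Sum.elim z ![a, b] ∘ colIdx.symm := by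
      refine ⟨fun i => w (colIdx (Sum.inl i)), w (colIdx (Sum.inr 0)),
        w (colIdx (Sum.inr 1)), ?_⟩
      funext i
      obtain ⟨i, rfl⟩ := colIdx.surjective i
      rcases i with i | i
      · simp
      · fin_cases i <;> simp
    rw [joint_mulVec] at h
    refine ⟨z, ?_, ⟨-a, ?_⟩, ⟨-b, ?_⟩⟩
    -- If `z` were zero, `a • u` and `b • v` would vanish, and with them the whole kernel vector.
    · rintro rfl
      simp only [Matrix.mulVec_zero, zero_add, smul_eq_zero, hu, hv, or_false] at h
      apply hw
      rw [h.1, h.2]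
      funext i
      obtain ⟨i, rfl⟩ := colIdx.surjective i
      rcases i with i | i
      · simp
      · fin_cases i <;> simp
    · rw [neg_smul]; exact eq_neg_of_add_eq_zero_left h.1
    · rw [neg_smul]; exact eq_neg_of_add_eq_zero_left h.2
  · rintro ⟨z, hz, ⟨a, ha⟩, b, hb⟩
    refine ⟨Sum.elim z ![-a, -b] ∘ colIdx.symm, ?_, ?_⟩
    · contrapose! hz
      funext i
      simpa using congrFun hz (colIdx (Sum.inl i))
    · rw [joint_mulVec]
      simp [ha, hb]

lemma CameraPair.exists_sees_iff (P : CameraPair) (s : Image × Image) :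
    (∃ x, P.Sees x s) ↔ s.1.rep ⬝ᵥ (cx P.fundamentalMatrix *ᵥ s.2.rep) = 0 := by
  rw [P.epipolar_iff s.1.rep_nonzero s.2.rep_nonzero]
  constructor
  · rintro ⟨x, h₁, h₂⟩
    exact ⟨x.rep, x.rep_nonzero, (P.fst.sees_iff x _).1 h₁, (P.snd.sees_iff x _).1 h₂⟩
  · rintro ⟨z, hz, h₁, h₂⟩
    exact ⟨Projectivization.mk ℂ z hz, (P.fst.sees_mk_iff hz _).2 h₁, (P.snd.sees_mk_iff hz _).2 h₂⟩

/-! ### The set of critical points is a quadric -/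

lemma CameraPair.eq_zero_of_mulVec_eq_zero (P : CameraPair) {z : Fin 4 → ℂ}
    (h₁ : cx P.fst.mat *ᵥ z = 0) (h₂ : cx P.snd.mat *ᵥ z = 0) : z = 0 := by
  by_contra hz
  exact P.center_ne ((P.fst.center_eq hz h₁).trans (P.snd.center_eq hz h₂).symm)

lemma CameraPair.eq_zero_of_mulVec_eq_zero_real (P : CameraPair) {z : Fin 4 → ℝ}
    (h₁ : P.fst.mat *ᵥ z = 0) (h₂ : P.snd.mat *ᵥ z = 0) : z = 0 := by
  by_contra hz
  refine cxv_ne_zero hz (P.eq_zero_of_mulVec_eq_zero ?_ ?_)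
  · rw [cx_mulVec_cxv, h₁]; funext i; simp [cxv]
  · rw [cx_mulVec_cxv, h₂]; funext i; simp [cxv]

/-- Away from the centres the image of `x` is unique and the epipolar constraint of `Q` applies to
it. At a centre one image point is free, and the constraint is a single linear condition on it, so
it can be satisfied. -/
lemma CameraPair.mem_criticalPoints (P Q : CameraPair) (x : Space) :
    x ∈ criticalPoints P Q ↔ (cx P.fst.mat *ᵥ x.rep) ⬝ᵥ
      (cx Q.fundamentalMatrix *ᵥ (cx P.snd.mat *ᵥ x.rep)) = 0 := by
  have key : x ∈ criticalPoints P Q ↔ ∃ u v : Fin 3 → ℂ, u ≠ 0 ∧ v ≠ 0 ∧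
      (∃ a : ℂ, cx P.fst.mat *ᵥ x.rep = a • u) ∧ (∃ b : ℂ, cx P.snd.mat *ᵥ x.rep = b • v) ∧
      u ⬝ᵥ (cx Q.fundamentalMatrix *ᵥ v) = 0 := by
    constructor
    · rintro ⟨y, s, ⟨h₁, h₂⟩, hs⟩
      exact ⟨s.1.rep, s.2.rep, s.1.rep_nonzero, s.2.rep_nonzero, (P.fst.sees_iff _ _).1 h₁,
        (P.snd.sees_iff _ _).1 h₂, (Q.exists_sees_iff s).1 ⟨y, hs⟩⟩
    · rintro ⟨u, v, hu, hv, ⟨a, ha⟩, ⟨b, hb⟩, h⟩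
      obtain ⟨c, hc, hcu⟩ := exists_rep_mk u hu
      obtain ⟨d, hd, hdv⟩ := exists_rep_mk v hv
      obtain ⟨y, hy⟩ := (Q.exists_sees_iff (Projectivization.mk ℂ u hu, Projectivization.mk ℂ v hv)).2
        (by simp only [hcu, hdv, Matrix.mulVec_smul, smul_dotProduct, dotProduct_smul, h, smul_zero])
      refine ⟨y, _, ⟨(P.fst.sees_iff _ _).2 ⟨a * c⁻¹, ?_⟩, (P.snd.sees_iff _ _).2 ⟨b * d⁻¹, ?_⟩⟩, hy⟩
      · rw [ha, hcu, mul_smul, inv_smul_smul₀ hc]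
      · rw [hb, hdv, mul_smul, inv_smul_smul₀ hd]
  rw [key]
  constructor
  · rintro ⟨u, v, -, -, ⟨a, ha⟩, ⟨b, hb⟩, h⟩
    rw [ha, hb, Matrix.mulVec_smul, smul_dotProduct, dotProduct_smul, h, smul_zero, smul_zero]
  · intro h
    -- At the first centre `u` is arbitrary, and one linear equation in three unknowns has a nonzero
    -- solution.
    by_cases h₁ : cx P.fst.mat *ᵥ x.rep = 0
    · have h₂ : cx P.snd.mat *ᵥ x.rep ≠ 0 := fun h₂ =>
        x.rep_nonzero (P.eq_zero_of_mulVec_eq_zero h₁ h₂)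
      obtain ⟨u, hu, hu'⟩ := exists_ne_zero_dotProduct_eq_zero
        (cx Q.fundamentalMatrix *ᵥ (cx P.snd.mat *ᵥ x.rep))
      exact ⟨u, _, hu, h₂, ⟨0, by rw [h₁, zero_smul]⟩, ⟨1, (one_smul _ _).symm⟩, hu'⟩
    · by_cases h₂ : cx P.snd.mat *ᵥ x.rep = 0
      · obtain ⟨v, hv, hv'⟩ := exists_ne_zero_dotProduct_eq_zero
          ((cx P.fst.mat *ᵥ x.rep) ᵥ* cx Q.fundamentalMatrix)
        refine ⟨_, v, h₁, hv, ⟨1, (one_smul _ _).symm⟩, ⟨0, by rw [h₂, zero_smul]⟩, ?_⟩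
        rw [Matrix.dotProduct_mulVec, dotProduct_comm, hv']
      · exact ⟨_, _, h₁, h₂, ⟨1, (one_smul _ _).symm⟩, ⟨1, (one_smul _ _).symm⟩, h⟩

/-- Twice the symmetric matrix of the quadratic form `z ↦ (P₁ z)ᵀ F (P₂ z)`. -/
def CameraPair.quadMat (P : CameraPair) (F : Matrix (Fin 3) (Fin 3) ℝ) :
    Matrix (Fin 4) (Fin 4) ℝ :=
  P.fst.matᵀ * F * P.snd.mat + (P.fst.matᵀ * F * P.snd.mat)ᵀ

lemma CameraPair.quadMat_isSymm (P : CameraPair) (F : Matrix (Fin 3) (Fin 3) ℝ) :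
    (P.quadMat F).IsSymm := by
  rw [Matrix.IsSymm, CameraPair.quadMat, Matrix.transpose_add, Matrix.transpose_transpose, add_comm]

lemma CameraPair.quadMat_form (P : CameraPair) (F : Matrix (Fin 3) (Fin 3) ℝ) (z : Fin 4 → ℂ) :
    z ⬝ᵥ (cx (P.quadMat F) *ᵥ z) =
      2 * ((cx P.fst.mat *ᵥ z) ⬝ᵥ (cx F *ᵥ (cx P.snd.mat *ᵥ z))) := by
  have h : z ⬝ᵥ (cx (P.fst.matᵀ * F * P.snd.mat) *ᵥ z) =
      (cx P.fst.mat *ᵥ z) ⬝ᵥ (cx F *ᵥ (cx P.snd.mat *ᵥ z)) := by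
    rw [cx_mul, cx_mul, ← Matrix.mulVec_mulVec, ← Matrix.mulVec_mulVec, cx_transpose,
      Matrix.dotProduct_mulVec, Matrix.vecMul_transpose]
  rw [CameraPair.quadMat, cx_add, Matrix.add_mulVec, dotProduct_add, h, cx_transpose,
    Matrix.mulVec_transpose, dotProduct_comm z, ← Matrix.dotProduct_mulVec, h, two_mul]

lemma CameraPair.quadMat_smul (P : CameraPair) (c : ℝ) (F : Matrix (Fin 3) (Fin 3) ℝ) :
    P.quadMat (c • F) = c • P.quadMat F := by
  simp [CameraPair.quadMat]

lemma CameraPair.quadMat_add (P : CameraPair) (F G : Matrix (Fin 3) (Fin 3) ℝ) :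
    P.quadMat (F + G) = P.quadMat F + P.quadMat G := by
  simp only [CameraPair.quadMat, Matrix.mul_add, Matrix.add_mul, Matrix.transpose_add]
  abel

lemma CameraPair.mem_criticalPoints_iff_quadMat (P Q : CameraPair) (x : Space) :
    x ∈ criticalPoints P Q ↔
      x.rep ⬝ᵥ (cx (P.quadMat Q.fundamentalMatrix) *ᵥ x.rep) = 0 := by
  rw [P.mem_criticalPoints, P.quadMat_form]
  simp

/-- Symmetric matrices with proportional quadratic forms are proportional. -/
lemma eq_smul_of_form_eq {A B : Matrix (Fin 4) (Fin 4) ℂ} (hA : A.IsSymm) (hB : B.IsSymm) (c : ℂ)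
    (h : ∀ z, z ⬝ᵥ (A *ᵥ z) = c * (z ⬝ᵥ (B *ᵥ z))) : A = c • B := by
  have pol : ∀ {M : Matrix (Fin 4) (Fin 4) ℂ}, M.IsSymm → ∀ x y : Fin 4 → ℂ,
      (x + y) ⬝ᵥ (M *ᵥ (x + y)) = x ⬝ᵥ (M *ᵥ x) + y ⬝ᵥ (M *ᵥ y) + 2 * (x ⬝ᵥ (M *ᵥ y)) := by
    intro M hM x y
    have : y ⬝ᵥ (M *ᵥ x) = x ⬝ᵥ (M *ᵥ y) := by
      rw [dotProduct_comm, Matrix.dotProduct_mulVec x, ← Matrix.mulVec_transpose, hM]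
    rw [Matrix.mulVec_add, add_dotProduct, dotProduct_add, dotProduct_add, this]
    ring
  ext i j
  have h₁ := pol hA (Pi.single i 1) (Pi.single j 1)
  have h₂ := pol hB (Pi.single i 1) (Pi.single j 1)
  rw [h, h, h, h₂] at h₁
  have e : ∀ M : Matrix (Fin 4) (Fin 4) ℂ,
      (Pi.single i 1 : Fin 4 → ℂ) ⬝ᵥ (M *ᵥ (Pi.single j 1 : Fin 4 → ℂ)) = M i j := by
    intro M; simp
  rw [e, e] at h₁
  rw [Matrix.smul_apply, smul_eq_mul]
  linear_combination -(1 / 2) * h₁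

lemma isSymm_cx {A : Matrix (Fin 4) (Fin 4) ℝ} (hA : A.IsSymm) : (cx A).IsSymm := by
  rw [Matrix.IsSymm, ← cx_transpose, hA]

/-- Each pair (P₁ z, P₂ z) satisfies the epipolar constraint of `P` itself, so the quadratic form
vanishes identically. -/
lemma CameraPair.quadMat_fundamentalMatrix (P : CameraPair) :
    P.quadMat P.fundamentalMatrix = 0 := by
  apply cx_injective
  have := eq_smul_of_form_eq (isSymm_cx (P.quadMat_isSymm P.fundamentalMatrix))
    (isSymm_cx (P.quadMat_isSymm P.fundamentalMatrix)) 0 (fun z => ?_)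
  · rw [this, zero_smul]; ext i j; simp
  · rw [P.quadMat_form, zero_mul]
    by_cases h₁ : cx P.fst.mat *ᵥ z = 0
    · simp [h₁]
    by_cases h₂ : cx P.snd.mat *ᵥ z = 0
    · simp [h₂]
    have hz : z ≠ 0 := by rintro rfl; simp at h₁
    rw [(P.epipolar_iff h₁ h₂).2 ⟨z, hz, ⟨1, (one_smul _ _).symm⟩, ⟨1, (one_smul _ _).symm⟩⟩, mul_zero]

/-! ### Coordinates adapted to a pair of cameras -/

/-- The projection to the first three coordinates. -/
def stdFst : Matrix (Fin 3) (Fin 4) ℝ := !![1, 0, 0, 0; 0, 1, 0, 0; 0, 0, 1, 0]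

/-- The projection to the first, second and fourth coordinate. -/
def stdSnd : Matrix (Fin 3) (Fin 4) ℝ := !![1, 0, 0, 0; 0, 1, 0, 0; 0, 0, 0, 1]

/-- The fundamental matrix, up to scale, of the pair of standard projections. -/
def stdFund : Matrix (Fin 3) (Fin 3) ℝ := !![0, 1, 0; -1, 0, 0; 0, 0, 0]

/-- Space and image coordinates in which the cameras become the standard projections. -/
structure CameraPair.Frame (P : CameraPair) where
  space : Matrix (Fin 4) (Fin 4) ℝ
  left : Matrix (Fin 3) (Fin 3) ℝ
  right : Matrix (Fin 3) (Fin 3) ℝ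
  det_space : space.det ≠ 0
  det_left : left.det ≠ 0
  det_right : right.det ≠ 0
  fst_mul : P.fst.mat * space = left * stdFst
  snd_mul : P.snd.mat * space = right * stdSnd

lemma Camera.exists_ker (C : Camera) : ∃ p : Fin 4 → ℝ, p ≠ 0 ∧ C.mat *ᵥ p = 0 := by
  have h : LinearMap.ker C.mat.mulVecLin ≠ ⊥ := LinearMap.ker_ne_bot_of_finrank_lt (by simp)
  obtain ⟨p, hp, h0⟩ := (Submodule.ne_bot_iff _).1 h
  exact ⟨p, h0, by simpa using hp⟩

lemma mul_stdFst_eq {B : Matrix (Fin 3) (Fin 4) ℝ} (h : ∀ i, B i 3 = 0) :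
    B * stdFstᵀ * stdFst = B := by
  ext i j
  fin_cases j <;> simp [Matrix.mul_apply, Fin.sum_univ_succ, stdFst, h]

lemma mul_stdSnd_eq {B : Matrix (Fin 3) (Fin 4) ℝ} (h : ∀ i, B i 2 = 0) :
    B * stdSndᵀ * stdSnd = B := by
  ext i j
  fin_cases j <;> simp [Matrix.mul_apply, Fin.sum_univ_succ, stdSnd, h]

/-- A right inverse of the camera yields a right inverse of the square factor `A`. -/
lemma Camera.det_ne_zero_of_mul_eq (C : Camera) {K : Matrix (Fin 4) (Fin 4) ℝ} (hK : K.det ≠ 0)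
    {A : Matrix (Fin 3) (Fin 3) ℝ} {N : Matrix (Fin 3) (Fin 4) ℝ} (h : C.mat * K = A * N) :
    A.det ≠ 0 := by
  obtain ⟨R, hR⟩ := C.exists_right_inverse
  have : A * (N * K⁻¹ * R) = 1 := by
    rw [← Matrix.mul_assoc, ← Matrix.mul_assoc, ← h, Matrix.mul_nonsing_inv_cancel_right _ _
      (isUnit_iff_ne_zero.2 hK), hR]
  intro h0
  have := congrArg Matrix.det this
  simp [h0] at this

/-- Take a basis of space whose third vector is the second centre and whose fourth vector is the
first centre. Each camera then has a zero column and factors through the corresponding coordinate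
projection. -/
lemma CameraPair.nonempty_frame (P : CameraPair) : Nonempty P.Frame := by
  obtain ⟨p, hp0, hp⟩ := P.fst.exists_ker
  obtain ⟨q, hq0, hq⟩ := P.snd.exists_ker
  have hpq : P.snd.mat *ᵥ p ≠ 0 := fun h => hp0 (P.eq_zero_of_mulVec_eq_zero_real hp h)
  have hqp : P.fst.mat *ᵥ q ≠ 0 := fun h => hq0 (P.eq_zero_of_mulVec_eq_zero_real h hq)
  have li : LinearIndependent ℝ ![q, p] := by
    rw [LinearIndependent.pair_iff]
    intro s t h
    have h₁ := congrArg (P.fst.mat *ᵥ ·) h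
    have h₂ := congrArg (P.snd.mat *ᵥ ·) h
    simp only [Matrix.mulVec_add, Matrix.mulVec_smul, hp, hq, smul_zero, add_zero, zero_add,
      Matrix.mulVec_zero, smul_eq_zero, hpq, hqp, or_false] at h₁ h₂
    exact ⟨h₁, h₂⟩
  obtain ⟨g, hg⟩ := exists_linearIndependent_cons_of_lt_finrank li (by simp)
  obtain ⟨g', hg'⟩ := exists_linearIndependent_cons_of_lt_finrank hg (by simp)
  let R : Matrix (Fin 4) (Fin 4) ℝ := Matrix.of ![g', g, q, p]
  have hR : R.det ≠ 0 := by
    rw [← isUnit_iff_ne_zero, ← Matrix.isUnit_iff_isUnit_det,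
      ← Matrix.linearIndependent_rows_iff_isUnit]
    exact hg'
  have hR' : Rᵀ.det ≠ 0 := by rwa [Matrix.det_transpose]
  have e₁ : P.fst.mat * Rᵀ * stdFstᵀ * stdFst = P.fst.mat * Rᵀ :=
    mul_stdFst_eq fun i => congrFun hp i
  have e₂ : P.snd.mat * Rᵀ * stdSndᵀ * stdSnd = P.snd.mat * Rᵀ :=
    mul_stdSnd_eq fun i => congrFun hq i
  exact ⟨⟨Rᵀ, P.fst.mat * Rᵀ * stdFstᵀ, P.snd.mat * Rᵀ * stdSndᵀ, hR',
    P.fst.det_ne_zero_of_mul_eq hR' e₁.symm, P.snd.det_ne_zero_of_mul_eq hR' e₂.symm, e₁.symm,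
    e₂.symm⟩⟩

/-- Twice the matrix of the quadratic form of `F` for the standard projections. -/
def stdQuad (F : Matrix (Fin 3) (Fin 3) ℝ) : Matrix (Fin 4) (Fin 4) ℝ :=
  !![2 * F 0 0, F 0 1 + F 1 0, F 2 0, F 0 2;
     F 0 1 + F 1 0, 2 * F 1 1, F 2 1, F 1 2;
     F 2 0, F 2 1, 0, F 2 2;
     F 0 2, F 1 2, F 2 2, 0]

lemma stdQuad_eq (F : Matrix (Fin 3) (Fin 3) ℝ) :
    stdFstᵀ * F * stdSnd + (stdFstᵀ * F * stdSnd)ᵀ = stdQuad F := by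
  ext i j
  fin_cases i <;> fin_cases j <;>
    simp [Matrix.mul_apply, Fin.sum_univ_succ, stdFst, stdSnd, stdQuad] <;> ring

section frame

variable {P : CameraPair}

/-- The matrix `F` in the image coordinates of the frame. -/
def CameraPair.Frame.pull (φ : P.Frame) (F : Matrix (Fin 3) (Fin 3) ℝ) : Matrix (Fin 3) (Fin 3) ℝ :=
  φ.leftᵀ * F * φ.right

lemma CameraPair.Frame.pull_injective (φ : P.Frame) : Function.Injective φ.pull := by
  intro F G h
  have hl : IsUnit φ.leftᵀ.det := by
    rw [Matrix.det_transpose]; exact isUnit_iff_ne_zero.2 φ.det_left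
  have hr : IsUnit φ.right.det := isUnit_iff_ne_zero.2 φ.det_right
  have h' := congrArg (fun M => φ.leftᵀ⁻¹ * (M * φ.right⁻¹)) h
  simpa only [CameraPair.Frame.pull, Matrix.mul_nonsing_inv_cancel_right _ _ hr,
    Matrix.nonsing_inv_mul_cancel_left _ _ hl] using h'

lemma CameraPair.Frame.pull_surjective (φ : P.Frame) : Function.Surjective φ.pull := by
  intro G
  have hl : IsUnit φ.leftᵀ.det := by
    rw [Matrix.det_transpose]; exact isUnit_iff_ne_zero.2 φ.det_left
  have hr : IsUnit φ.right.det := isUnit_iff_ne_zero.2 φ.det_right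
  refine ⟨φ.leftᵀ⁻¹ * G * φ.right⁻¹, ?_⟩
  rw [CameraPair.Frame.pull, Matrix.mul_assoc, Matrix.nonsing_inv_mul_cancel_right _ _ hr,
    Matrix.mul_nonsing_inv_cancel_left _ _ hl]

lemma CameraPair.Frame.pull_add (φ : P.Frame) (F G : Matrix (Fin 3) (Fin 3) ℝ) :
    φ.pull (F + G) = φ.pull F + φ.pull G := by
  simp [CameraPair.Frame.pull, Matrix.mul_add, Matrix.add_mul]

lemma CameraPair.Frame.pull_smul (φ : P.Frame) (c : ℝ) (F : Matrix (Fin 3) (Fin 3) ℝ) :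
    φ.pull (c • F) = c • φ.pull F := by
  simp [CameraPair.Frame.pull]

/-- This turns all questions about quadrics through the centres into computations with the nine
entries of `φ.pull F`. -/
lemma CameraPair.Frame.quadMat_eq (φ : P.Frame) (F : Matrix (Fin 3) (Fin 3) ℝ) :
    φ.spaceᵀ * P.quadMat F * φ.space = stdQuad (φ.pull F) := by
  have h : φ.spaceᵀ * (P.fst.matᵀ * F * P.snd.mat) * φ.space =
      stdFstᵀ * φ.pull F * stdSnd := by
    calc _ = (P.fst.mat * φ.space)ᵀ * F * (P.snd.mat * φ.space) := by
          simp only [Matrix.transpose_mul, Matrix.mul_assoc]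
      _ = _ := by
          rw [φ.fst_mul, φ.snd_mul]
          simp only [CameraPair.Frame.pull, Matrix.transpose_mul, Matrix.mul_assoc]
  rw [CameraPair.quadMat, Matrix.mul_add, Matrix.add_mul, h, ← stdQuad_eq, ← h]
  simp only [Matrix.transpose_mul, Matrix.mul_assoc, Matrix.transpose_transpose]

/-- A quadric in the space coordinates of the frame. -/
def CameraPair.Frame.pullQuad (φ : P.Frame) (S : Matrix (Fin 4) (Fin 4) ℝ) :
    Matrix (Fin 4) (Fin 4) ℝ :=
  φ.spaceᵀ * S * φ.space

lemma CameraPair.Frame.pullQuad_injective (φ : P.Frame) : Function.Injective φ.pullQuad := by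
  intro F G h
  have hl : IsUnit φ.spaceᵀ.det := by
    rw [Matrix.det_transpose]; exact isUnit_iff_ne_zero.2 φ.det_space
  have hr : IsUnit φ.space.det := isUnit_iff_ne_zero.2 φ.det_space
  have h' := congrArg (fun M => φ.spaceᵀ⁻¹ * (M * φ.space⁻¹)) h
  simpa only [CameraPair.Frame.pullQuad, Matrix.mul_nonsing_inv_cancel_right _ _ hr,
    Matrix.nonsing_inv_mul_cancel_left _ _ hl] using h'

lemma CameraPair.Frame.rank_pullQuad (φ : P.Frame) (S : Matrix (Fin 4) (Fin 4) ℝ) :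
    (φ.pullQuad S).rank = S.rank := by
  rw [CameraPair.Frame.pullQuad,
    Matrix.rank_mul_eq_left_of_isUnit_det _ _ (isUnit_iff_ne_zero.2 φ.det_space),
    Matrix.rank_mul_eq_right_of_isUnit_det]
  rw [Matrix.det_transpose]; exact isUnit_iff_ne_zero.2 φ.det_space

/-- If it vanished, every pair of image points would have a common preimage. In frame coordinates
the first basis vector on the left and the second on the right have none. -/
lemma CameraPair.fundamentalMatrix_ne_zero (P : CameraPair) : P.fundamentalMatrix ≠ 0 := by
  intro h
  obtain ⟨φ⟩ := P.nonempty_frame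
  have hl : IsUnit φ.left.det := isUnit_iff_ne_zero.2 φ.det_left
  have hr : IsUnit φ.right.det := isUnit_iff_ne_zero.2 φ.det_right
  have hs : IsUnit φ.space.det := isUnit_iff_ne_zero.2 φ.det_space
  have inv : ∀ {n : ℕ} {A : Matrix (Fin n) (Fin n) ℝ}, IsUnit A.det → cx A⁻¹ * cx A = 1 := by
    intro n A hA
    rw [← cx_mul, Matrix.nonsing_inv_mul _ hA, cx_one]
  have ne : ∀ {A : Matrix (Fin 3) (Fin 3) ℝ}, IsUnit A.det → ∀ i : Fin 3,
      cx A *ᵥ Pi.single i 1 ≠ 0 := by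
    intro A hA i h0
    have := congrArg (cx A⁻¹ *ᵥ ·) h0
    simp only [Matrix.mulVec_mulVec, inv hA, Matrix.one_mulVec, Matrix.mulVec_zero] at this
    simpa using congrFun this i
  obtain ⟨z, hz, ⟨a, ha⟩, b, hb⟩ := (P.epipolar_iff (ne hl 0) (ne hr 1)).1 (by
    rw [h]
    have : cx (0 : Matrix (Fin 3) (Fin 3) ℝ) = 0 := by ext i j; simp
    rw [this, Matrix.zero_mulVec, dotProduct_zero])
  have hz' : z = cx φ.space *ᵥ (cx φ.space⁻¹ *ᵥ z) := by
    rw [Matrix.mulVec_mulVec, ← cx_mul, Matrix.mul_nonsing_inv _ hs, cx_one, Matrix.one_mulVec]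
  generalize cx φ.space⁻¹ *ᵥ z = w at hz'
  rw [hz', Matrix.mulVec_mulVec, ← cx_mul] at ha hb
  rw [φ.fst_mul] at ha
  rw [φ.snd_mul] at hb
  replace ha := congrArg (cx φ.left⁻¹ *ᵥ ·) ha
  replace hb := congrArg (cx φ.right⁻¹ *ᵥ ·) hb
  simp only [cx_mul, ← Matrix.mulVec_smul, Matrix.mulVec_mulVec, ← Matrix.mul_assoc, inv hl, inv hr,
    Matrix.one_mulVec, Matrix.one_mul] at ha hb
  have hw : w = 0 := by
    funext i
    have ha₁ := congrFun ha 1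
    have ha₂ := congrFun ha 2
    have hb₀ := congrFun hb 0
    have hb₂ := congrFun hb 2
    simp [Matrix.mulVec, dotProduct, Fin.sum_univ_succ, stdFst] at ha₁ ha₂
    simp [Matrix.mulVec, dotProduct, Fin.sum_univ_succ, stdSnd] at hb₀ hb₂
    fin_cases i <;> assumption
  exact hz (by rw [hz', hw, Matrix.mulVec_zero])

lemma eq_smul_stdFund {F : Matrix (Fin 3) (Fin 3) ℝ} (h : stdQuad F = 0) :
    F = F 0 1 • stdFund := by
  have e : ∀ i j, stdQuad F i j = 0 := fun i j => by rw [h]; rfl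
  have h00 := e 0 0
  have h01 := e 0 1
  have h11 := e 1 1
  have h02 := e 0 2
  have h12 := e 1 2
  have h03 := e 0 3
  have h13 := e 1 3
  have h23 := e 2 3
  simp [stdQuad] at h00 h01 h11 h02 h12 h03 h13 h23
  ext i j
  fin_cases i <;> fin_cases j <;> simp [stdFund, *]
  linarith

lemma CameraPair.Frame.exists_pull_fundamentalMatrix (φ : P.Frame) :
    ∃ c : ℝ, c ≠ 0 ∧ φ.pull P.fundamentalMatrix = c • stdFund := by
  have h : stdQuad (φ.pull P.fundamentalMatrix) = 0 := by
    rw [← φ.quadMat_eq, P.quadMat_fundamentalMatrix, Matrix.mul_zero, Matrix.zero_mul]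
  refine ⟨_, fun h0 => P.fundamentalMatrix_ne_zero (φ.pull_injective ?_), eq_smul_stdFund h⟩
  rw [eq_smul_stdFund h, h0, zero_smul]
  simp [CameraPair.Frame.pull]

/-- In frame coordinates, a vanishing `stdQuad` leaves only the skew part of the upper left block.
Consequently a critical quadric determines the other fundamental matrix up to scale and a multiple
of that of `P`. -/
lemma CameraPair.quadMat_eq_zero_iff (P : CameraPair) (F : Matrix (Fin 3) (Fin 3) ℝ) :
    P.quadMat F = 0 ↔ ∃ c : ℝ, F = c • P.fundamentalMatrix := by
  constructor
  · intro h
    obtain ⟨φ⟩ := P.nonempty_frame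
    obtain ⟨c, hc, hφ⟩ := φ.exists_pull_fundamentalMatrix
    have h' : stdQuad (φ.pull F) = 0 := by
      rw [← φ.quadMat_eq, h, Matrix.mul_zero, Matrix.zero_mul]
    refine ⟨φ.pull F 0 1 * c⁻¹, φ.pull_injective ?_⟩
    rw [φ.pull_smul, hφ, smul_smul, inv_mul_cancel_right₀ hc]
    exact eq_smul_stdFund h'
  · rintro ⟨c, rfl⟩
    rw [P.quadMat_smul, P.quadMat_fundamentalMatrix, smul_zero]

end frame

/-! ### A quadric is determined by its set of complex points -/

lemma symm_dotProduct_mulVec {n K : Type*} [Fintype n] [CommRing K] {A : Matrix n n K}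
    (hA : A.IsSymm) (x y : n → K) : y ⬝ᵥ (A *ᵥ x) = x ⬝ᵥ (A *ᵥ y) := by
  rw [dotProduct_comm, Matrix.dotProduct_mulVec x, ← Matrix.mulVec_transpose, hA]

/-- A nonzero real symmetric matrix is a multiple of a square, or its complex quadratic form
contains a hyperbolic plane. -/
lemma square_or_exists_hyperbolic {S : Matrix (Fin 4) (Fin 4) ℝ} (hS : S.IsSymm) (h0 : S ≠ 0) :
    (∃ (c : ℝ) (m : Fin 4 → ℝ), c ≠ 0 ∧ m ≠ 0 ∧ S = c • Matrix.vecMulVec m m) ∨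
    ∃ v w : Fin 4 → ℂ, v ⬝ᵥ (cx S *ᵥ v) = 0 ∧ w ⬝ᵥ (cx S *ᵥ w) = 0 ∧ v ⬝ᵥ (cx S *ᵥ w) = 1 := by
  have hS' := isSymm_cx hS
  by_cases hv : ∃ v : Fin 4 → ℂ, v ⬝ᵥ (cx S *ᵥ v) = 0 ∧ cx S *ᵥ v ≠ 0
  · right
    obtain ⟨v, hv, hne⟩ := hv
    obtain ⟨i, hi⟩ := Function.ne_iff.1 hne
    have hx : v ⬝ᵥ (cx S *ᵥ ((cx S *ᵥ v) i)⁻¹ • (Pi.single i 1 : Fin 4 → ℂ)) = 1 := by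
      rw [← symm_dotProduct_mulVec hS', smul_dotProduct, single_one_dotProduct, smul_eq_mul,
        inv_mul_cancel₀ hi]
    generalize ((cx S *ᵥ v) i)⁻¹ • (Pi.single i 1 : Fin 4 → ℂ) = x at hx
    have hx' : x ⬝ᵥ (cx S *ᵥ v) = 1 := by rw [symm_dotProduct_mulVec hS', hx]
    -- Since `v` is isotropic and pairs to 1 with `x`, subtracting this multiple of `v` makes `x`
    -- isotropic without changing the pairing.
    refine ⟨v, x - (x ⬝ᵥ (cx S *ᵥ x) / 2) • v, hv, ?_, ?_⟩
    · simp only [Matrix.mulVec_sub, Matrix.mulVec_smul, sub_dotProduct, dotProduct_sub,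
        smul_dotProduct, dotProduct_smul, hv, hx, hx', smul_eq_mul]
      ring
    · simp only [Matrix.mulVec_sub, Matrix.mulVec_smul, dotProduct_sub, dotProduct_smul, hv, hx,
        smul_eq_mul]
      ring
  · left
    push Not at hv
    obtain ⟨a, ha⟩ : ∃ a : Fin 4 → ℝ, a ⬝ᵥ (S *ᵥ a) ≠ 0 := by
      by_contra! h
      apply h0
      ext i j
      have e : ∀ k l : Fin 4, (Pi.single k 1 : Fin 4 → ℝ) ⬝ᵥ (S *ᵥ (Pi.single l 1 : Fin 4 → ℝ)) =
        S k l := by intro k l; simp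
      have h₁ := h (Pi.single j 1 + Pi.single i 1)
      rw [Matrix.mulVec_add, add_dotProduct, dotProduct_add, dotProduct_add, h, h,
        symm_dotProduct_mulVec hS, e] at h₁
      simp only [zero_add, add_zero] at h₁
      have : S i j + S i j = 0 := h₁
      simp only [Matrix.zero_apply]
      linarith
    set r := a ⬝ᵥ (S *ᵥ a) with hr
    have hra : cxv a ⬝ᵥ (cx S *ᵥ cxv a) = (r : ℂ) := by
      rw [cx_mulVec_cxv, cxv_dotProduct_cxv]
    have hrC : (r : ℂ) ≠ 0 := by exact_mod_cast ha
    -- Here every isotropic vector lies in the kernel. If `b` is orthogonal to `a` and not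
    -- isotropic, a suitable `a + t b` is isotropic but pairs with `a` to `r ≠ 0`. So the form is
    -- determined by the component along `a`.
    have key : ∀ b : Fin 4 → ℂ, b ⬝ᵥ (cx S *ᵥ cxv a) = 0 → b ⬝ᵥ (cx S *ᵥ b) = 0 := by
      intro b hb
      by_contra hq
      obtain ⟨t, ht⟩ := IsAlgClosed.exists_pow_nat_eq (-(r : ℂ) / (b ⬝ᵥ (cx S *ᵥ b))) two_pos
      have hb' : cxv a ⬝ᵥ (cx S *ᵥ b) = 0 := by rw [symm_dotProduct_mulVec hS', hb]
      have h₁ : (cxv a + t • b) ⬝ᵥ (cx S *ᵥ (cxv a + t • b)) = 0 := by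
        simp only [Matrix.mulVec_add, Matrix.mulVec_smul, add_dotProduct, dotProduct_add,
          smul_dotProduct, dotProduct_smul, hb, hb', hra, smul_eq_mul]
        have : t * (t * (b ⬝ᵥ (cx S *ᵥ b))) = -r := by
          rw [← mul_assoc, ← sq, ht, div_mul_cancel₀ _ hq]
        linear_combination this
      have h₂ := congrArg (cxv a ⬝ᵥ ·) (hv _ h₁)
      simp only [Matrix.mulVec_add, Matrix.mulVec_smul, dotProduct_add, dotProduct_smul, hb', hra,
        dotProduct_zero, smul_zero, add_zero] at h₂
      exact hrC h₂
    have ha0 : a ≠ 0 := by rintro rfl; simp [hr] at ha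
    refine ⟨r⁻¹, S *ᵥ a, inv_ne_zero ha, fun h => ha (by rw [hr, h, dotProduct_zero]), ?_⟩
    apply cx_injective
    have hsq : cx (Matrix.vecMulVec (S *ᵥ a) (S *ᵥ a)) =
        Matrix.vecMulVec (cx S *ᵥ cxv a) (cx S *ᵥ cxv a) := by
      rw [cx_mulVec_cxv]
      ext i j; simp [Matrix.vecMulVec_apply, cxv]
    have hsy : (Matrix.vecMulVec (S *ᵥ a) (S *ᵥ a)).IsSymm := by
      rw [Matrix.IsSymm, Matrix.transpose_vecMulVec]
    rw [cx_smul]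
    refine eq_smul_of_form_eq hS' (isSymm_cx hsy) _ fun z => ?_
    rw [hsq, Matrix.vecMulVec_mulVec, dotProduct_smul]
    -- The vector in question is the component of `z` orthogonal to `a`.
    have hz := key (z - (z ⬝ᵥ (cx S *ᵥ cxv a) / r) • cxv a) (by
      simp only [sub_dotProduct, smul_dotProduct, hra, smul_eq_mul]
      field_simp
      ring)
    have hz' : cxv a ⬝ᵥ (cx S *ᵥ z) = z ⬝ᵥ (cx S *ᵥ cxv a) := symm_dotProduct_mulVec hS' _ _
    simp only [Matrix.mulVec_sub, Matrix.mulVec_smul, sub_dotProduct, dotProduct_sub,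
      smul_dotProduct, dotProduct_smul, hra, hz', smul_eq_mul] at hz
    rw [MulOpposite.smul_eq_mul_unop, MulOpposite.unop_op, dotProduct_comm (cx S *ᵥ cxv a) z]
    push_cast
    field_simp at hz ⊢
    linear_combination hz

/-- If a quadratic form containing a hyperbolic plane vanishes only where another one vanishes,
then the second one is a multiple of the first one. -/
lemma exists_eq_smul_of_hyperbolic {S S' : Matrix (Fin 4) (Fin 4) ℂ} (hS : S.IsSymm)
    (hS' : S'.IsSymm) {v w : Fin 4 → ℂ} (hv : v ⬝ᵥ (S *ᵥ v) = 0) (hw : w ⬝ᵥ (S *ᵥ w) = 0)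
    (hvw : v ⬝ᵥ (S *ᵥ w) = 1) (h : ∀ z, z ⬝ᵥ (S *ᵥ z) = 0 → z ⬝ᵥ (S' *ᵥ z) = 0) :
    ∃ c : ℂ, S' = c • S := by
  have hwv : w ⬝ᵥ (S *ᵥ v) = 1 := by rw [symm_dotProduct_mulVec hS, hvw]
  set c := v ⬝ᵥ (S' *ᵥ w) with hc
  have hwv' : w ⬝ᵥ (S' *ᵥ v) = c := by rw [symm_dotProduct_mulVec hS']
  have hv' := h v hv
  have hw' := h w hw
  have key : ∀ x : Fin 4 → ℂ, v ⬝ᵥ (S *ᵥ x) = 0 → w ⬝ᵥ (S *ᵥ x) = 0 →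
      x ⬝ᵥ (S' *ᵥ x) = c * (x ⬝ᵥ (S *ᵥ x)) ∧ v ⬝ᵥ (S' *ᵥ x) = 0 ∧ w ⬝ᵥ (S' *ᵥ x) = 0 := by
    intro x h₁ h₂
    have h₃ : x ⬝ᵥ (S *ᵥ v) = 0 := by rw [symm_dotProduct_mulVec hS, h₁]
    have h₄ : x ⬝ᵥ (S *ᵥ w) = 0 := by rw [symm_dotProduct_mulVec hS, h₂]
    have e₁ : x ⬝ᵥ (S' *ᵥ v) = v ⬝ᵥ (S' *ᵥ x) := symm_dotProduct_mulVec hS' _ _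
    have e₂ : x ⬝ᵥ (S' *ᵥ w) = w ⬝ᵥ (S' *ᵥ x) := symm_dotProduct_mulVec hS' _ _
    -- For `x` orthogonal to `v` and `w`, the vector `t v + s w + x` is isotropic for `S` as soon as
    -- `2ts` cancels the value at `x`. Each such pair gives a linear equation for the unknown values
    -- of `S'`.
    have gen : ∀ t s : ℂ, 2 * t * s + x ⬝ᵥ (S *ᵥ x) = 0 →
        2 * t * s * c + 2 * t * (v ⬝ᵥ (S' *ᵥ x)) + 2 * s * (w ⬝ᵥ (S' *ᵥ x)) + x ⬝ᵥ (S' *ᵥ x) = 0 := by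
      intro t s hts
      have := h (t • v + s • w + x) (by
        simp only [Matrix.mulVec_add, Matrix.mulVec_smul, add_dotProduct, dotProduct_add,
          smul_dotProduct, dotProduct_smul, hv, hw, hvw, hwv, h₁, h₂, h₃, h₄, smul_eq_mul]
        linear_combination hts)
      simp only [Matrix.mulVec_add, Matrix.mulVec_smul, add_dotProduct, dotProduct_add,
        smul_dotProduct, dotProduct_smul, hv', hw', ← hc, hwv', e₁, e₂, smul_eq_mul] at this
      linear_combination this
    generalize x ⬝ᵥ (S *ᵥ x) = q at *
    generalize v ⬝ᵥ (S' *ᵥ x) = A at *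
    generalize w ⬝ᵥ (S' *ᵥ x) = B at *
    generalize x ⬝ᵥ (S' *ᵥ x) = q' at *
    -- All six pairs satisfy `2ts = -q`; they suffice to solve for `A`, `B` and `q'`, even when `q =
    -- 0`.
    have g₁ := gen 1 (-q / 2) (by ring)
    have g₂ := gen (-1) (q / 2) (by ring)
    have g₃ := gen 2 (-q / 4) (by ring)
    have g₄ := gen (-q / 2) 1 (by ring)
    have g₅ := gen (q / 2) (-1) (by ring)
    have g₆ := gen (-q / 4) 2 (by ring)
    have hA : A = 0 := by linear_combination (1 / 3) * g₃ - (1 / 4) * g₁ - (1 / 12) * g₂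
    have hB : B = 0 := by linear_combination (1 / 3) * g₆ - (1 / 4) * g₄ - (1 / 12) * g₅
    refine ⟨?_, hA, hB⟩
    linear_combination (1 / 2) * g₁ + (1 / 2) * g₂
  refine ⟨c, eq_smul_of_form_eq hS' hS c fun z => ?_⟩
  -- Split `z` into its components in the hyperbolic plane and in its orthogonal complement.
  obtain ⟨x, hx⟩ : ∃ x, x = z - (w ⬝ᵥ (S *ᵥ z)) • v - (v ⬝ᵥ (S *ᵥ z)) • w := ⟨_, rfl⟩
  have hz : z = (w ⬝ᵥ (S *ᵥ z)) • v + (v ⬝ᵥ (S *ᵥ z)) • w + x := by rw [hx]; abel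
  have h₁ : v ⬝ᵥ (S *ᵥ x) = 0 := by
    rw [hx]
    simp only [Matrix.mulVec_sub, Matrix.mulVec_smul, dotProduct_sub, dotProduct_smul, hv, hvw,
      smul_eq_mul]
    ring
  have h₂ : w ⬝ᵥ (S *ᵥ x) = 0 := by
    rw [hx]
    simp only [Matrix.mulVec_sub, Matrix.mulVec_smul, dotProduct_sub, dotProduct_smul, hw, hwv,
      smul_eq_mul]
    ring
  obtain ⟨k₁, k₂, k₃⟩ := key x h₁ h₂
  have h₃ : x ⬝ᵥ (S *ᵥ v) = 0 := by rw [symm_dotProduct_mulVec hS, h₁]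
  have h₄ : x ⬝ᵥ (S *ᵥ w) = 0 := by rw [symm_dotProduct_mulVec hS, h₂]
  have e₁ : x ⬝ᵥ (S' *ᵥ v) = 0 := by rw [symm_dotProduct_mulVec hS', k₂]
  have e₂ : x ⬝ᵥ (S' *ᵥ w) = 0 := by rw [symm_dotProduct_mulVec hS', k₃]
  generalize w ⬝ᵥ (S *ᵥ z) = α at hz
  generalize v ⬝ᵥ (S *ᵥ z) = β at hz
  rw [hz]
  simp only [Matrix.mulVec_add, Matrix.mulVec_smul, add_dotProduct, dotProduct_add,
    smul_dotProduct, dotProduct_smul, hv, hw, hvw, hwv, h₁, h₂, h₃, h₄, hv', hw', ← hc, hwv', e₁, e₂,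
    k₁, k₂, k₃, smul_eq_mul]
  ring

lemma Quadric.mem_points_of_form (S : Quadric) {z : Fin 4 → ℂ} {S' : Quadric}
    (h : S.points ⊆ S'.points) (hz : z ⬝ᵥ (cx S.mat *ᵥ z) = 0) : z ⬝ᵥ (cx S'.mat *ᵥ z) = 0 := by
  by_cases h0 : z = 0
  · simp [h0]
  · exact (S'.mk_mem_points h0).1 (h ((S.mk_mem_points h0).2 hz))

lemma exists_real_smul {A B : Matrix (Fin 4) (Fin 4) ℝ} (hB : B ≠ 0) {c : ℂ}
    (h : cx B = c • cx A) : ∃ r : ℝ, r ≠ 0 ∧ B = r • A := by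
  have hB' : B = c.re • A := by
    ext i j
    have := congrArg Complex.re (congrFun (congrFun h i) j)
    simpa using this
  refine ⟨c.re, fun h0 => hB ?_, hB'⟩
  rw [hB', h0, zero_smul]

/-- A quadric containing a quadric other than a double plane is equal to it. -/
lemma Quadric.exists_smul_of_subset (S S' : Quadric) (hS : 2 ≤ S.mat.rank)
    (h : S.points ⊆ S'.points) : ∃ r : ℝ, r ≠ 0 ∧ S'.mat = r • S.mat := by
  rcases square_or_exists_hyperbolic S.symm S.ne_zero with ⟨c, m, hc, hm, e⟩ | ⟨v, w, hv, hw, hvw⟩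
  · have e' : S.mat = Matrix.vecMulVec (c • m) m := by
      rw [e]; ext i j; simp [Matrix.vecMulVec_apply, mul_assoc]
    have := Matrix.rank_vecMulVec_le (c • m) m
    rw [← e'] at this
    omega
  · obtain ⟨c, hc⟩ := exists_eq_smul_of_hyperbolic (isSymm_cx S.symm) (isSymm_cx S'.symm) hv hw hvw
      (fun z hz => S.mem_points_of_form h hz)
    exact exists_real_smul S'.ne_zero hc

lemma exists_smul_of_ker_le {m m' : Fin 4 → ℝ} (hm : m ≠ 0)
    (h : ∀ z : Fin 4 → ℝ, m ⬝ᵥ z = 0 → m' ⬝ᵥ z = 0) : ∃ c : ℝ, m' = c • m := by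
  obtain ⟨i, hi⟩ := Function.ne_iff.1 hm
  have hi' : m i ≠ 0 := hi
  refine ⟨m' i / m i, funext fun j => ?_⟩
  have := h (m i • Pi.single j 1 - m j • Pi.single i 1) (by simp; ring)
  simp at this
  simp only [Pi.smul_apply, smul_eq_mul]
  field_simp
  linarith

/-- Double planes are allowed, so inclusion would not suffice. If either form contains a hyperbolic
plane, the inclusion starting from that quadric decides; two double planes are compared through the
real zeros of their linear forms. -/
lemma Quadric.exists_smul_of_points_eq (S S' : Quadric) (h : S.points = S'.points) :
    ∃ r : ℝ, r ≠ 0 ∧ S'.mat = r • S.mat := by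
  rcases square_or_exists_hyperbolic S.symm S.ne_zero with ⟨c, m, hc, hm, e⟩ | ⟨v, w, hv, hw, hvw⟩
  · rcases square_or_exists_hyperbolic S'.symm S'.ne_zero with
      ⟨c', m', hc', hm', e'⟩ | ⟨v, w, hv, hw, hvw⟩
    · obtain ⟨k, hk⟩ := exists_smul_of_ker_le (m' := m') hm (fun z hz => by
        have := S.mem_points_of_form h.le (z := cxv z) (by
          rw [cx_mulVec_cxv, cxv_dotProduct_cxv, e, Matrix.smul_mulVec, Matrix.vecMulVec_mulVec, hz]
          simp)
        rw [cx_mulVec_cxv, cxv_dotProduct_cxv, e', Matrix.smul_mulVec,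
          Matrix.vecMulVec_mulVec] at this
        simp only [op_smul_eq_smul, dotProduct_smul, smul_eq_mul,
          Complex.ofReal_eq_zero, mul_eq_zero, hc', false_or] at this
        rcases this with h | h
        · exact h
        · rw [dotProduct_comm, h])
      have hk0 : k ≠ 0 := by rintro rfl; exact hm' (by simpa using hk)
      refine ⟨c' * k ^ 2 / c, by positivity, ?_⟩
      rw [e, e', hk]
      ext i j
      simp [Matrix.vecMulVec_apply]
      field_simp
    · obtain ⟨c, hc⟩ := exists_eq_smul_of_hyperbolic (isSymm_cx S'.symm) (isSymm_cx S.symm) hv hw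
        hvw (fun z hz => S'.mem_points_of_form h.ge hz)
      obtain ⟨r, hr, e⟩ := exists_real_smul S.ne_zero hc
      exact ⟨r⁻¹, inv_ne_zero hr, by rw [e, inv_smul_smul₀ hr]⟩
  · obtain ⟨c, hc⟩ := exists_eq_smul_of_hyperbolic (isSymm_cx S.symm) (isSymm_cx S'.symm) hv hw hvw
      (fun z hz => S.mem_points_of_form h.le hz)
    exact exists_real_smul S'.ne_zero hc

lemma Quadric.points_eq_of_smul {S S' : Quadric} {r : ℝ} (hr : r ≠ 0) (h : S'.mat = r • S.mat) :
    S'.points = S.points := by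
  ext x
  simp only [Quadric.points, Set.mem_ofPred_eq, h, cx_smul, Matrix.smul_mulVec, dotProduct_smul,
    smul_eq_mul, mul_eq_zero, Complex.ofReal_eq_zero, hr, false_or]

/-! ### Types of quadrics in adapted coordinates -/

namespace CameraPair.Frame

variable {P : CameraPair} (φ : P.Frame)

lemma isUnit_det_space : IsUnit φ.space.det := isUnit_iff_ne_zero.2 φ.det_space

lemma inv_mulVec_mulVec (w : Fin 4 → ℂ) : cx φ.space⁻¹ *ᵥ (cx φ.space *ᵥ w) = w := by
  rw [Matrix.mulVec_mulVec, ← cx_mul, Matrix.nonsing_inv_mul _ φ.isUnit_det_space, cx_one,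
    Matrix.one_mulVec]

lemma mulVec_inv_mulVec (z : Fin 4 → ℂ) : cx φ.space *ᵥ (cx φ.space⁻¹ *ᵥ z) = z := by
  rw [Matrix.mulVec_mulVec, ← cx_mul, Matrix.mul_nonsing_inv _ φ.isUnit_det_space, cx_one,
    Matrix.one_mulVec]

lemma mulVec_ne_zero {w : Fin 4 → ℂ} (hw : w ≠ 0) : cx φ.space *ᵥ w ≠ 0 := by
  intro h
  apply hw
  rw [← φ.inv_mulVec_mulVec w, h, Matrix.mulVec_zero]

lemma form_pullQuad (S : Matrix (Fin 4) (Fin 4) ℝ) (w w' : Fin 4 → ℂ) :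
    (cx φ.space *ᵥ w) ⬝ᵥ (cx S *ᵥ (cx φ.space *ᵥ w')) = w ⬝ᵥ (cx (φ.pullQuad S) *ᵥ w') := by
  rw [pullQuad, cx_mul, cx_mul, ← Matrix.mulVec_mulVec, ← Matrix.mulVec_mulVec, cx_transpose,
    Matrix.dotProduct_mulVec w, Matrix.vecMul_transpose]

lemma single_ne_zero' (i : Fin 4) : (Pi.single i 1 : Fin 4 → ℂ) ≠ 0 := by
  intro h
  simpa using congrFun h i

lemma center_fst : P.fst.center =
    Projectivization.mk ℂ (cx φ.space *ᵥ Pi.single 3 1) (φ.mulVec_ne_zero (single_ne_zero' 3)) := by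
  apply Camera.center_eq
  rw [Matrix.mulVec_mulVec, ← cx_mul, φ.fst_mul, cx_mul, ← Matrix.mulVec_mulVec]
  have : cx stdFst *ᵥ (Pi.single 3 1 : Fin 4 → ℂ) = 0 := by
    funext i; fin_cases i <;> simp [stdFst]
  rw [this, Matrix.mulVec_zero]

lemma center_snd : P.snd.center =
    Projectivization.mk ℂ (cx φ.space *ᵥ Pi.single 2 1) (φ.mulVec_ne_zero (single_ne_zero' 2)) := by
  apply Camera.center_eq
  rw [Matrix.mulVec_mulVec, ← cx_mul, φ.snd_mul, cx_mul, ← Matrix.mulVec_mulVec]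
  have : cx stdSnd *ᵥ (Pi.single 2 1 : Fin 4 → ℂ) = 0 := by
    funext i; fin_cases i <;> simp [stdSnd]
  rw [this, Matrix.mulVec_zero]

lemma single_form (T : Matrix (Fin 4) (Fin 4) ℝ) (i j : Fin 4) :
    (Pi.single i 1 : Fin 4 → ℂ) ⬝ᵥ (cx T *ᵥ (Pi.single j 1 : Fin 4 → ℂ)) = (T i j : ℂ) := by
  simp

lemma center_fst_mem_points (S : Quadric) :
    P.fst.center ∈ S.points ↔ φ.pullQuad S.mat 3 3 = 0 := by
  rw [φ.center_fst, S.mk_mem_points, φ.form_pullQuad, single_form, Complex.ofReal_eq_zero]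

lemma center_snd_mem_points (S : Quadric) :
    P.snd.center ∈ S.points ↔ φ.pullQuad S.mat 2 2 = 0 := by
  rw [φ.center_snd, S.mk_mem_points, φ.form_pullQuad, single_form, Complex.ofReal_eq_zero]

lemma mulVec_single_eq_zero (S : Matrix (Fin 4) (Fin 4) ℝ) (j : Fin 4) :
    cx S *ᵥ (cx φ.space *ᵥ Pi.single j 1) = 0 ↔ ∀ i, φ.pullQuad S i j = 0 := by
  constructor
  · intro h i
    have := φ.form_pullQuad S (Pi.single i 1) (Pi.single j 1)
    rw [h, dotProduct_zero, single_form] at this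
    exact_mod_cast this.symm
  · intro h
    apply (dotProduct_eq_zero_iff).1
    intro z
    have hz : cx (φ.pullQuad S) *ᵥ (Pi.single j 1 : Fin 4 → ℂ) = 0 := by
      funext i; simp [h i]
    rw [dotProduct_comm, ← φ.mulVec_inv_mulVec z, φ.form_pullQuad, hz, dotProduct_zero]

lemma center_fst_mem_singularLocus (S : Quadric) :
    P.fst.center ∈ S.singularLocus ↔ ∀ i, φ.pullQuad S.mat i 3 = 0 := by
  rw [φ.center_fst, S.mk_mem_singularLocus, φ.mulVec_single_eq_zero]

lemma center_snd_mem_singularLocus (S : Quadric) :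
    P.snd.center ∈ S.singularLocus ↔ ∀ i, φ.pullQuad S.mat i 2 = 0 := by
  rw [φ.center_snd, S.mk_mem_singularLocus, φ.mulVec_single_eq_zero]

lemma pullQuad_isSymm {S : Matrix (Fin 4) (Fin 4) ℝ} (hS : S.IsSymm) : (φ.pullQuad S).IsSymm := by
  rw [Matrix.IsSymm, pullQuad, Matrix.transpose_mul, Matrix.transpose_mul,
    Matrix.transpose_transpose, hS, Matrix.mul_assoc]

/-- The centres are isotropic, so on the line joining them only the mixed term of the form survives.
-/
lemma onCommonLine_iff (S : Quadric) (h₁ : φ.pullQuad S.mat 3 3 = 0)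
    (h₂ : φ.pullQuad S.mat 2 2 = 0) :
    S.OnCommonLine P.fst.center P.snd.center ↔ φ.pullQuad S.mat 2 3 = 0 := by
  have hsym : φ.pullQuad S.mat 3 2 = φ.pullQuad S.mat 2 3 :=
    (φ.pullQuad_isSymm S.symm).apply 2 3
  have key : ∀ a b : ℂ, (a • (cx φ.space *ᵥ Pi.single 3 1) + b • (cx φ.space *ᵥ Pi.single 2 1)) ⬝ᵥ
      (cx S.mat *ᵥ (a • (cx φ.space *ᵥ Pi.single 3 1) + b • (cx φ.space *ᵥ Pi.single 2 1))) =
      2 * a * b * (φ.pullQuad S.mat 2 3 : ℂ) := by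
    intro a b
    simp only [Matrix.mulVec_add, Matrix.mulVec_smul, add_dotProduct, dotProduct_add,
      smul_dotProduct, dotProduct_smul, φ.form_pullQuad, single_form, h₁, h₂, hsym, smul_eq_mul,
      Complex.ofReal_zero]
    ring
  rw [Quadric.OnCommonLine, φ.center_fst, φ.center_snd]
  constructor
  · intro h
    have hne : (1 : ℂ) • (cx φ.space *ᵥ Pi.single 3 1) + (1 : ℂ) • (cx φ.space *ᵥ Pi.single 2 1)
        ≠ 0 := by
      rw [one_smul, one_smul, ← Matrix.mulVec_add]
      apply φ.mulVec_ne_zero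
      intro h0
      simpa using congrFun h0 3
    have := h ((mk_mem_lineThrough _ _ hne).2 ⟨1, 1, rfl⟩)
    rw [S.mk_mem_points, key] at this
    simpa using this
  · intro h x
    induction x using Projectivization.ind with
    | h v hv =>
      rw [mk_mem_lineThrough, S.mk_mem_points]
      rintro ⟨a, b, rfl⟩
      rw [key, h]
      simp

lemma onCommonLine_of_inCommonPlane (S : Quadric) (p q : Space) (h : S.InCommonPlane p q) :
    S.OnCommonLine p q := by
  obtain ⟨l, -, hl, hp, hq⟩ := h
  refine Set.Subset.trans ?_ hl
  induction p using Projectivization.ind with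
  | h p hp0 =>
    induction q using Projectivization.ind with
    | h q hq0 =>
      intro x
      induction x using Projectivization.ind with
      | h v hv =>
        rw [mk_mem_plane] at hp hq ⊢
        rw [mk_mem_lineThrough]
        rintro ⟨a, b, rfl⟩
        rw [dotProduct_add, dotProduct_smul, dotProduct_smul, hp, hq, smul_zero, smul_zero, add_zero]

/-- The quadratic form is twice the product of the linear forms `l` and `m`, and `l` vanishes at
both centres. -/
lemma inCommonPlane_of_pullQuad (S : Quadric) {l m : Fin 4 → ℝ} (hl : l ≠ 0) (h₂ : l 2 = 0)
    (h₃ : l 3 = 0) (h : φ.pullQuad S.mat = Matrix.vecMulVec l m + Matrix.vecMulVec m l) :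
    S.InCommonPlane P.fst.center P.snd.center := by
  -- Linear forms are transported by the inverse transpose of the coordinate change.
  have key : ∀ w, (cx φ.space⁻¹ᵀ *ᵥ cxv l) ⬝ᵥ (cx φ.space *ᵥ w) = cxv l ⬝ᵥ w := by
    intro w
    rw [cx_transpose, Matrix.mulVec_transpose, ← Matrix.dotProduct_mulVec, φ.inv_mulVec_mulVec]
  refine ⟨cx φ.space⁻¹ᵀ *ᵥ cxv l, ?_, ?_, ?_, ?_⟩
  · intro h0
    apply cxv_ne_zero hl
    apply (dotProduct_eq_zero_iff).1
    intro w
    rw [← key, h0, zero_dotProduct]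
  · intro x
    induction x using Projectivization.ind with
    | h v hv =>
      rw [mk_mem_plane, S.mk_mem_points, ← φ.mulVec_inv_mulVec v, key, φ.form_pullQuad]
      generalize cx φ.space⁻¹ *ᵥ v = w
      intro hw
      have e : cx (Matrix.vecMulVec l m + Matrix.vecMulVec m l) =
          Matrix.vecMulVec (cxv l) (cxv m) + Matrix.vecMulVec (cxv m) (cxv l) := by
        ext i j; simp [Matrix.vecMulVec_apply, cxv]
      rw [h, e, Matrix.add_mulVec, Matrix.vecMulVec_mulVec, Matrix.vecMulVec_mulVec, hw,
        dotProduct_add, op_smul_eq_smul, op_smul_eq_smul, dotProduct_smul, dotProduct_smul,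
        dotProduct_comm w, hw]
      simp
  · rw [φ.center_fst, mk_mem_plane, key]
    simp [cxv, h₃]
  · rw [φ.center_snd, mk_mem_plane, key]
    simp [cxv, h₂]

/-- The entries of `F` can be read off from those of the quadric. Only a multiple of `stdFund`
remains free, and it is fixed by making the entry `1 0` zero. -/
lemma exists_pullQuad_eq_stdQuad (S : Quadric) (h₁ : φ.pullQuad S.mat 3 3 = 0)
    (h₂ : φ.pullQuad S.mat 2 2 = 0) : ∃ F, S.mat = P.quadMat F := by
  have hs := φ.pullQuad_isSymm S.symm
  obtain ⟨F, hF⟩ := φ.pull_surjective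
    !![φ.pullQuad S.mat 0 0 / 2, φ.pullQuad S.mat 0 1, φ.pullQuad S.mat 0 3;
       0, φ.pullQuad S.mat 1 1 / 2, φ.pullQuad S.mat 1 3;
       φ.pullQuad S.mat 2 0, φ.pullQuad S.mat 2 1, φ.pullQuad S.mat 2 3]
  refine ⟨F, φ.pullQuad_injective ?_⟩
  have e : φ.pullQuad (P.quadMat F) = stdQuad (φ.pull F) := φ.quadMat_eq F
  rw [e, hF]
  ext i j
  fin_cases i <;> fin_cases j <;> simp [stdQuad, h₁, h₂, mul_div_cancel₀] <;> exact hs.apply _ _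

end CameraPair.Frame

/-! ### Ranks -/

lemma rank_lt_of_det_eq_zero {n : ℕ} {A : Matrix (Fin n) (Fin n) ℝ} (h : A.det = 0) :
    A.rank < n := by
  have hle : A.rank ≤ n := A.rank_le_width
  refine lt_of_le_of_ne hle fun hr => ?_
  have hs : Function.Surjective A.mulVecLin := by
    rw [← LinearMap.range_eq_top]
    apply Submodule.eq_top_of_finrank_eq
    rw [Matrix.rank] at hr
    simpa using hr
  have : IsUnit A := Matrix.mulVec_surjective_iff_isUnit.1 hs
  rw [Matrix.isUnit_iff_isUnit_det, h] at this
  simp at this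

lemma le_rank_of_minor {m n k : ℕ} {A : Matrix (Fin m) (Fin n) ℝ} (r : Fin k → Fin m)
    (c : Fin k → Fin n) (h : (A.submatrix r c).det ≠ 0) : k ≤ A.rank := by
  have h₁ := A.rank_submatrix_le r c
  rw [Matrix.rank_of_isUnit _ ((Matrix.isUnit_iff_isUnit_det _).2 (isUnit_iff_ne_zero.2 h)),
    Fintype.card_fin] at h₁
  exact h₁

lemma rank_eq_of_det_ne_zero {n : ℕ} {A : Matrix (Fin n) (Fin n) ℝ} (h : A.det ≠ 0) :
    A.rank = n := by
  rw [Matrix.rank_of_isUnit _ ((Matrix.isUnit_iff_isUnit_det _).2 (isUnit_iff_ne_zero.2 h)),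
    Fintype.card_fin]

lemma rank_vecMulVec_add_le_two {m n : ℕ} (u w : Fin m → ℝ) (v x : Fin n → ℝ) :
    (Matrix.vecMulVec u v + Matrix.vecMulVec w x).rank ≤ 2 := by
  have : Matrix.vecMulVec u v + Matrix.vecMulVec w x =
      (Matrix.of fun i => ![u i, w i]) * (Matrix.of ![v, x]) := by
    ext i j
    simp [Matrix.mul_apply, Fin.sum_univ_two, Matrix.vecMulVec_apply]
  rw [this]
  exact (Matrix.rank_mul_le_left _ _).trans (Matrix.rank_le_width _)

lemma rank_eq_two_of_adjugate_ne_zero {F : Matrix (Fin 3) (Fin 3) ℝ} (hdet : F.det = 0)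
    (hadj : F.adjugate ≠ 0) : F.rank = 2 := by
  apply le_antisymm (Nat.le_of_lt_succ (rank_lt_of_det_eq_zero hdet))
  obtain ⟨i, j, hij⟩ : ∃ i j, F.adjugate i j ≠ 0 := by
    by_contra! h
    exact hadj (by ext i j; exact h i j)
  rw [Matrix.adjugate_fin_succ_eq_det_submatrix] at hij
  exact le_rank_of_minor j.succAbove i.succAbove (right_ne_zero_of_mul hij)

/-- A real quadratic form in four variables that vanishes on a plane through the origin has
nonnegative determinant. -/
lemma det_nonneg_of_isotropic {S : Matrix (Fin 4) (Fin 4) ℝ} (hS : S.IsSymm)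
    {W : Submodule ℝ (Fin 4 → ℝ)} (hW : Module.finrank ℝ W = 2)
    (h : ∀ w ∈ W, w ⬝ᵥ (S *ᵥ w) = 0) : 0 ≤ S.det := by
  let b := Module.finBasisOfFinrankEq ℝ W hW
  have li : LinearIndependent ℝ (fun i => (b i : Fin 4 → ℝ)) :=
    b.linearIndependent.map' W.subtype (Submodule.ker_subtype W)
  obtain ⟨g, hg⟩ := exists_linearIndependent_cons_of_lt_finrank li (by simp)
  obtain ⟨g', hg'⟩ := exists_linearIndependent_cons_of_lt_finrank hg (by simp)
  -- The rows of `R` form a basis whose last two vectors span `W`.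
  obtain ⟨R, hR⟩ : ∃ R : Matrix (Fin 4) (Fin 4) ℝ,
      R = Matrix.of (Fin.cons g' (Fin.cons g fun i => (b i : Fin 4 → ℝ))) := ⟨_, rfl⟩
  have hdet : R.det ≠ 0 := by
    rw [← isUnit_iff_ne_zero, ← Matrix.isUnit_iff_isUnit_det,
      ← Matrix.linearIndependent_rows_iff_isUnit, hR]
    exact hg'
  have e : ∀ i j, (R * S * Rᵀ) i j = R i ⬝ᵥ (S *ᵥ R j) := by
    intro i j
    rw [Matrix.mul_assoc, Matrix.mul_apply']
    congr 1
  have hr2 : R 2 = b 0 := by rw [hR]; rfl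
  have hr3 : R 3 = b 1 := by rw [hR]; rfl
  have h00 := h _ (b 0).2
  have h11 := h _ (b 1).2
  have h01 : (b 0 : Fin 4 → ℝ) ⬝ᵥ (S *ᵥ (b 1 : Fin 4 → ℝ)) = 0 := by
    have := h _ (W.add_mem (b 0).2 (b 1).2)
    rw [Matrix.mulVec_add, add_dotProduct, dotProduct_add, dotProduct_add, h00, h11,
      symm_dotProduct_mulVec hS] at this
    rw [symm_dotProduct_mulVec hS]
    linarith
  have hsym : (R * S * Rᵀ).IsSymm := by
    rw [Matrix.IsSymm, Matrix.transpose_mul, Matrix.transpose_mul, Matrix.transpose_transpose, hS,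
      Matrix.mul_assoc]
  have m22 : (R * S * Rᵀ) 2 2 = 0 := by rw [e, hr2, h00]
  have m33 : (R * S * Rᵀ) 3 3 = 0 := by rw [e, hr3, h11]
  have m23 : (R * S * Rᵀ) 2 3 = 0 := by rw [e, hr2, hr3, h01]
  have hd : R.det * S.det * R.det = (R * S * Rᵀ).det := by simp
  generalize R * S * Rᵀ = M at *
  have m32 : M 3 2 = 0 := by rw [hsym.apply 2 3, m23]
  -- With a zero lower right 2×2 block, the determinant is the square of that of the off-diagonal
  -- block.
  have hM : M.det = (M 0 2 * M 1 3 - M 0 3 * M 1 2) ^ 2 := by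
    rw [Matrix.det_succ_row_zero]
    simp only [Fin.sum_univ_four, Matrix.det_fin_three, Matrix.submatrix_apply]
    simp [Fin.succAbove, m22, m33, m23, m32, hsym.apply 0 2, hsym.apply 0 3, hsym.apply 1 2,
      hsym.apply 1 3, hsym.apply 0 1]
    ring
  have hpos : 0 < R.det * R.det := mul_self_pos.2 hdet
  have : 0 ≤ (R.det * R.det) * S.det := by
    have : R.det * R.det * S.det = M.det := by rw [← hd]; ring
    rw [this, hM]; positivity
  exact nonneg_of_mul_nonneg_right this hpos

/-! ### Invariants of pencils of fundamental matrices -/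

/-- The coefficient of `a² b` in `det (a F + b G)`. -/
def mix (F G : Matrix (Fin 3) (Fin 3) ℝ) : ℝ := (F.adjugate * G).trace

/-- A common right kernel vector. -/
def CommonRight (F G : Matrix (Fin 3) (Fin 3) ℝ) : Prop :=
  ∃ v : Fin 3 → ℝ, v ≠ 0 ∧ F *ᵥ v = 0 ∧ G *ᵥ v = 0

/-- A common left kernel vector. -/
def CommonLeft (F G : Matrix (Fin 3) (Fin 3) ℝ) : Prop :=
  ∃ v : Fin 3 → ℝ, v ≠ 0 ∧ v ᵥ* F = 0 ∧ v ᵥ* G = 0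

/-- The pencil contains a matrix of rank at most one. -/
def HasRankOne (F G : Matrix (Fin 3) (Fin 3) ℝ) : Prop :=
  ∃ a b : ℝ, ¬ (a = 0 ∧ b = 0) ∧ (a • F + b • G).adjugate = 0

/-- The pencil contains a matrix of rank at most one at which the adjugate, as a quadratic map on
the pencil, is degenerate. -/
def HasDegenerateRankOne (F G : Matrix (Fin 3) (Fin 3) ℝ) : Prop :=
  ∃ a b : ℝ, ¬ (a = 0 ∧ b = 0) ∧ (a • F + b • G).adjugate = 0 ∧
    ∀ x y : ℝ, ((x • F + y • G) + (a • F + b • G)).adjugate = (x • F + y • G).adjugate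

/-- The type of the critical quadric in terms of the pencil of fundamental matrices. -/
def PencilType (F G : Matrix (Fin 3) (Fin 3) ℝ) : QuadricType → Prop
  | .smoothNotOnLine => mix F G ≠ 0 ∧ mix G F ≠ 0
  | .smoothOnLine => mix F G = 0 ∧ mix G F ≠ 0
  | .coneNotOnLine => mix F G ≠ 0 ∧ mix G F = 0
  | .coneVertex => mix F G = 0 ∧ mix G F = 0 ∧ Xor (CommonRight F G) (CommonLeft F G) ∧
      ¬ HasRankOne F G
  | .planesSamePlane => mix F G = 0 ∧ mix G F = 0 ∧ ¬ CommonRight F G ∧ ¬ CommonLeft F G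
  | .planesOneSingular => mix F G = 0 ∧ mix G F = 0 ∧ Xor (CommonRight F G) (CommonLeft F G) ∧
      HasRankOne F G
  | .planesBothSingular => mix F G = 0 ∧ mix G F = 0 ∧ CommonRight F G ∧ CommonLeft F G ∧
      ¬ HasDegenerateRankOne F G
  | .doublePlane => mix F G = 0 ∧ mix G F = 0 ∧ CommonRight F G ∧ CommonLeft F G ∧
      HasDegenerateRankOne F G

/-- The conditions were chosen as an exhaustive case distinction, so every quadric of critical
points occurs in the table. -/
lemma exists_pencilType (F G : Matrix (Fin 3) (Fin 3) ℝ) : ∃ t, PencilType F G t := by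
  by_cases h₁ : mix F G = 0 <;> by_cases h₂ : mix G F = 0
  · by_cases h₃ : CommonRight F G <;> by_cases h₄ : CommonLeft F G
    · by_cases h₅ : HasDegenerateRankOne F G
      · exact ⟨.doublePlane, h₁, h₂, h₃, h₄, h₅⟩
      · exact ⟨.planesBothSingular, h₁, h₂, h₃, h₄, h₅⟩
    · by_cases h₅ : HasRankOne F G
      · exact ⟨.planesOneSingular, h₁, h₂, Or.inl ⟨h₃, h₄⟩, h₅⟩
      · exact ⟨.coneVertex, h₁, h₂, Or.inl ⟨h₃, h₄⟩, h₅⟩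
    · by_cases h₅ : HasRankOne F G
      · exact ⟨.planesOneSingular, h₁, h₂, Or.inr ⟨h₄, h₃⟩, h₅⟩
      · exact ⟨.coneVertex, h₁, h₂, Or.inr ⟨h₄, h₃⟩, h₅⟩
    · exact ⟨.planesSamePlane, h₁, h₂, h₃, h₄⟩
  · exact ⟨.smoothOnLine, h₁, h₂⟩
  · exact ⟨.coneNotOnLine, h₁, h₂⟩
  · exact ⟨.smoothNotOnLine, h₁, h₂⟩

lemma commonRight_comm (F G : Matrix (Fin 3) (Fin 3) ℝ) : CommonRight F G ↔ CommonRight G F :=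
  exists_congr fun _ => and_congr_right fun _ => and_comm

lemma commonLeft_comm (F G : Matrix (Fin 3) (Fin 3) ℝ) : CommonLeft F G ↔ CommonLeft G F :=
  exists_congr fun _ => and_congr_right fun _ => and_comm

lemma HasRankOne.symm {F G : Matrix (Fin 3) (Fin 3) ℝ} : HasRankOne F G → HasRankOne G F := by
  rintro ⟨a, b, h, h'⟩
  exact ⟨b, a, fun h0 => h h0.symm, by rwa [add_comm]⟩

lemma HasDegenerateRankOne.symm {F G : Matrix (Fin 3) (Fin 3) ℝ} :
    HasDegenerateRankOne F G → HasDegenerateRankOne G F := by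
  rintro ⟨a, b, h, h', h''⟩
  refine ⟨b, a, fun h0 => h h0.symm, by rwa [add_comm], fun x y => ?_⟩
  rw [add_comm (b • G), add_comm (x • G)]
  exact h'' y x

lemma hasRankOne_comm (F G : Matrix (Fin 3) (Fin 3) ℝ) : HasRankOne F G ↔ HasRankOne G F :=
  ⟨HasRankOne.symm, HasRankOne.symm⟩

lemma hasDegenerateRankOne_comm (F G : Matrix (Fin 3) (Fin 3) ℝ) :
    HasDegenerateRankOne F G ↔ HasDegenerateRankOne G F :=
  ⟨HasDegenerateRankOne.symm, HasDegenerateRankOne.symm⟩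

/-- Exchanging the matrices trades the two mixed coefficients and leaves the other invariants alone,
so only the smooth quadric on a line and the cone off a line change places. -/
lemma PencilType.swap {F G : Matrix (Fin 3) (Fin 3) ℝ} {t : QuadricType} (h : PencilType F G t) :
    PencilType G F t.conjugate := by
  cases t <;>
    simp only [QuadricType.conjugate, PencilType, commonRight_comm G F, commonLeft_comm G F,
      hasRankOne_comm G F, hasDegenerateRankOne_comm G F] at h ⊢ <;> tauto

/-! ### The invariants in adapted coordinates -/

namespace CameraPair.Frame

variable {P : CameraPair} (φ : P.Frame)

lemma adjugate_pull (F : Matrix (Fin 3) (Fin 3) ℝ) :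
    (φ.pull F).adjugate = φ.right.adjugate * F.adjugate * φ.leftᵀ.adjugate := by
  rw [pull, Matrix.adjugate_mul_distrib, Matrix.adjugate_mul_distrib, Matrix.mul_assoc]

lemma adjugate_pull_inj (F G : Matrix (Fin 3) (Fin 3) ℝ) :
    (φ.pull F).adjugate = (φ.pull G).adjugate ↔ F.adjugate = G.adjugate := by
  rw [adjugate_pull, adjugate_pull]
  refine ⟨fun h => ?_, fun h => by rw [h]⟩
  have h' := congrArg (fun M => φ.right * (M * φ.leftᵀ)) h
  simp only [Matrix.mul_assoc, Matrix.adjugate_mul, Matrix.mul_smul, Matrix.mul_one] at h'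
  simp only [← Matrix.mul_assoc, Matrix.mul_adjugate, Matrix.smul_mul, Matrix.one_mul,
    Matrix.det_transpose] at h'
  rw [smul_right_inj φ.det_left, smul_right_inj φ.det_right] at h'
  exact h'

lemma adjugate_pull_eq_zero (F : Matrix (Fin 3) (Fin 3) ℝ) :
    (φ.pull F).adjugate = 0 ↔ F.adjugate = 0 := by
  have := φ.adjugate_pull_inj F 0
  simpa [pull] using this

lemma det_pull (F : Matrix (Fin 3) (Fin 3) ℝ) :
    (φ.pull F).det = φ.left.det * F.det * φ.right.det := by
  simp [pull]

/-- Pulling back multiplies `det (a F + b G)`, and with it each coefficient, by the determinants of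
the two image coordinate changes. -/
lemma mix_pull (F G : Matrix (Fin 3) (Fin 3) ℝ) :
    mix (φ.pull F) (φ.pull G) = φ.left.det * φ.right.det * mix F G := by
  rw [mix, adjugate_pull, pull]
  have : φ.right.adjugate * F.adjugate * φ.leftᵀ.adjugate * (φ.leftᵀ * G * φ.right) =
      φ.right.adjugate * (F.adjugate * ((φ.leftᵀ.adjugate * φ.leftᵀ) * G) * φ.right) := by
    simp only [Matrix.mul_assoc]
  rw [this, Matrix.trace_mul_comm, Matrix.adjugate_mul, Matrix.smul_mul, Matrix.one_mul,
    Matrix.mul_assoc, Matrix.mul_adjugate, Matrix.det_transpose]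
  simp [mix, mul_assoc]
  ring

lemma mix_smul_left (c : ℝ) (F G : Matrix (Fin 3) (Fin 3) ℝ) : mix (c • F) G = c ^ 2 * mix F G := by
  simp [mix, Matrix.adjugate_smul]

lemma mix_smul_right (c : ℝ) (F G : Matrix (Fin 3) (Fin 3) ℝ) : mix F (c • G) = c * mix F G := by
  simp [mix]

lemma adjugate_stdFund : stdFund.adjugate = !![0, 0, 0; 0, 0, 0; 0, 0, 1] := by
  rw [Matrix.adjugate_fin_three]
  simp [stdFund]

lemma mix_stdFund_left (g : Matrix (Fin 3) (Fin 3) ℝ) : mix stdFund g = g 2 2 := by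
  rw [mix, adjugate_stdFund]
  simp [Matrix.trace, Fin.sum_univ_three, Matrix.vecMul, dotProduct]

lemma mix_stdFund_right (g : Matrix (Fin 3) (Fin 3) ℝ) :
    mix g stdFund = (g 0 1 * g 2 2 - g 0 2 * g 2 1) - (g 1 0 * g 2 2 - g 1 2 * g 2 0) := by
  rw [mix, Matrix.adjugate_fin_three]
  simp [Matrix.trace, Fin.sum_univ_three, stdFund]
  ring

lemma mix_fundamentalMatrix_left (F : Matrix (Fin 3) (Fin 3) ℝ) :
    mix P.fundamentalMatrix F = 0 ↔ φ.pull F 2 2 = 0 := by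
  obtain ⟨c, hc, h⟩ := φ.exists_pull_fundamentalMatrix
  have := φ.mix_pull P.fundamentalMatrix F
  rw [h, mix_smul_left, mix_stdFund_left] at this
  constructor
  · intro h0
    simpa [h0, hc] using this
  · intro h0
    simpa [h0, φ.det_left, φ.det_right] using this

lemma mix_fundamentalMatrix_right (F : Matrix (Fin 3) (Fin 3) ℝ) :
    mix F P.fundamentalMatrix = 0 ↔ mix (φ.pull F) stdFund = 0 := by
  obtain ⟨c, hc, h⟩ := φ.exists_pull_fundamentalMatrix
  have := φ.mix_pull F P.fundamentalMatrix
  rw [h, mix_smul_right] at this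
  constructor
  · intro h0
    simpa [h0, hc] using this
  · intro h0
    simpa [h0, φ.det_left, φ.det_right] using this

lemma isUnit_det_left : IsUnit φ.leftᵀ.det := by
  rw [Matrix.det_transpose]; exact isUnit_iff_ne_zero.2 φ.det_left

lemma isUnit_det_right : IsUnit φ.right.det := isUnit_iff_ne_zero.2 φ.det_right

lemma pull_mulVec_eq_zero (F : Matrix (Fin 3) (Fin 3) ℝ) (v : Fin 3 → ℝ) :
    φ.pull F *ᵥ v = 0 ↔ F *ᵥ (φ.right *ᵥ v) = 0 := by
  rw [pull, Matrix.mulVec_mulVec, Matrix.mul_assoc, ← Matrix.mulVec_mulVec]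
  constructor
  · intro h
    have := congrArg (φ.leftᵀ⁻¹ *ᵥ ·) h
    simpa [Matrix.mulVec_mulVec, Matrix.nonsing_inv_mul_cancel_left _ _ φ.isUnit_det_left] using this
  · intro h
    rw [h, Matrix.mulVec_zero]

lemma commonRight_pull (F G : Matrix (Fin 3) (Fin 3) ℝ) :
    CommonRight (φ.pull F) (φ.pull G) ↔ CommonRight F G := by
  constructor
  · rintro ⟨v, hv, h₁, h₂⟩
    refine ⟨φ.right *ᵥ v, fun h0 => hv ?_, (φ.pull_mulVec_eq_zero F v).1 h₁,
      (φ.pull_mulVec_eq_zero G v).1 h₂⟩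
    have := congrArg (φ.right⁻¹ *ᵥ ·) h0
    simpa [Matrix.mulVec_mulVec, Matrix.nonsing_inv_mul _ φ.isUnit_det_right] using this
  · rintro ⟨v, hv, h₁, h₂⟩
    have e : φ.right *ᵥ (φ.right⁻¹ *ᵥ v) = v := by
      rw [Matrix.mulVec_mulVec, Matrix.mul_nonsing_inv _ φ.isUnit_det_right, Matrix.one_mulVec]
    refine ⟨φ.right⁻¹ *ᵥ v, fun h0 => hv ?_, (φ.pull_mulVec_eq_zero F _).2 (by rw [e, h₁]),
      (φ.pull_mulVec_eq_zero G _).2 (by rw [e, h₂])⟩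
    rw [← e, h0, Matrix.mulVec_zero]

lemma vecMul_pull_eq_zero (F : Matrix (Fin 3) (Fin 3) ℝ) (v : Fin 3 → ℝ) :
    v ᵥ* φ.pull F = 0 ↔ (φ.left *ᵥ v) ᵥ* F = 0 := by
  rw [pull, ← Matrix.vecMul_vecMul, ← Matrix.vecMul_vecMul, Matrix.vecMul_transpose]
  constructor
  · intro h
    have := congrArg (· ᵥ* φ.right⁻¹) h
    simpa [Matrix.vecMul_vecMul, Matrix.mul_nonsing_inv_cancel_right _ _ φ.isUnit_det_right]
      using this
  · intro h
    rw [h, Matrix.zero_vecMul]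

lemma commonLeft_pull (F G : Matrix (Fin 3) (Fin 3) ℝ) :
    CommonLeft (φ.pull F) (φ.pull G) ↔ CommonLeft F G := by
  have hl : IsUnit φ.left.det := isUnit_iff_ne_zero.2 φ.det_left
  constructor
  · rintro ⟨v, hv, h₁, h₂⟩
    refine ⟨φ.left *ᵥ v, fun h0 => hv ?_, (φ.vecMul_pull_eq_zero F v).1 h₁,
      (φ.vecMul_pull_eq_zero G v).1 h₂⟩
    have := congrArg (φ.left⁻¹ *ᵥ ·) h0
    simpa [Matrix.mulVec_mulVec, Matrix.nonsing_inv_mul _ hl] using this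
  · rintro ⟨v, hv, h₁, h₂⟩
    have e : φ.left *ᵥ (φ.left⁻¹ *ᵥ v) = v := by
      rw [Matrix.mulVec_mulVec, Matrix.mul_nonsing_inv _ hl, Matrix.one_mulVec]
    refine ⟨φ.left⁻¹ *ᵥ v, fun h0 => hv ?_, (φ.vecMul_pull_eq_zero F _).2 (by rw [e, h₁]),
      (φ.vecMul_pull_eq_zero G _).2 (by rw [e, h₂])⟩
    rw [← e, h0, Matrix.mulVec_zero]

lemma commonRight_stdFund {c : ℝ} (hc : c ≠ 0) (g : Matrix (Fin 3) (Fin 3) ℝ) :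
    CommonRight (c • stdFund) g ↔ g 0 2 = 0 ∧ g 1 2 = 0 ∧ g 2 2 = 0 := by
  constructor
  · rintro ⟨v, hv, h₁, h₂⟩
    have a := congrFun h₁ 0
    have b := congrFun h₁ 1
    simp [Matrix.mulVec, dotProduct, Fin.sum_univ_three, stdFund, hc] at a b
    have h2 : v 2 ≠ 0 := by
      intro h
      apply hv
      funext i
      fin_cases i <;> assumption
    have e : ∀ i, g i 2 = 0 := by
      intro i
      have := congrFun h₂ i
      simpa [Matrix.mulVec, dotProduct, Fin.sum_univ_three, a, b, h2] using this
    exact ⟨e 0, e 1, e 2⟩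
  · rintro ⟨h0, h1, h2⟩
    refine ⟨Pi.single 2 1, by simp, ?_, ?_⟩
    · funext i; fin_cases i <;> simp [stdFund]
    · funext i; fin_cases i <;> simpa

lemma commonLeft_stdFund {c : ℝ} (hc : c ≠ 0) (g : Matrix (Fin 3) (Fin 3) ℝ) :
    CommonLeft (c • stdFund) g ↔ g 2 0 = 0 ∧ g 2 1 = 0 ∧ g 2 2 = 0 := by
  constructor
  · rintro ⟨v, hv, h₁, h₂⟩
    have a := congrFun h₁ 0
    have b := congrFun h₁ 1
    simp [Matrix.vecMul, dotProduct, Fin.sum_univ_three, stdFund, hc] at a b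
    have h2 : v 2 ≠ 0 := by
      intro h
      apply hv
      funext i
      fin_cases i <;> assumption
    have e : ∀ i, g 2 i = 0 := by
      intro i
      have := congrFun h₂ i
      simpa [Matrix.vecMul, dotProduct, Fin.sum_univ_three, a, b, h2] using this
    exact ⟨e 0, e 1, e 2⟩
  · rintro ⟨h0, h1, h2⟩
    refine ⟨Pi.single 2 1, by simp, ?_, ?_⟩
    · funext i; fin_cases i <;> simp [stdFund]
    · funext i; fin_cases i <;> simpa

lemma commonRight_fundamentalMatrix (F : Matrix (Fin 3) (Fin 3) ℝ) :
    CommonRight P.fundamentalMatrix F ↔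
      φ.pull F 0 2 = 0 ∧ φ.pull F 1 2 = 0 ∧ φ.pull F 2 2 = 0 := by
  obtain ⟨c, hc, h⟩ := φ.exists_pull_fundamentalMatrix
  rw [← φ.commonRight_pull, h, commonRight_stdFund hc]

lemma commonLeft_fundamentalMatrix (F : Matrix (Fin 3) (Fin 3) ℝ) :
    CommonLeft P.fundamentalMatrix F ↔
      φ.pull F 2 0 = 0 ∧ φ.pull F 2 1 = 0 ∧ φ.pull F 2 2 = 0 := by
  obtain ⟨c, hc, h⟩ := φ.exists_pull_fundamentalMatrix
  rw [← φ.commonLeft_pull, h, commonLeft_stdFund hc]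

lemma hasRankOne_fundamentalMatrix (F : Matrix (Fin 3) (Fin 3) ℝ) :
    HasRankOne P.fundamentalMatrix F ↔ HasRankOne stdFund (φ.pull F) := by
  obtain ⟨c, hc, h⟩ := φ.exists_pull_fundamentalMatrix
  have e : ∀ a b : ℝ, (a • P.fundamentalMatrix + b • F).adjugate = 0 ↔
      ((a * c) • stdFund + b • φ.pull F).adjugate = 0 := by
    intro a b
    rw [← φ.adjugate_pull_eq_zero, φ.pull_add, φ.pull_smul, φ.pull_smul, h, smul_smul]
  constructor
  · rintro ⟨a, b, h0, h₁⟩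
    exact ⟨a * c, b, by simpa [hc] using h0, (e a b).1 h₁⟩
  · rintro ⟨a, b, h0, h₁⟩
    refine ⟨a / c, b, by simpa [hc] using h0, (e _ _).2 ?_⟩
    rwa [div_mul_cancel₀ _ hc]

lemma hasDegenerateRankOne_fundamentalMatrix (F : Matrix (Fin 3) (Fin 3) ℝ) :
    HasDegenerateRankOne P.fundamentalMatrix F ↔ HasDegenerateRankOne stdFund (φ.pull F) := by
  obtain ⟨c, hc, h⟩ := φ.exists_pull_fundamentalMatrix
  have p : ∀ a b : ℝ, φ.pull (a • P.fundamentalMatrix + b • F) =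
      (a * c) • stdFund + b • φ.pull F := by
    intro a b
    rw [φ.pull_add, φ.pull_smul, φ.pull_smul, h, smul_smul]
  constructor
  · rintro ⟨a, b, h0, h₁, h₂⟩
    refine ⟨a * c, b, by simpa [hc] using h0, ?_, fun x y => ?_⟩
    · rwa [← p, φ.adjugate_pull_eq_zero]
    · have := h₂ (x / c) y
      rwa [← φ.adjugate_pull_inj, φ.pull_add, p, p, div_mul_cancel₀ _ hc] at this
  · rintro ⟨a, b, h0, h₁, h₂⟩
    refine ⟨a / c, b, by simpa [hc] using h0, ?_, fun x y => ?_⟩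
    · rwa [← φ.adjugate_pull_eq_zero, p, div_mul_cancel₀ _ hc]
    · rw [← φ.adjugate_pull_inj, φ.pull_add, p, p, div_mul_cancel₀ _ hc]
      exact h₂ _ _

end CameraPair.Frame

/-! ### Ranks of quadrics in adapted coordinates -/

section stdQuad

variable {g : Matrix (Fin 3) (Fin 3) ℝ}

/-- The right side is the discriminant of the polynomial in `det_add_smul_stdFund`. This ties the
geometry of the quadric to the number of singular matrices `g + x • stdFund`. -/
lemma det_stdQuad (g : Matrix (Fin 3) (Fin 3) ℝ) :
    (stdQuad g).det = mix g stdFund ^ 2 - 4 * g 2 2 * g.det := by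
  rw [CameraPair.Frame.mix_stdFund_right, Matrix.det_succ_row_zero]
  simp only [Fin.sum_univ_four, Matrix.det_fin_three, Matrix.submatrix_apply]
  simp [Fin.succAbove, stdQuad]
  ring

lemma det_add_smul_stdFund (g : Matrix (Fin 3) (Fin 3) ℝ) (x : ℝ) :
    (g + x • stdFund).det = g 2 2 * x ^ 2 + mix g stdFund * x + g.det := by
  rw [CameraPair.Frame.mix_stdFund_right, Matrix.det_fin_three, Matrix.det_fin_three]
  simp [stdFund]
  ring

/-- Two principal 3×3 minors of the quadric are multiples of 2×2 minors of `g` containing `g 2 2`.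
If both vanished, `g` would have rank one. -/
lemma rank_stdQuad_of_cone (hdet : g.det = 0) (hadj : g.adjugate ≠ 0) (hf : g 2 2 ≠ 0)
    (hm : mix g stdFund = 0) : (stdQuad g).rank = 3 := by
  have h0 : (stdQuad g).det = 0 := by rw [det_stdQuad, hm, hdet]; ring
  apply le_antisymm (Nat.le_of_lt_succ (rank_lt_of_det_eq_zero h0))
  have m₀ : ((stdQuad g).submatrix ![0, 2, 3] ![0, 2, 3]).det =
      -2 * g 2 2 * (g 0 0 * g 2 2 - g 0 2 * g 2 0) := by
    rw [Matrix.det_fin_three]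
    simp [stdQuad]
    ring
  have m₁ : ((stdQuad g).submatrix ![1, 2, 3] ![1, 2, 3]).det =
      -2 * g 2 2 * (g 1 1 * g 2 2 - g 1 2 * g 2 1) := by
    rw [Matrix.det_fin_three]
    simp [stdQuad]
    ring
  by_cases h₀ : g 0 0 * g 2 2 - g 0 2 * g 2 0 = 0
  · by_cases h₁ : g 1 1 * g 2 2 - g 1 2 * g 2 1 = 0
    · exfalso
      rw [CameraPair.Frame.mix_stdFund_right] at hm
      rw [Matrix.det_fin_three] at hdet
      -- The product of the two mixed minors equals that of the principal ones minus `g 2 2 * det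
      -- g`, hence is zero; by `hm` the mixed minors coincide.
      have hs : (g 0 1 * g 2 2 - g 0 2 * g 2 1) ^ 2 = 0 := by
        linear_combination (g 0 1 * g 2 2 - g 0 2 * g 2 1) * hm - g 2 2 * hdet +
          (g 1 1 * g 2 2 - g 1 2 * g 2 1) * h₀
      have hs' := pow_eq_zero_iff (two_ne_zero) |>.1 hs
      have hs'' : g 1 0 * g 2 2 - g 1 2 * g 2 0 = 0 := by linear_combination hs' - hm
      apply hadj
      have cancel : ∀ x : ℝ, g 2 2 * x = 0 → x = 0 := fun x hx =>
        (mul_eq_zero.1 hx).resolve_left hf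
      have hk : g 1 1 * g 2 0 - g 1 0 * g 2 1 = 0 :=
        cancel _ (by linear_combination g 2 0 * h₁ - g 2 1 * hs'')
      rw [Matrix.adjugate_fin_three]
      ext i j
      fin_cases i <;> fin_cases j <;> simp <;> apply cancel
      · linear_combination g 2 2 * h₁
      · linear_combination -g 2 2 * hs'
      · linear_combination g 1 2 * hs' - g 0 2 * h₁
      · linear_combination -g 2 2 * hs''
      · linear_combination g 2 2 * h₀
      · linear_combination g 0 2 * hs'' - g 1 2 * h₀
      · linear_combination g 2 1 * hs'' - g 2 0 * h₁
      · linear_combination g 2 0 * hs' - g 2 1 * h₀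
      · linear_combination g 1 1 * h₀ - g 1 0 * hs' + g 0 2 * hk
    · exact le_rank_of_minor _ _ (by rw [m₁]; simp [hf, h₁])
  · exact le_rank_of_minor _ _ (by rw [m₀]; simp [hf, h₀])

/-- A binary quadratic form vanishing at a point is a product of linear forms. -/
lemma exists_factor {a b s d₀ d₁ : ℝ} (hd : ¬ (d₀ = 0 ∧ d₁ = 0))
    (h : b * d₀ ^ 2 - s * d₀ * d₁ + a * d₁ ^ 2 = 0) :
    ∃ m₀ m₁ : ℝ, a = d₀ * m₀ ∧ b = d₁ * m₁ ∧ s = d₀ * m₁ + d₁ * m₀ := by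
  -- The form `a X² + s X Y + b Y²` vanishes at `(d₁, -d₀)`, so `d₀ X + d₁ Y` divides it; the
  -- quotient is computed by dividing by a nonzero coefficient.
  by_cases h₀ : d₀ = 0
  · have h₁ : d₁ ≠ 0 := fun h₁ => hd ⟨h₀, h₁⟩
    subst h₀
    have ha : a = 0 := by simpa [h₁] using h
    exact ⟨s / d₁, b / d₁, by simp [ha], by field_simp, by field_simp; ring⟩
  · refine ⟨a / d₀, (s - d₁ * (a / d₀)) / d₀, by field_simp, ?_, by field_simp; ring⟩
    field_simp
    linear_combination h

/-- The form `g 0 2 * z₀ + g 1 2 * z₁` divides the part in `z₀, z₁` and the coefficients of `z₂` and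
`z₃`, hence the whole quadratic form. -/
lemma stdQuad_eq_of_factor {k m₀ m₁ : ℝ} (hf : g 2 2 = 0) (ha : g 0 0 = g 0 2 * m₀)
    (hb : g 1 1 = g 1 2 * m₁) (hs : g 0 1 + g 1 0 = g 0 2 * m₁ + g 1 2 * m₀)
    (he₀ : g 2 0 = k * g 0 2) (he₁ : g 2 1 = k * g 1 2) :
    stdQuad g = Matrix.vecMulVec ![g 0 2, g 1 2, 0, 0] ![m₀, m₁, k, 1] +
      Matrix.vecMulVec ![m₀, m₁, k, 1] ![g 0 2, g 1 2, 0, 0] := by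
  ext i j
  fin_cases i <;> fin_cases j <;>
    simp [stdQuad, ha, hb, hs, he₀, he₁, hf] <;> ring

lemma two_le_rank_stdQuad (hd : ¬ (g 0 2 = 0 ∧ g 1 2 = 0)) :
    2 ≤ (stdQuad g).rank := by
  by_cases h₀ : g 0 2 = 0
  · have h₁ : g 1 2 ≠ 0 := fun h₁ => hd ⟨h₀, h₁⟩
    refine le_rank_of_minor ![1, 3] ![1, 3] ?_
    rw [Matrix.det_fin_two]
    simpa [stdQuad] using h₁
  · refine le_rank_of_minor ![0, 3] ![0, 3] ?_
    rw [Matrix.det_fin_two]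
    simpa [stdQuad] using h₀

/-- The form of the quadric if the centres lie on a line of it and the first one is not singular. -/
lemma exists_stdQuad_eq_vecMulVec (hf : g 2 2 = 0) (hm : mix g stdFund = 0) (hdet : g.det = 0)
    (hd : ¬ (g 0 2 = 0 ∧ g 1 2 = 0)) (he : ¬ (g 2 0 = 0 ∧ g 2 1 = 0)) :
    ∃ m : Fin 4 → ℝ, stdQuad g = Matrix.vecMulVec ![g 0 2, g 1 2, 0, 0] m +
      Matrix.vecMulVec m ![g 0 2, g 1 2, 0, 0] := by
  rw [CameraPair.Frame.mix_stdFund_right, hf] at hm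
  -- With `g 2 2 = 0`, the vanishing of `mix g stdFund` says that the two vectors are parallel. Then
  -- `det g` is `-k` times the value that must vanish for `exists_factor`.
  obtain ⟨k, hk₀, hk₁⟩ : ∃ k : ℝ, g 2 0 = k * g 0 2 ∧ g 2 1 = k * g 1 2 := by
    by_cases h₀ : g 0 2 = 0
    · have h₁ : g 1 2 ≠ 0 := fun h₁ => hd ⟨h₀, h₁⟩
      refine ⟨g 2 1 / g 1 2, ?_, by field_simp⟩
      rw [h₀] at hm ⊢
      simpa [h₁] using hm
    · refine ⟨g 2 0 / g 0 2, by field_simp, ?_⟩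
      field_simp
      linear_combination -hm
  have hk : k ≠ 0 := by rintro rfl; exact he ⟨by simpa using hk₀, by simpa using hk₁⟩
  rw [Matrix.det_fin_three, hf, hk₀, hk₁] at hdet
  obtain ⟨m₀, m₁, ha, hb, hs⟩ := exists_factor (a := g 0 0) (b := g 1 1) (s := g 0 1 + g 1 0) hd (by
    apply (mul_eq_zero.1 (_ : k * _ = 0)).resolve_left hk
    linear_combination -hdet)
  exact ⟨_, stdQuad_eq_of_factor hf ha hb hs hk₀ hk₁⟩

/-- The coordinate `z₂` does not occur, so the rank is at most three. It drops to two exactly when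
`g 0 2 * z₀ + g 1 2 * z₁` divides the part in `z₀, z₁`, which is also the condition for a rank one
matrix in the pencil. -/
lemma rank_stdQuad_of_left_kernel (h₀ : g 2 0 = 0) (h₁ : g 2 1 = 0) (hf : g 2 2 = 0)
    (hd : ¬ (g 0 2 = 0 ∧ g 1 2 = 0)) :
    (HasRankOne stdFund g → (stdQuad g).rank = 2) ∧
      (¬ HasRankOne stdFund g → (stdQuad g).rank = 3) := by
  have hω : g 1 1 * g 0 2 ^ 2 - (g 0 1 + g 1 0) * g 0 2 * g 1 2 + g 0 0 * g 1 2 ^ 2 = 0 ↔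
      HasRankOne stdFund g := by
    constructor
    · intro h
      obtain ⟨m₀, m₁, ha, hb, hs⟩ := exists_factor hd h
      -- With this multiple of `stdFund` added, the upper two rows of `g` become the product of the
      -- column `(g 0 2, g 1 2)` and the row `(m₀, m₁, 1)`.
      refine ⟨g 0 2 * m₁ - g 0 1, 1, by simp, ?_⟩
      rw [Matrix.adjugate_fin_three]
      ext i j
      fin_cases i <;> fin_cases j <;> simp [stdFund, h₀, h₁, hf]
      · rw [hb]; ring
      · rw [ha]; linear_combination g 0 2 * hs
      · rw [ha, hb]; linear_combination -g 0 2 * m₁ * hs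
    · rintro ⟨a, b, hab, h⟩
      have e22 := congrFun (congrFun h 2) 2
      have e02 := congrFun (congrFun h 0) 2
      have e12 := congrFun (congrFun h 1) 2
      rw [Matrix.adjugate_fin_three] at e22 e02 e12
      simp [stdFund] at e22 e02 e12
      have hb : b ≠ 0 := by
        rintro rfl
        exact hab ⟨by simpa using e22, rfl⟩
      apply (mul_eq_zero.1 (_ : b ^ 2 * _ = 0)).resolve_left (pow_ne_zero 2 hb)
      linear_combination -g 0 2 * e02 - g 1 2 * e12
  constructor
  · intro h
    obtain ⟨m₀, m₁, ha, hb, hs⟩ := exists_factor hd (hω.2 h)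
    refine le_antisymm ?_ (two_le_rank_stdQuad hd)
    rw [stdQuad_eq_of_factor (k := 0) hf ha hb hs (by simp [h₀]) (by simp [h₁])]
    exact rank_vecMulVec_add_le_two _ _ _ _
  · intro h
    rw [← hω] at h
    apply le_antisymm
    · apply Nat.le_of_lt_succ (rank_lt_of_det_eq_zero _)
      rw [det_stdQuad, CameraPair.Frame.mix_stdFund_right, hf, h₀, h₁]
      ring
    · refine le_rank_of_minor ![0, 1, 3] ![0, 1, 3] fun h' => h ?_
      rw [Matrix.det_fin_three] at h'
      simp [stdQuad] at h'
      linear_combination -(1 / 2) * h'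

/-- Transposition exchanges the roles of the two cameras, which reduces right kernels to left
kernels. -/
lemma stdQuad_transpose (g : Matrix (Fin 3) (Fin 3) ℝ) :
    stdQuad gᵀ = (stdQuad g).submatrix (Equiv.swap 2 3) (Equiv.swap 2 3) := by
  have s0 : Equiv.swap (2 : Fin 4) 3 0 = 0 := by decide
  have s1 : Equiv.swap (2 : Fin 4) 3 1 = 1 := by decide
  ext i j
  fin_cases i <;> fin_cases j <;> simp [stdQuad, s0, s1, add_comm]

lemma stdFund_transpose : stdFundᵀ = -stdFund := by
  ext i j
  fin_cases i <;> fin_cases j <;> simp [stdFund]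

lemma hasRankOne_transpose (g : Matrix (Fin 3) (Fin 3) ℝ) :
    HasRankOne stdFund gᵀ ↔ HasRankOne stdFund g := by
  have key : ∀ g : Matrix (Fin 3) (Fin 3) ℝ, HasRankOne stdFund g → HasRankOne stdFund gᵀ := by
    rintro g ⟨a, b, h0, h⟩
    refine ⟨-a, b, by simpa using h0, ?_⟩
    have e : -a • stdFund + b • gᵀ = (a • stdFund + b • g)ᵀ := by
      rw [Matrix.transpose_add, Matrix.transpose_smul, Matrix.transpose_smul, stdFund_transpose]
      simp
    rw [e, ← Matrix.adjugate_transpose, h, Matrix.transpose_zero]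
  exact ⟨fun h => by simpa using key _ h, key g⟩

lemma rank_stdQuad_of_right_kernel (h₀ : g 0 2 = 0) (h₁ : g 1 2 = 0) (hf : g 2 2 = 0)
    (he : ¬ (g 2 0 = 0 ∧ g 2 1 = 0)) :
    (HasRankOne stdFund g → (stdQuad g).rank = 2) ∧
      (¬ HasRankOne stdFund g → (stdQuad g).rank = 3) := by
  have := rank_stdQuad_of_left_kernel (g := gᵀ) h₀ h₁ hf he
  rwa [hasRankOne_transpose, stdQuad_transpose, Matrix.rank_submatrix] at this

/-- Only `z₀` and `z₁` occur. The binary form and the only nonzero adjugate entry, as a quadratic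
form on the pencil, have proportional discriminants, so a double plane means a double root of the
adjugate. -/
lemma rank_stdQuad_of_both_kernels (h₀ : g 2 0 = 0) (h₁ : g 2 1 = 0) (hf : g 2 2 = 0)
    (h₀' : g 0 2 = 0) (h₁' : g 1 2 = 0) (hne : stdQuad g ≠ 0) :
    (HasDegenerateRankOne stdFund g → (stdQuad g).rank = 1) ∧
      (¬ HasDegenerateRankOne stdFund g → (stdQuad g).rank = 2) := by
  have hΔ : 4 * (g 0 0 * g 1 1) = (g 0 1 + g 1 0) ^ 2 ↔ HasDegenerateRankOne stdFund g := by
    constructor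
    · intro h
      -- The double root is the symmetric part of `g`.
      refine ⟨(g 1 0 - g 0 1) / 2, 1, by simp, ?_, fun x y => ?_⟩
      · rw [Matrix.adjugate_fin_three]
        ext i j
        fin_cases i <;> fin_cases j <;> simp [stdFund, h₀, h₁, hf, h₀', h₁']
        linear_combination (1 / 4) * h
      · rw [Matrix.adjugate_fin_three, Matrix.adjugate_fin_three]
        ext i j
        fin_cases i <;> fin_cases j <;> simp [stdFund, h₀, h₁, hf, h₀', h₁']
        linear_combination ((1 / 4) * (2 * y + 1)) * h
    · rintro ⟨a, b, hab, h, h'⟩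
      have e := congrFun (congrFun h 2) 2
      have e' := congrFun (congrFun (h' 1 0) 2) 2
      rw [Matrix.adjugate_fin_three] at e
      rw [Matrix.adjugate_fin_three, Matrix.adjugate_fin_three] at e'
      simp [stdFund] at e e'
      have hu : a + b * g 0 1 = b * g 1 0 - a := by linear_combination e' - e
      have hb : b ≠ 0 := by
        rintro rfl
        refine hab ⟨?_, rfl⟩
        simp at hu
        linarith
      have key : b ^ 2 * (4 * (g 0 0 * g 1 1) - (g 0 1 + g 1 0) ^ 2) = 0 := by
        linear_combination 4 * e - (a + b * g 0 1 - (b * g 1 0 - a)) * hu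
      have := (mul_eq_zero.1 key).resolve_left (pow_ne_zero 2 hb)
      linarith
  constructor
  · intro h
    rw [← hΔ] at h
    apply le_antisymm
    · by_cases ha : g 0 0 = 0
      · have hs : g 0 1 + g 1 0 = 0 := by
          rw [ha] at h
          simpa using h.symm
        have : stdQuad g = Matrix.vecMulVec ![0, 2 * g 1 1, 0, 0] ![0, 1, 0, 0] := by
          ext i j
          fin_cases i <;> fin_cases j <;>
            simp [stdQuad, Matrix.vecMulVec_apply, ha, hs, h₀, h₁, hf, h₀', h₁']
        rw [this]
        exact Matrix.rank_vecMulVec_le _ _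
      · have : stdQuad g = Matrix.vecMulVec ![2 * g 0 0, g 0 1 + g 1 0, 0, 0]
            ![1, (g 0 1 + g 1 0) / (2 * g 0 0), 0, 0] := by
          ext i j
          fin_cases i <;> fin_cases j <;>
            simp [stdQuad, Matrix.vecMulVec_apply, h₀, h₁, hf, h₀', h₁'] <;> field_simp
          linear_combination h
        rw [this]
        exact Matrix.rank_vecMulVec_le _ _
    · obtain ⟨i, j, hij⟩ : ∃ i j, stdQuad g i j ≠ 0 := by
        by_contra! h
        exact hne (by ext i j; exact h i j)
      exact le_rank_of_minor ![i] ![j] (by rw [Matrix.det_unique]; exact hij)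
  · intro h
    rw [← hΔ] at h
    apply le_antisymm
    · have : stdQuad g = Matrix.vecMulVec (stdQuad g 0) ![1, 0, 0, 0] +
          Matrix.vecMulVec (stdQuad g 1) ![0, 1, 0, 0] := by
        ext i j
        fin_cases i <;> fin_cases j <;>
          simp [stdQuad, h₀, h₁, hf, h₀', h₁']
      rw [this]
      exact rank_vecMulVec_add_le_two _ _ _ _
    · refine le_rank_of_minor ![0, 1] ![0, 1] fun h' => h ?_
      rw [Matrix.det_fin_two] at h'
      simp [stdQuad] at h'
      linear_combination h'

end stdQuad

lemma exists_eq_vecMulVec_of_adjugate_eq_zero {F : Matrix (Fin 3) (Fin 3) ℝ}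
    (h : F.adjugate = 0) : ∃ u v : Fin 3 → ℝ, F = Matrix.vecMulVec u v := by
  by_cases h0 : F = 0
  · exact ⟨0, 0, by rw [h0, Matrix.zero_vecMulVec]⟩
  obtain ⟨i, j, hij⟩ : ∃ i j, F i j ≠ 0 := by
    by_contra! h
    exact h0 (by ext i j; exact h i j)
  have minor : ∀ r s c d, F r c * F s d = F r d * F s c := by
    have e : ∀ k l, F.adjugate k l = 0 := fun k l => by rw [h]; rfl
    have e00 := e 0 0
    have e01 := e 0 1
    have e02 := e 0 2
    have e10 := e 1 0
    have e11 := e 1 1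
    have e12 := e 1 2
    have e20 := e 2 0
    have e21 := e 2 1
    have e22 := e 2 2
    rw [Matrix.adjugate_fin_three] at e00 e01 e02 e10 e11 e12 e20 e21 e22
    simp at e00 e01 e02 e10 e11 e12 e20 e21 e22
    intro r s c d
    fin_cases r <;> fin_cases s <;> fin_cases c <;> fin_cases d <;> simp <;> linarith
  refine ⟨fun k => F k j, fun l => F i l / F i j, ?_⟩
  ext k l
  rw [Matrix.vecMulVec_apply]
  field_simp
  linear_combination minor k i l j

/-- The quadric of a matrix of rank at most one is a pair of planes or a double plane. -/
lemma CameraPair.rank_quadMat_le_two (P : CameraPair) {F : Matrix (Fin 3) (Fin 3) ℝ}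
    (h : F.adjugate = 0) : (P.quadMat F).rank ≤ 2 := by
  obtain ⟨u, v, rfl⟩ := exists_eq_vecMulVec_of_adjugate_eq_zero h
  rw [CameraPair.quadMat, Matrix.mul_vecMulVec, Matrix.vecMulVec_mul, Matrix.transpose_vecMulVec]
  exact rank_vecMulVec_add_le_two _ _ _ _

/-! ### The type of the critical quadric -/

/-- The second camera projects a whole real line to a right kernel vector of `F`, and the form
vanishes on that line. -/
lemma CameraPair.isRuled_of_quadMat (P : CameraPair) (S : Quadric) {F : Matrix (Fin 3) (Fin 3) ℝ}
    (hS : S.mat = P.quadMat F) (hdet : F.det = 0) : S.IsRuled := by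
  obtain ⟨r, hr, hFr⟩ := Matrix.exists_mulVec_eq_zero_iff.2 hdet
  obtain ⟨R, hR⟩ := P.snd.exists_right_inverse
  obtain ⟨q, hq0, hq⟩ := P.snd.exists_ker
  have hRr : P.snd.mat *ᵥ (R *ᵥ r) = r := by rw [Matrix.mulVec_mulVec, hR, Matrix.one_mulVec]
  have li : LinearIndependent ℝ ![q, R *ᵥ r] := by
    rw [LinearIndependent.pair_iff]
    intro s t h
    have h₁ := congrArg (P.snd.mat *ᵥ ·) h
    simp only [Matrix.mulVec_add, Matrix.mulVec_smul, hq, hRr, smul_zero, zero_add,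
      Matrix.mulVec_zero, smul_eq_zero, hr, or_false] at h₁
    subst h₁
    simpa [hq0] using h
  refine ⟨Submodule.span ℝ (Set.range ![q, R *ᵥ r]), by simpa using finrank_span_eq_card li, ?_⟩
  intro w hw
  have hw' : F *ᵥ (P.snd.mat *ᵥ w) = 0 := by
    rw [Matrix.range_cons, Matrix.range_cons, Matrix.range_empty, Set.union_empty,
      Set.singleton_union, Submodule.mem_span_pair] at hw
    obtain ⟨a, b, rfl⟩ := hw
    rw [Matrix.mulVec_add, Matrix.mulVec_smul, Matrix.mulVec_smul, hq, hRr, smul_zero, zero_add,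
      Matrix.mulVec_smul, hFr, smul_zero]
  have := P.quadMat_form F (cxv w)
  rw [cx_mulVec_cxv, cx_mulVec_cxv, cx_mulVec_cxv, cx_mulVec_cxv, hw', cxv_dotProduct_cxv,
    cxv_dotProduct_cxv, dotProduct_zero, ← hS] at this
  simpa using this

/-- Dictionary between pencil and quadric. The coefficient `mix P.fundamentalMatrix F` detects
whether the centres are on a line. Since `det F = 0`, the determinant of the quadric is, up to a
nonzero factor, the square of the other coefficient. Common right and left kernel vectors mean that
the first and second centre are singular, and members of rank one decide the remaining ranks. -/
theorem hasType_of_pencilType (P : CameraPair) (S : Quadric) {F : Matrix (Fin 3) (Fin 3) ℝ}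
    (hS : S.mat = P.quadMat F) (hdet : F.det = 0) (hadj : F.adjugate ≠ 0) {t : QuadricType}
    (h : PencilType P.fundamentalMatrix F t) : S.HasType P t := by
  obtain ⟨φ⟩ := P.nonempty_frame
  have hT : φ.pullQuad S.mat = stdQuad (φ.pull F) := by rw [hS]; exact φ.quadMat_eq F
  have h33 : φ.pullQuad S.mat 3 3 = 0 := by rw [hT]; rfl
  have h22 : φ.pullQuad S.mat 2 2 = 0 := by rw [hT]; rfl
  have h₁ := (φ.center_fst_mem_points S).2 h33
  have h₂ := (φ.center_snd_mem_points S).2 h22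
  have hrank : S.mat.rank = (stdQuad (φ.pull F)).rank := by rw [← hT, φ.rank_pullQuad]
  have hline := φ.onCommonLine_iff S h33 h22
  have hruled := P.isRuled_of_quadMat S hS hdet
  have hne : stdQuad (φ.pull F) ≠ 0 := by
    intro h0
    apply S.ne_zero
    apply φ.pullQuad_injective
    rw [hT, h0]
    simp [CameraPair.Frame.pullQuad]
  have hl := φ.mix_fundamentalMatrix_left F
  have hr := φ.mix_fundamentalMatrix_right F
  have hsing₁ : P.fst.center ∈ S.singularLocus ↔ CommonRight P.fundamentalMatrix F := by
    rw [φ.center_fst_mem_singularLocus, φ.commonRight_fundamentalMatrix, hT]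
    constructor
    · intro h
      exact ⟨h 0, h 1, h 2⟩
    · rintro ⟨a, b, c⟩ i
      fin_cases i
      · exact a
      · exact b
      · exact c
      · rfl
  have hsing₂ : P.snd.center ∈ S.singularLocus ↔ CommonLeft P.fundamentalMatrix F := by
    rw [φ.center_snd_mem_singularLocus, φ.commonLeft_fundamentalMatrix, hT]
    constructor
    · intro h
      exact ⟨h 0, h 1, h 3⟩
    · rintro ⟨a, b, c⟩ i
      fin_cases i
      · exact a
      · exact b
      · rfl
      · exact c
  have hcr := φ.commonRight_fundamentalMatrix F
  have hcl := φ.commonLeft_fundamentalMatrix F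
  have hro := φ.hasRankOne_fundamentalMatrix F
  have hdr := φ.hasDegenerateRankOne_fundamentalMatrix F
  rw [hT] at hline
  change _ ↔ φ.pull F 2 2 = 0 at hline
  replace hdet : (φ.pull F).det = 0 := by rw [φ.det_pull, hdet]; ring
  replace hadj : (φ.pull F).adjugate ≠ 0 := by rwa [Ne, φ.adjugate_pull_eq_zero]
  have hsmooth : mix F P.fundamentalMatrix ≠ 0 → S.mat.rank = 4 := by
    intro h
    rw [hrank]
    apply rank_eq_of_det_ne_zero
    rw [det_stdQuad, hdet, mul_zero, sub_zero]
    exact pow_ne_zero 2 (mt hr.2 h)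
  refine ⟨h₁, h₂, ?_⟩
  generalize φ.pull F = g at *
  have hxor : mix P.fundamentalMatrix F = 0 →
      Xor (CommonRight P.fundamentalMatrix F) (CommonLeft P.fundamentalMatrix F) →
      (HasRankOne stdFund g → (stdQuad g).rank = 2) ∧
        (¬ HasRankOne stdFund g → (stdQuad g).rank = 3) := by
    intro h0 hx
    have hf := hl.1 h0
    rw [hcr, hcl] at hx
    rcases hx with ⟨⟨a, b, -⟩, hx⟩ | ⟨⟨a, b, -⟩, hx⟩
    · exact rank_stdQuad_of_right_kernel a b hf fun h => hx ⟨h.1, h.2, hf⟩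
    · exact rank_stdQuad_of_left_kernel a b hf fun h => hx ⟨h.1, h.2, hf⟩
  have hboth : CommonRight P.fundamentalMatrix F → CommonLeft P.fundamentalMatrix F →
      (HasDegenerateRankOne stdFund g → (stdQuad g).rank = 1) ∧
        (¬ HasDegenerateRankOne stdFund g → (stdQuad g).rank = 2) := by
    intro hR hL
    obtain ⟨a, b, c⟩ := hcr.1 hR
    obtain ⟨a', b', -⟩ := hcl.1 hL
    exact rank_stdQuad_of_both_kernels a' b' c a b hne
  cases t
  case smoothNotOnLine => exact ⟨hsmooth h.2, hruled, fun h' => h.1 (hl.2 (hline.1 h'))⟩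
  case smoothOnLine => exact ⟨hsmooth h.2, hruled, hline.2 (hl.1 h.1)⟩
  case coneNotOnLine =>
    refine ⟨?_, fun h' => h.1 (hl.2 (hline.1 h'))⟩
    rw [Quadric.IsCone, hrank]
    exact rank_stdQuad_of_cone hdet hadj (mt hl.2 h.1) (hr.1 h.2)
  case coneVertex =>
    obtain ⟨hm, -, hx, ho⟩ := h
    refine ⟨?_, by rwa [hsing₁, hsing₂]⟩
    rw [Quadric.IsCone, hrank]
    exact (hxor hm hx).2 (mt hro.2 ho)
  case planesSamePlane =>
    obtain ⟨hm, hm', hR, hL⟩ := h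
    have hf := hl.1 hm
    have hd : ¬ (g 0 2 = 0 ∧ g 1 2 = 0) := fun h => hR (hcr.2 ⟨h.1, h.2, hf⟩)
    have he : ¬ (g 2 0 = 0 ∧ g 2 1 = 0) := fun h => hL (hcl.2 ⟨h.1, h.2, hf⟩)
    obtain ⟨m, e⟩ := exists_stdQuad_eq_vecMulVec hf (hr.1 hm') hdet hd he
    refine ⟨?_, ?_, mt hsing₁.1 hR, mt hsing₂.1 hL⟩
    · rw [Quadric.IsTwoPlanes, hrank]
      refine le_antisymm ?_ (two_le_rank_stdQuad hd)
      rw [e]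
      exact rank_vecMulVec_add_le_two _ _ _ _
    · refine φ.inCommonPlane_of_pullQuad S (l := ![g 0 2, g 1 2, 0, 0]) ?_ rfl rfl (hT.trans e)
      intro h0
      exact hd ⟨congrFun h0 0, congrFun h0 1⟩
  case planesOneSingular =>
    obtain ⟨hm, -, hx, ho⟩ := h
    refine ⟨?_, by rwa [hsing₁, hsing₂]⟩
    rw [Quadric.IsTwoPlanes, hrank]
    exact (hxor hm hx).1 (hro.1 ho)
  case planesBothSingular =>
    obtain ⟨-, -, hR, hL, ho⟩ := h
    refine ⟨?_, hsing₁.2 hR, hsing₂.2 hL⟩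
    rw [Quadric.IsTwoPlanes, hrank]
    exact (hboth hR hL).2 (mt hdr.2 ho)
  case doublePlane =>
    obtain ⟨-, -, hR, hL, ho⟩ := h
    change S.mat.rank = 1
    rw [hrank]
    exact (hboth hR hL).1 (hdr.1 ho)

/-- Rank and position of the centres separate the rows, except that the two cone rows are separated
because a singular centre forces the line of centres into the quadric. -/
lemma Quadric.HasType.unique {S : Quadric} {P : CameraPair} {t t' : QuadricType}
    (h : S.HasType P t) (h' : S.HasType P t') : t = t' := by
  obtain ⟨φ⟩ := P.nonempty_frame
  have h33 := (φ.center_fst_mem_points S).1 h.1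
  have h22 := (φ.center_snd_mem_points S).1 h.2.1
  have hline := φ.onCommonLine_iff S h33 h22
  have hs₁ : P.fst.center ∈ S.singularLocus → S.OnCommonLine P.fst.center P.snd.center :=
    fun hs => hline.2 ((φ.center_fst_mem_singularLocus S).1 hs 2)
  have hs₂ : P.snd.center ∈ S.singularLocus → S.OnCommonLine P.fst.center P.snd.center :=
    fun hs => hline.2 (by
      rw [← (φ.pullQuad_isSymm S.symm).apply]
      exact (φ.center_snd_mem_singularLocus S).1 hs 3)
  clear hline h22 h33
  replace h := h.2.2
  replace h' := h'.2.2
  cases t <;> cases t' <;>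
    simp only [Quadric.IsSmooth, Quadric.IsCone, Quadric.IsTwoPlanes, Quadric.IsDoublePlane,
      xor_def] at h h' <;>
    first
    | rfl
    | (exfalso; omega)
    | (exfalso; tauto)

/-! ### Fundamental matrices and equivalence of camera pairs -/

lemma CameraPair.det_fundamentalMatrix (P : CameraPair) : P.fundamentalMatrix.det = 0 := by
  obtain ⟨φ⟩ := P.nonempty_frame
  obtain ⟨c, hc, h⟩ := φ.exists_pull_fundamentalMatrix
  have := φ.det_pull P.fundamentalMatrix
  rw [h, Matrix.det_smul] at this
  have h0 : stdFund.det = 0 := by rw [Matrix.det_fin_three]; simp [stdFund]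
  rw [h0, mul_zero, eq_comm] at this
  simpa [φ.det_left, φ.det_right] using this

lemma CameraPair.adjugate_fundamentalMatrix_ne_zero (P : CameraPair) :
    P.fundamentalMatrix.adjugate ≠ 0 := by
  obtain ⟨φ⟩ := P.nonempty_frame
  obtain ⟨c, hc, h⟩ := φ.exists_pull_fundamentalMatrix
  rw [Ne, ← φ.adjugate_pull_eq_zero, h, Matrix.adjugate_smul,
    CameraPair.Frame.adjugate_stdFund]
  intro h0
  have := congrFun (congrFun h0 2) 2
  simp [hc] at this

lemma CameraPair.sameFundamental_iff_quadMat (P Q : CameraPair) :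
    P.SameFundamental Q ↔ P.quadMat Q.fundamentalMatrix = 0 := by
  rw [P.quadMat_eq_zero_iff]
  constructor
  · rintro ⟨c, -, h⟩
    exact ⟨c, h⟩
  · rintro ⟨c, h⟩
    refine ⟨c, ?_, h⟩
    rintro rfl
    exact Q.fundamentalMatrix_ne_zero (by rw [h, zero_smul])

/-- The form that the cameras of `c` attach to the fundamental matrix of `d` is, up to scale, the
pullback along `H` of the form attached by `d`, which is zero. -/
lemma Configuration.Equivalent.sameFundamental {c d : Configuration} (h : c.Equivalent d) :
    c.cameras.SameFundamental d.cameras := by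
  obtain ⟨H, -, ⟨a, ha, h₁⟩, ⟨b, hb, h₂⟩⟩ := h
  rw [CameraPair.sameFundamental_iff_quadMat]
  have hH : (↑H⁻¹ : Matrix (Fin 4) (Fin 4) ℝ) * (H : Matrix (Fin 4) (Fin 4) ℝ) = 1 := by
    rw [← Units.val_mul, inv_mul_cancel, Units.val_one]
  have e₁ : c.cameras.fst.mat = a • (d.cameras.fst.mat * (H : Matrix (Fin 4) (Fin 4) ℝ)) := by
    rw [← Matrix.smul_mul, ← h₁, Matrix.mul_assoc, hH, Matrix.mul_one]
  have e₂ : c.cameras.snd.mat = b • (d.cameras.snd.mat * (H : Matrix (Fin 4) (Fin 4) ℝ)) := by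
    rw [← Matrix.smul_mul, ← h₂, Matrix.mul_assoc, hH, Matrix.mul_one]
  have e : c.cameras.quadMat d.cameras.fundamentalMatrix = (a * b) •
      ((H : Matrix (Fin 4) (Fin 4) ℝ)ᵀ * d.cameras.quadMat d.cameras.fundamentalMatrix *
        (H : Matrix (Fin 4) (Fin 4) ℝ)) := by
    simp only [CameraPair.quadMat, e₁, e₂, Matrix.transpose_smul, Matrix.transpose_mul,
      Matrix.smul_mul, Matrix.mul_smul, Matrix.mul_add, Matrix.add_mul, Matrix.mul_assoc, smul_add,
      smul_smul, Matrix.transpose_transpose, mul_comm b a]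
  rw [e, CameraPair.quadMat_fundamentalMatrix]
  simp

lemma Camera.mulVec_eq_zero_of_center_eq (C : Camera) {v : Fin 4 → ℂ} (hv : v ≠ 0)
    (h : C.center = Projectivization.mk ℂ v hv) : cx C.mat *ᵥ v = 0 := by
  have h' := congrArg Projectivization.submodule h
  rw [Camera.center, Projectivization.submodule_mk'', Projectivization.submodule_mk] at h'
  have : v ∈ LinearMap.ker (cx C.mat).mulVecLin := by
    rw [h']; exact Submodule.mem_span_singleton_self v
  simpa using this

/-! ### Cameras realising a given matrix of rank two. -/

lemma rank_eq_three_of_vecMul {A : Matrix (Fin 3) (Fin 4) ℝ}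
    (h : ∀ w : Fin 3 → ℝ, w ᵥ* A = 0 → w = 0) : A.rank = 3 := by
  have hi : Function.Injective Aᵀ.mulVecLin := by
    rw [← LinearMap.ker_eq_bot, LinearMap.ker_eq_bot']
    intro w hw
    exact h w (by simpa [Matrix.mulVec_transpose] using hw)
  rw [← Matrix.rank_transpose, Matrix.rank, LinearMap.finrank_range_of_inj hi]
  simp

lemma stdFst_mul_transpose : stdFst * stdFstᵀ = 1 := by
  ext i j
  fin_cases i <;> fin_cases j <;> simp [stdFst, Matrix.mul_apply, Fin.sum_univ_four]

lemma stdFst_mulVec_single : stdFst *ᵥ Pi.single 3 1 = 0 := by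
  funext i; fin_cases i <;> simp [stdFst]

/-- The matrix of the cross product with `l`. -/
def crossMat (l : Fin 3 → ℝ) : Matrix (Fin 3) (Fin 3) ℝ :=
  !![0, -l 2, l 1; l 2, 0, -l 0; -l 1, l 0, 0]

lemma crossMat_transpose (l : Fin 3 → ℝ) : (crossMat l)ᵀ = -crossMat l := by
  ext i j
  fin_cases i <;> fin_cases j <;> simp [crossMat]

lemma crossMat_mulVec_self (l : Fin 3 → ℝ) : crossMat l *ᵥ l = 0 := by
  funext i
  fin_cases i <;> simp [crossMat, Matrix.mulVec, dotProduct, Fin.sum_univ_three] <;> ring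

lemma lagrange_identity (l w : Fin 3 → ℝ) :
    (w ⬝ᵥ w) * (l ⬝ᵥ l) = (w ᵥ* crossMat l) ⬝ᵥ (w ᵥ* crossMat l) + (w ⬝ᵥ l) ^ 2 := by
  simp [crossMat, Matrix.vecMul, dotProduct, Fin.sum_univ_three]
  ring

/-- Every real `3 × 3` matrix of rank two is a fundamental matrix. -/
lemma exists_cameraPair {F : Matrix (Fin 3) (Fin 3) ℝ} (hdet : F.det = 0) (hadj : F.adjugate ≠ 0) :
    ∃ Q : CameraPair, ∃ c : ℝ, c ≠ 0 ∧ Q.fundamentalMatrix = c • F := by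
  obtain ⟨l, hl, hlF⟩ := Matrix.exists_vecMul_eq_zero_iff.2 hdet
  have hker : ∀ w : Fin 3 → ℝ, w ᵥ* F = 0 → ∃ c : ℝ, c • l = w := by
    have hfr : Module.finrank ℝ (LinearMap.ker Fᵀ.mulVecLin) = 1 := by
      have h₁ := LinearMap.finrank_range_add_finrank_ker Fᵀ.mulVecLin
      have h₂ := Fᵀ.rank_transpose
      rw [Matrix.transpose_transpose, rank_eq_two_of_adjugate_ne_zero hdet hadj, Matrix.rank] at h₂
      rw [← h₂] at h₁
      simp at h₁
      omega
    have hl' : l ∈ LinearMap.ker Fᵀ.mulVecLin := by simpa [Matrix.mulVec_transpose] using hlF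
    have := (finrank_eq_one_iff_of_nonzero' (⟨l, hl'⟩ : LinearMap.ker Fᵀ.mulVecLin)
      (by simpa using hl)).1 hfr
    intro w hw
    obtain ⟨c, hc⟩ := this ⟨w, by simpa [Matrix.mulVec_transpose] using hw⟩
    exact ⟨c, congrArg Subtype.val hc⟩
  have hll : l ⬝ᵥ l ≠ 0 := by simpa using hl
  -- With `l` a left kernel vector of `F`, the cameras are `([l]ₓ F | l)` and `(I | 0)`.
  obtain ⟨A, hA⟩ : ∃ A : Matrix (Fin 3) (Fin 4) ℝ,
    A = crossMat l * F * stdFst + Matrix.vecMulVec l (Pi.single 3 1) := ⟨_, rfl⟩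
  have hA3 : A *ᵥ Pi.single 3 1 = l := by
    rw [hA, Matrix.add_mulVec, ← Matrix.mulVec_mulVec, stdFst_mulVec_single, Matrix.mulVec_zero,
      Matrix.vecMulVec_mulVec]
    simp
  have rank_A : A.rank = 3 := by
    apply rank_eq_three_of_vecMul
    intro w hw
    have h₁ : w ⬝ᵥ l = 0 := by rw [← hA3, Matrix.dotProduct_mulVec, hw, zero_dotProduct]
    have h₂ : (w ᵥ* crossMat l) ᵥ* F = 0 := by
      have := congrArg (· ᵥ* stdFstᵀ) hw
      simp only [hA, Matrix.vecMul_add, Matrix.vecMul_vecMulVec, h₁, zero_smul, add_zero,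
        Matrix.vecMul_vecMul, Matrix.mul_assoc, stdFst_mul_transpose, Matrix.mul_one,
        Matrix.zero_vecMul] at this
      rwa [Matrix.vecMul_vecMul]
    obtain ⟨c, hc⟩ := hker _ h₂
    have h₃ : (w ᵥ* crossMat l) ⬝ᵥ l = 0 := by
      rw [← Matrix.dotProduct_mulVec, crossMat_mulVec_self, dotProduct_zero]
    have hc0 : c = 0 := by
      rw [← hc, smul_dotProduct, smul_eq_mul] at h₃
      exact (mul_eq_zero.1 h₃).resolve_right hll
    -- The cross product of `w` and `l` is a multiple of `l` and orthogonal to it, hence zero; as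
    -- `w` is also orthogonal to `l`, it vanishes.
    have h₄ := lagrange_identity l w
    rw [← hc, hc0, zero_smul, zero_dotProduct, h₁] at h₄
    have h₅ : w ⬝ᵥ w = 0 := (mul_eq_zero.1 (by simpa using h₄)).resolve_right hll
    simpa using h₅
  have rank_B : stdFst.rank = 3 := by
    apply rank_eq_three_of_vecMul
    intro w hw
    have := congrArg (· ᵥ* stdFstᵀ) hw
    simpa [Matrix.vecMul_vecMul, stdFst_mul_transpose] using this
  have e3 : (Pi.single 3 1 : Fin 4 → ℝ) ≠ 0 := by simp
  obtain ⟨Q, hQ₁, hQ₂⟩ : ∃ Q : CameraPair, Q.fst.mat = A ∧ Q.snd.mat = stdFst := by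
    refine ⟨⟨⟨A, rank_A⟩, ⟨stdFst, rank_B⟩, fun h => ?_⟩, rfl, rfl⟩
    rw [Camera.center_eq ⟨stdFst, rank_B⟩ (cxv_ne_zero e3) (by
      rw [cx_mulVec_cxv, stdFst_mulVec_single]; funext i; simp [cxv])] at h
    have := Camera.mulVec_eq_zero_of_center_eq _ _ h
    rw [cx_mulVec_cxv, hA3] at this
    exact cxv_ne_zero hl this
  have hq : Q.quadMat F = 0 := by
    -- The summand with `l` disappears because `l` kills `F`; the rest is skew, so its
    -- symmetrisation is zero.
    have e : Aᵀ * F * stdFst = -(stdFstᵀ * Fᵀ * crossMat l * F * stdFst) := by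
      have hz : Matrix.vecMulVec (Pi.single 3 1 : Fin 4 → ℝ) (l ᵥ* F) = 0 := by
        rw [hlF]; ext i j; simp [Matrix.vecMulVec_apply]
      rw [hA, Matrix.transpose_add, Matrix.add_mul, Matrix.transpose_vecMulVec,
        Matrix.vecMulVec_mul, hz, add_zero, Matrix.transpose_mul,
        Matrix.transpose_mul, crossMat_transpose]
      simp [Matrix.mul_assoc]
    rw [CameraPair.quadMat, hQ₁, hQ₂, e]
    simp only [Matrix.transpose_neg, Matrix.transpose_mul, crossMat_transpose,
      Matrix.transpose_transpose, Matrix.mul_assoc, Matrix.neg_mul, Matrix.mul_neg, neg_neg]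
    exact neg_add_cancel _
  obtain ⟨c, hc⟩ := (Q.quadMat_eq_zero_iff F).1 hq
  have hc0 : c ≠ 0 := by
    rintro rfl
    apply hadj
    rw [hc, zero_smul, Matrix.adjugate_zero]
  exact ⟨Q, c⁻¹, inv_ne_zero hc0, by rw [hc, inv_smul_smul₀ hc0]⟩

/-- Automorphisms of the standard fundamental matrix come from space. -/
lemma exists_lift_of_stdFund {X Y : Matrix (Fin 3) (Fin 3) ℝ} {k : ℝ} (hk : k ≠ 0)
    (hX : X.det ≠ 0) (hY : Y.det ≠ 0) (h : Xᵀ * stdFund * Y = k • stdFund) :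
    ∃ (L : Matrix (Fin 4) (Fin 4) ℝ) (m : ℝ), L.det ≠ 0 ∧ m ≠ 0 ∧ stdFst * L = X * stdFst ∧
      stdSnd * L = m • (Y * stdSnd) := by
  have e : ∀ i j, X 0 i * Y 1 j - X 1 i * Y 0 j = k * stdFund i j := by
    intro i j
    have := congrFun (congrFun h i) j
    rw [Matrix.smul_apply, smul_eq_mul] at this
    rw [← this]
    simp [Matrix.mul_apply, Fin.sum_univ_three, stdFund]
    ring
  have e00 := e 0 0
  have e01 := e 0 1
  have e02 := e 0 2
  have e10 := e 1 0
  have e11 := e 1 1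
  have e12 := e 1 2
  have e20 := e 2 0
  have e21 := e 2 1
  simp [stdFund] at e00 e01 e02 e10 e11 e12 e20 e21
  obtain ⟨d, hd⟩ : ∃ d, d = X 0 0 * X 1 1 - X 0 1 * X 1 0 := ⟨_, rfl⟩
  obtain ⟨d', hd'⟩ : ∃ d', d' = Y 0 0 * Y 1 1 - Y 0 1 * Y 1 0 := ⟨_, rfl⟩
  -- Determinants of the upper left 2×2 blocks. Both blocks are therefore invertible, which makes
  -- `X` and `Y` block triangular with proportional upper blocks.
  have hdd : d * d' = k ^ 2 := by
    rw [hd, hd']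
    linear_combination (X 0 1 * Y 1 1 - X 1 1 * Y 0 1) * e00 - (X 0 1 * Y 1 0 - X 1 1 * Y 0 0) * e01
      - k * e10
  have hd0 : d ≠ 0 := by rintro rfl; exact pow_ne_zero 2 hk (by rw [← hdd, zero_mul])
  have hd0' : d' ≠ 0 := by rintro rfl; exact pow_ne_zero 2 hk (by rw [← hdd, mul_zero])
  have cancel : ∀ {c x : ℝ}, c ≠ 0 → c * x = 0 → x = 0 := fun hc h =>
    (mul_eq_zero.1 h).resolve_left hc
  have x02 : X 0 2 = 0 := cancel hd0' (by rw [hd']; linear_combination Y 0 0 * e21 - Y 0 1 * e20)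
  have x12 : X 1 2 = 0 := cancel hd0' (by rw [hd']; linear_combination Y 1 0 * e21 - Y 1 1 * e20)
  have y02 : Y 0 2 = 0 := cancel hd0 (by rw [hd]; linear_combination X 0 1 * e02 - X 0 0 * e12)
  have y12 : Y 1 2 = 0 := cancel hd0 (by rw [hd]; linear_combination X 1 1 * e02 - X 1 0 * e12)
  have y00 : d * Y 0 0 = k * X 0 0 := by rw [hd]; linear_combination X 0 1 * e00 - X 0 0 * e10
  have y01 : d * Y 0 1 = k * X 0 1 := by rw [hd]; linear_combination X 0 1 * e01 - X 0 0 * e11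
  have y10 : d * Y 1 0 = k * X 1 0 := by rw [hd]; linear_combination X 1 1 * e00 - X 1 0 * e10
  have y11 : d * Y 1 1 = k * X 1 1 := by rw [hd]; linear_combination X 1 1 * e01 - X 1 0 * e11
  have x22 : X 2 2 ≠ 0 := by
    intro h0
    apply hX
    rw [Matrix.det_fin_three, x02, x12, h0]
    ring
  have y22 : Y 2 2 ≠ 0 := by
    intro h0
    apply hY
    rw [Matrix.det_fin_three, y02, y12, h0]
    ring
  -- The cameras share the first two coordinates, where `X` equals `d / k` times `Y`. The third row
  -- of `X` and the rescaled third row of `Y` act on the separate coordinates.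
  refine ⟨!![X 0 0, X 0 1, 0, 0; X 1 0, X 1 1, 0, 0; X 2 0, X 2 1, X 2 2, 0;
    d / k * Y 2 0, d / k * Y 2 1, 0, d / k * Y 2 2], d / k, ?_, div_ne_zero hd0 hk, ?_, ?_⟩
  · have : (!![X 0 0, X 0 1, 0, 0; X 1 0, X 1 1, 0, 0; X 2 0, X 2 1, X 2 2, 0;
        d / k * Y 2 0, d / k * Y 2 1, 0, d / k * Y 2 2] : Matrix (Fin 4) (Fin 4) ℝ).det =
        d * X 2 2 * (d / k * Y 2 2) := by
      rw [hd, Matrix.det_succ_row_zero]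
      simp only [Fin.sum_univ_four, Matrix.det_fin_three, Matrix.submatrix_apply]
      simp [Fin.succAbove]
      ring
    rw [this]
    exact mul_ne_zero (mul_ne_zero hd0 x22) (mul_ne_zero (div_ne_zero hd0 hk) y22)
  · ext i j
    fin_cases i <;> fin_cases j <;>
      simp [Matrix.mul_apply, Fin.sum_univ_succ, stdFst, x02, x12]
  · ext i j
    fin_cases i <;> fin_cases j <;>
      simp [Matrix.mul_apply, Fin.sum_univ_succ, stdSnd, y02, y12] <;> field_simp <;> linarith

/-- Camera pairs with the same fundamental matrix are projectively equivalent. -/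
lemma CameraPair.SameFundamental.exists_projective {Q R : CameraPair} (h : Q.SameFundamental R) :
    ∃ (H : GL (Fin 4) ℝ) (a b : ℝ), a ≠ 0 ∧ b ≠ 0 ∧
      R.fst.mat * (H : Matrix (Fin 4) (Fin 4) ℝ) = a • Q.fst.mat ∧
      R.snd.mat * (H : Matrix (Fin 4) (Fin 4) ℝ) = b • Q.snd.mat := by
  obtain ⟨c, hc, h⟩ := h
  obtain ⟨φ⟩ := Q.nonempty_frame
  obtain ⟨ψ⟩ := R.nonempty_frame
  obtain ⟨p, hp, hφ⟩ := φ.exists_pull_fundamentalMatrix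
  obtain ⟨q, hq, hψ⟩ := ψ.exists_pull_fundamentalMatrix
  have ul : IsUnit ψ.left.det := isUnit_iff_ne_zero.2 ψ.det_left
  have ur : IsUnit ψ.right.det := isUnit_iff_ne_zero.2 ψ.det_right
  obtain ⟨X, hX⟩ : ∃ X, X = ψ.left⁻¹ * φ.left := ⟨_, rfl⟩
  obtain ⟨Y, hY⟩ : ∃ Y, Y = ψ.right⁻¹ * φ.right := ⟨_, rfl⟩
  have hX' : ψ.left * X = φ.left := by rw [hX, Matrix.mul_nonsing_inv_cancel_left _ _ ul]
  have hY' : ψ.right * Y = φ.right := by rw [hY, Matrix.mul_nonsing_inv_cancel_left _ _ ur]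
  have dX : X.det ≠ 0 := by
    intro h0
    apply φ.det_left
    rw [← hX', Matrix.det_mul, h0, mul_zero]
  have dY : Y.det ≠ 0 := by
    intro h0
    apply φ.det_right
    rw [← hY', Matrix.det_mul, h0, mul_zero]
  -- The changes of image coordinates between the two frames preserve `stdFund` up to scale, so they
  -- lift to space.
  have key : Xᵀ * stdFund * Y = (q⁻¹ * (c * p)) • stdFund := by
    have e : Xᵀ * ψ.pull R.fundamentalMatrix * Y = c • φ.pull Q.fundamentalMatrix := by
      rw [h, ψ.pull_smul, CameraPair.Frame.pull, CameraPair.Frame.pull, ← hX', ← hY']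
      simp [Matrix.mul_assoc]
    rw [hψ, hφ, Matrix.mul_smul, Matrix.smul_mul, smul_smul] at e
    rw [mul_smul, ← e, inv_smul_smul₀ hq]
  obtain ⟨L, m, hL, hm, h₁, h₂⟩ := exists_lift_of_stdFund
    (mul_ne_zero (inv_ne_zero hq) (mul_ne_zero hc hp)) dX dY key
  have us : IsUnit φ.space.det := φ.isUnit_det_space
  have hH : (ψ.space * L * φ.space⁻¹).det ≠ 0 := by
    rw [Matrix.det_mul, Matrix.det_mul, Matrix.det_nonsing_inv]
    exact mul_ne_zero (mul_ne_zero ψ.det_space hL) us.ringInverse.ne_zero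
  refine ⟨Matrix.GeneralLinearGroup.mkOfDetNeZero _ hH, 1, m, one_ne_zero, hm, ?_, ?_⟩
  · change R.fst.mat * (ψ.space * L * φ.space⁻¹) = _
    rw [← Matrix.mul_assoc, ← Matrix.mul_assoc, ψ.fst_mul, Matrix.mul_assoc ψ.left, h₁,
      ← Matrix.mul_assoc, hX', ← φ.fst_mul, Matrix.mul_nonsing_inv_cancel_right _ _ us, one_smul]
  · change R.snd.mat * (ψ.space * L * φ.space⁻¹) = _
    rw [← Matrix.mul_assoc, ← Matrix.mul_assoc, ψ.snd_mul, Matrix.mul_assoc ψ.right, h₂,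
      Matrix.mul_smul, ← Matrix.mul_assoc, hY', ← φ.snd_mul, Matrix.smul_mul,
      Matrix.mul_nonsing_inv_cancel_right _ _ us]

/-! ### Critical quadrics and conjugates -/

lemma CameraPair.SameFundamental.symm {P Q : CameraPair} (h : P.SameFundamental Q) :
    Q.SameFundamental P := by
  obtain ⟨c, hc, h⟩ := h
  exact ⟨c⁻¹, inv_ne_zero hc, by rw [h, inv_smul_smul₀ hc]⟩

/-- The quadric of critical points of `P` with respect to `Q`. -/
def criticalQuadric (P Q : CameraPair) (h : ¬ P.SameFundamental Q) : Quadric where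
  mat := P.quadMat Q.fundamentalMatrix
  symm := P.quadMat_isSymm _
  ne_zero := mt (P.sameFundamental_iff_quadMat Q).2 h

lemma points_criticalQuadric (P Q : CameraPair) (h : ¬ P.SameFundamental Q) :
    (criticalQuadric P Q h).points = criticalPoints P Q := by
  ext x
  exact (P.mem_criticalPoints_iff_quadMat Q x).symm

lemma hasType_criticalQuadric (P Q : CameraPair) (h : ¬ P.SameFundamental Q) {t : QuadricType}
    (ht : PencilType P.fundamentalMatrix Q.fundamentalMatrix t) :
    (criticalQuadric P Q h).HasType P t :=
  hasType_of_pencilType P _ rfl Q.det_fundamentalMatrix Q.adjugate_fundamentalMatrix_ne_zero ht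

lemma Quadric.HasType.of_smul {S S' : Quadric} {P : CameraPair} {t : QuadricType} {r : ℝ}
    (hr : r ≠ 0) (h : S'.mat = r • S.mat) (hS : S.HasType P t) : S'.HasType P t := by
  have hp := Quadric.points_eq_of_smul hr h
  have hs : S'.singularLocus = S.singularLocus := by
    ext x
    simp only [Quadric.singularLocus, Set.mem_ofPred_eq, h, cx_smul, Matrix.smul_mulVec,
      smul_eq_zero, Complex.ofReal_eq_zero, hr, false_or]
  have hrk : S'.mat.rank = S.mat.rank := by 
    rw [h, Matrix.rank_smul_of_mem_nonZeroDivisors _ (mem_nonZeroDivisors_of_ne_zero hr)]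
  have hru : S.IsRuled → S'.IsRuled := by
    rintro ⟨W, hW, h'⟩
    refine ⟨W, hW, fun w hw => ?_⟩
    rw [h, Matrix.smul_mulVec, dotProduct_smul, h' w hw, smul_zero]
  cases t <;>
    simp only [Quadric.HasType, Quadric.IsSmooth, Quadric.IsCone, Quadric.IsTwoPlanes,
      Quadric.IsDoublePlane, Quadric.OnCommonLine, Quadric.InCommonPlane, hp, hs, hrk] at hS ⊢ <;>
    tauto

lemma Quadric.conjugates_smul {S : Quadric} {P : CameraPair} {d : Configuration}
    (hd : d ∈ S.conjugates P) :
    ∃ r : ℝ, r ≠ 0 ∧ P.quadMat d.cameras.fundamentalMatrix = r • S.mat := by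
  obtain ⟨h₁, h₂, -⟩ := hd
  rw [← points_criticalQuadric P d.cameras h₁] at h₂
  exact S.exists_smul_of_points_eq _ h₂

/-- One pencil governs both quadrics: by uniqueness of types its type is that of `S`, and after the
swap it is that of the conjugate. -/
lemma Quadric.conjugate_hasType {S : Quadric} {P : CameraPair} {t : QuadricType}
    (hS : S.HasType P t) {d : Configuration} (hd : d ∈ S.conjugates P) :
    ∃ S' : Quadric, d.points = S'.points ∧ S'.HasType d.cameras t.conjugate := by
  obtain ⟨r, hr, hrS⟩ := Quadric.conjugates_smul hd
  obtain ⟨h₁, -, h₃⟩ := hd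
  obtain ⟨t', ht'⟩ := exists_pencilType P.fundamentalMatrix d.cameras.fundamentalMatrix
  have hc := hasType_criticalQuadric P d.cameras h₁ ht'
  have hc' : (criticalQuadric P d.cameras h₁).HasType P t := hS.of_smul hr hrS
  obtain rfl := hc.unique hc'
  refine ⟨criticalQuadric d.cameras P (fun h => h₁ h.symm), ?_, hasType_criticalQuadric _ _ _ ht'.swap⟩
  rw [points_criticalQuadric, h₃]

/-- Both configurations reconstruct the set of all image pairs seen by both camera pairs. -/
lemma Quadric.nontrivialConjugate {S : Quadric} {P : CameraPair} {d : Configuration}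
    (hd : d ∈ S.conjugates P) : (Configuration.mk P S.points).NontrivialConjugate d := by
  obtain ⟨h₁, h₂, h₃⟩ := hd
  refine ⟨⟨⟨{s | (∃ x, P.Sees x s) ∧ ∃ y, d.cameras.Sees y s}, ⟨?_, ?_⟩, ?_, ?_⟩,
    fun h => h₁ h.sameFundamental⟩, h₁⟩
  · intro x hx
    change x ∈ S.points at hx
    rw [h₂] at hx
    obtain ⟨y, s, hx, hy⟩ := hx
    exact ⟨s, ⟨⟨x, hx⟩, ⟨y, hy⟩⟩, hx⟩
  · rintro s ⟨⟨x, hx⟩, ⟨y, hy⟩⟩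
    refine ⟨x, ?_, hx⟩
    change x ∈ S.points
    rw [h₂]
    exact ⟨y, s, hx, hy⟩
  · intro y hy
    rw [h₃] at hy
    obtain ⟨x, s, hy, hx⟩ := hy
    exact ⟨s, ⟨⟨x, hx⟩, ⟨y, hy⟩⟩, hy⟩
  · rintro s ⟨⟨x, hx⟩, ⟨y, hy⟩⟩
    refine ⟨y, ?_, hy⟩
    rw [h₃]
    exact ⟨x, s, hy, hx⟩

lemma Quadric.HasType.two_le_rank {S : Quadric} {P : CameraPair} {t : QuadricType}
    (hS : S.HasType P t) (ht : t ≠ .doublePlane) : 2 ≤ S.mat.rank := by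
  replace hS := hS.2.2
  cases t <;>
    simp only [Quadric.IsSmooth, Quadric.IsCone, Quadric.IsTwoPlanes, ne_eq, not_true_eq_false]
      at hS ht <;> omega

lemma Configuration.NontrivialConjugate.subset_criticalPoints {P : CameraPair} {X : Set Space}
    {d : Configuration} (h : (Configuration.mk P X).NontrivialConjugate d) :
    X ⊆ criticalPoints P d.cameras ∧ d.points ⊆ criticalPoints d.cameras P := by
  obtain ⟨⟨⟨T, ⟨h₁, h₂⟩, h₃, h₄⟩, -⟩, -⟩ := h
  constructor
  · intro x hx
    obtain ⟨s, hs, hxs⟩ := h₁ x hx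
    obtain ⟨y, -, hy⟩ := h₄ s hs
    exact ⟨y, s, hxs, hy⟩
  · intro y hy
    obtain ⟨s, hs, hys⟩ := h₃ y hy
    obtain ⟨x, -, hx⟩ := h₂ s hs
    exact ⟨x, s, hys, hx⟩

/-- Being a reconstruction only yields that `S` lies in the quadric of critical points. The rank
condition forces equality; a double plane could be one half of a pair of planes. -/
lemma Quadric.exists_conjugate_of_nontrivialConjugate {S : Quadric} {P : CameraPair}
    (hS : 2 ≤ S.mat.rank) {d : Configuration}
    (hd : (Configuration.mk P S.points).NontrivialConjugate d) :
    ∃ e ∈ S.conjugates P, e.cameras = d.cameras ∧ d.points ⊆ e.points := by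
  have hne : ¬ P.SameFundamental d.cameras := hd.2
  obtain ⟨h₁, h₂⟩ := hd.subset_criticalPoints
  rw [← points_criticalQuadric P d.cameras hne] at h₁
  obtain ⟨r, hr, h⟩ := S.exists_smul_of_subset _ hS h₁
  refine ⟨⟨d.cameras, criticalPoints d.cameras P⟩, ⟨hne, ?_, rfl⟩, rfl, h₂⟩
  rw [← points_criticalQuadric P d.cameras hne, Quadric.points_eq_of_smul hr h]

/-! ### Counting conjugates -/

lemma sees_projAct {C D : Camera} {H : GL (Fin 4) ℝ} {a : ℝ} (ha : a ≠ 0)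
    (h : D.mat * (H : Matrix (Fin 4) (Fin 4) ℝ) = a • C.mat) (x : Space) (u : Image) :
    D.Sees (projAct H x) u ↔ C.Sees x u := by
  induction x using Projectivization.ind with
  | h v hv =>
    have ha' : (a : ℂ) ≠ 0 := by exact_mod_cast ha
    rw [projAct, Projectivization.map_mk, Camera.sees_mk_iff, Camera.sees_mk_iff,
      Matrix.mulVecLin_apply, Matrix.mulVec_mulVec, ← cx_mul, h, cx_smul, Matrix.smul_mulVec]
    constructor
    · rintro ⟨b, hb⟩
      exact ⟨(a : ℂ)⁻¹ * b, by rw [mul_smul, ← hb, inv_smul_smul₀ ha']⟩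
    · rintro ⟨b, hb⟩
      exact ⟨a * b, by rw [hb, mul_smul]⟩

/-- The projective transformation relating the cameras preserves images, and critical points are
defined by images alone. -/
lemma CameraPair.SameFundamental.equivalent {Q R : CameraPair} (h : Q.SameFundamental R)
    (P : CameraPair) : (Configuration.mk Q (criticalPoints Q P)).Equivalent
      (Configuration.mk R (criticalPoints R P)) := by
  obtain ⟨H, a, b, ha, hb, h₁, h₂⟩ := h.exists_projective
  have hs : ∀ x s, R.Sees (projAct H x) s ↔ Q.Sees x s := fun x s =>
    and_congr (sees_projAct ha h₁ x s.1) (sees_projAct hb h₂ x s.2)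
  have hH : (H : Matrix (Fin 4) (Fin 4) ℝ) * (↑H⁻¹ : Matrix (Fin 4) (Fin 4) ℝ) = 1 := by
    rw [← Units.val_mul, mul_inv_cancel, Units.val_one]
  have scale : ∀ {A B : Matrix (Fin 3) (Fin 4) ℝ} {c : ℝ}, c ≠ 0 →
      B * (H : Matrix (Fin 4) (Fin 4) ℝ) = c • A →
      A * (↑H⁻¹ : Matrix (Fin 4) (Fin 4) ℝ) = c⁻¹ • B := by
    intro A B c hc h
    have : A = c⁻¹ • (B * (H : Matrix (Fin 4) (Fin 4) ℝ)) := by rw [h, inv_smul_smul₀ hc]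
    rw [this, Matrix.smul_mul, Matrix.mul_assoc, hH, Matrix.mul_one]
  refine ⟨H, ?_, ⟨a⁻¹, inv_ne_zero ha, scale ha h₁⟩, ⟨b⁻¹, inv_ne_zero hb, scale hb h₂⟩⟩
  ext x
  constructor
  · rintro ⟨z, ⟨y, s, hz, hy⟩, rfl⟩
    exact ⟨y, s, (hs z s).2 hz, hy⟩
  · rintro ⟨y, s, hx, hy⟩
    have e : projAct H (projAct H⁻¹ x) = x := by
      rw [← Function.comp_apply (f := projAct H), ← projAct_mul, mul_inv_cancel, projAct_one, id]
    exact ⟨projAct H⁻¹ x, ⟨y, s, (hs _ s).1 (by rwa [e]), hy⟩, e⟩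

/-- The parameters of the matrices of rank two in the pencil spanned by `g` and `stdFund`. -/
def rankTwoSet (g : Matrix (Fin 3) (Fin 3) ℝ) : Set ℝ :=
  {x | (g + x • stdFund).det = 0 ∧ (g + x • stdFund).adjugate ≠ 0}

/-- Each admissible `x` gives a camera pair with fundamental matrix proportional to `F` plus a
multiple of that of `P`. Every conjugate arises this way up to equivalence, from exactly one `x`. -/
lemma conjugateCount_eq {P : CameraPair} (φ : P.Frame) (S : Quadric)
    {F : Matrix (Fin 3) (Fin 3) ℝ} (hS : S.mat = P.quadMat F) :
    S.conjugateCount P = (rankTwoSet (φ.pull F)).encard := by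
  obtain ⟨c, hc, hφ⟩ := φ.exists_pull_fundamentalMatrix
  have hpull : ∀ x : ℝ, φ.pull (F + (x * c⁻¹) • P.fundamentalMatrix) = φ.pull F + x • stdFund := by
    intro x
    rw [φ.pull_add, φ.pull_smul, hφ, smul_smul, inv_mul_cancel_right₀ hc]
  have hmem : ∀ x, x ∈ rankTwoSet (φ.pull F) ↔
      (F + (x * c⁻¹) • P.fundamentalMatrix).det = 0 ∧
        (F + (x * c⁻¹) • P.fundamentalMatrix).adjugate ≠ 0 := by
    intro x
    rw [rankTwoSet, Set.mem_ofPred_eq, ← hpull, φ.det_pull, Ne, φ.adjugate_pull_eq_zero]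
    simp [φ.det_left, φ.det_right]
  have : Nonempty CameraPair := ⟨P⟩
  choose! Q k hk hQ using fun x (hx : x ∈ rankTwoSet (φ.pull F)) =>
    exists_cameraPair ((hmem x).1 hx).1 ((hmem x).1 hx).2
  have hquad : ∀ x ∈ rankTwoSet (φ.pull F), P.quadMat (Q x).fundamentalMatrix = k x • S.mat := by
    intro x hx
    rw [hQ x hx, P.quadMat_smul, P.quadMat_add, P.quadMat_smul, P.quadMat_fundamentalMatrix,
      smul_zero, add_zero, hS]
  have himage : Quotient.mk configurationSetoid '' S.conjugates P =
      (fun x => Quotient.mk configurationSetoid ⟨Q x, criticalPoints (Q x) P⟩) ''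
        rankTwoSet (φ.pull F) := by
    ext e
    constructor
    · rintro ⟨d, hd, rfl⟩
      obtain ⟨r, hr, hrS⟩ := Quadric.conjugates_smul hd
      -- The conjugate and `r • F` define the same quadric, so they differ by a multiple of the
      -- fundamental matrix of `P`.
      obtain ⟨a, ha⟩ := (P.quadMat_eq_zero_iff (d.cameras.fundamentalMatrix + (-r) • F)).1 (by
        rw [P.quadMat_add, P.quadMat_smul, hrS, hS, neg_smul, add_neg_cancel])
      have hF : d.cameras.fundamentalMatrix =
          r • (F + (r⁻¹ * a * c * c⁻¹) • P.fundamentalMatrix) := by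
        rw [mul_inv_cancel_right₀ hc, smul_add, smul_smul, mul_inv_cancel_left₀ hr, ← ha, neg_smul]
        abel
      have hx : r⁻¹ * a * c ∈ rankTwoSet (φ.pull F) := by
        have h₁ := d.cameras.det_fundamentalMatrix
        have h₂ := d.cameras.adjugate_fundamentalMatrix_ne_zero
        rw [hF] at h₁ h₂
        rw [Matrix.det_smul] at h₁
        rw [Matrix.adjugate_smul] at h₂
        exact (hmem _).2 ⟨(mul_eq_zero.1 h₁).resolve_left (pow_ne_zero _ hr), right_ne_zero_of_smul h₂⟩
      refine ⟨_, hx, Quotient.sound ?_⟩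
      have hsame : (Q (r⁻¹ * a * c)).SameFundamental d.cameras :=
        ⟨r * (k (r⁻¹ * a * c))⁻¹, mul_ne_zero hr (inv_ne_zero (hk _ hx)), by
          rw [hQ _ hx, mul_smul, inv_smul_smul₀ (hk _ hx), ← hF]⟩
      have := hsame.equivalent P
      rw [← hd.2.2] at this
      exact this
    · rintro ⟨x, hx, rfl⟩
      refine ⟨_, ⟨?_, ?_, rfl⟩, rfl⟩
      · rw [P.sameFundamental_iff_quadMat, hquad x hx]
        exact smul_ne_zero (hk x hx) S.ne_zero
      · have hne : ¬ P.SameFundamental (Q x) := by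
          rw [P.sameFundamental_iff_quadMat, hquad x hx]
          exact smul_ne_zero (hk x hx) S.ne_zero
        rw [← points_criticalQuadric P (Q x) hne]
        exact (Quadric.points_eq_of_smul (hk x hx) (hquad x hx)).symm
  have hinj : Set.InjOn (fun x => Quotient.mk configurationSetoid ⟨Q x, criticalPoints (Q x) P⟩)
      (rankTwoSet (φ.pull F)) := by
    intro x hx y hy hxy
    have heq : (Configuration.mk (Q x) (criticalPoints (Q x) P)).Equivalent
        (Configuration.mk (Q y) (criticalPoints (Q y) P)) := Quotient.exact hxy
    obtain ⟨a, ha, h⟩ : (Q x).SameFundamental (Q y) := heq.sameFundamental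
    rw [hQ x hx, hQ y hy] at h
    have h' := congrArg P.quadMat h
    simp only [P.quadMat_smul, P.quadMat_add, P.quadMat_fundamentalMatrix, smul_zero, add_zero,
      ← hS, smul_smul] at h'
    -- Comparing quadrics removes the multiple of the fundamental matrix of `P` and fixes the scale;
    -- comparing the matrices then gives `x = y`.
    have hk' : k y = a * k x := smul_left_injective ℝ S.ne_zero h'
    rw [smul_smul, ← hk'] at h
    have h₂ := smul_right_injective _ (hk y hy) h
    have h₃ := smul_left_injective ℝ P.fundamentalMatrix_ne_zero (add_left_cancel h₂)
    exact (mul_right_cancel₀ (inv_ne_zero hc) h₃).symm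
  rw [Quadric.conjugateCount, himage, hinj.encard_image]

/-- All matrices `g + x • stdFund` are singular, and one entry of the adjugate is the monic
polynomial `x² + u x + v`, which has no root beyond `1 + |u| + |v|`. -/
lemma infinite_rankTwoSet {g : Matrix (Fin 3) (Fin 3) ℝ} (h₁ : g 2 2 = 0) (h₂ : mix g stdFund = 0)
    (h₃ : g.det = 0) : (rankTwoSet g).Infinite := by
  set u := g 0 1 - g 1 0 with hu
  set v := g 0 0 * g 1 1 - g 0 1 * g 1 0 with hv
  refine (Set.Ioi_infinite (1 + |u| + |v|)).mono fun x hx => ⟨?_, fun h => ?_⟩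
  · rw [det_add_smul_stdFund, h₁, h₂, h₃]; ring
  · have e := congrFun (congrFun h 2) 2
    rw [Matrix.adjugate_fin_three] at e
    simp [stdFund] at e
    have e' : x * x + u * x + v = 0 := by rw [hu, hv]; linear_combination e
    have hx' : 1 + |u| + |v| < x := hx
    have hu' := neg_abs_le u
    have hv' := neg_abs_le v
    have := abs_nonneg u
    have := abs_nonneg v
    nlinarith [mul_nonneg (by linarith : 0 ≤ u + |u|) (by linarith : 0 ≤ x),
      mul_pos (by linarith : 0 < x - (1 + |u| + |v|)) (by linarith : 0 < x),
      mul_nonneg (abs_nonneg v) (by linarith : 0 ≤ x - 1)]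

/-- Under `h₁` and `h₂` a suitable 3×3 minor of the quadric equals `2 * det g`. -/
lemma det_eq_zero_of_rank_stdQuad_le_two {g : Matrix (Fin 3) (Fin 3) ℝ} (h₁ : g 2 2 = 0)
    (h₂ : mix g stdFund = 0) (h : (stdQuad g).rank ≤ 2) : g.det = 0 := by
  by_contra h0
  have : 3 ≤ (stdQuad g).rank := by
    refine le_rank_of_minor ![0, 1, 2] ![0, 1, 3] fun h' => h0 ?_
    rw [CameraPair.Frame.mix_stdFund_right, h₁] at h₂
    rw [Matrix.det_fin_three] at h' ⊢
    simp [stdQuad, h₁] at h'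
    rw [h₁]
    linear_combination (1 / 2) * h' + (1 / 2) * (g 0 1 - g 1 0) * h₂
  omega

lemma encard_rankTwoSet {P : CameraPair} (φ : P.Frame) {S : Quadric}
    {F : Matrix (Fin 3) (Fin 3) ℝ} (hS : S.mat = P.quadMat F) {t : QuadricType}
    (ht : S.HasType P t) : (rankTwoSet (φ.pull F)).encard = t.numConjugates := by
  have hT : φ.pullQuad S.mat = stdQuad (φ.pull F) := by rw [hS]; exact φ.quadMat_eq F
  have h33 : φ.pullQuad S.mat 3 3 = 0 := by rw [hT]; rfl
  have h22 : φ.pullQuad S.mat 2 2 = 0 := by rw [hT]; rfl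
  have hrank : (stdQuad (φ.pull F)).rank = S.mat.rank := by rw [← hT, φ.rank_pullQuad]
  have hline := φ.onCommonLine_iff S h33 h22
  have hs₁ := φ.center_fst_mem_singularLocus S
  have hs₂ := φ.center_snd_mem_singularLocus S
  have hdetS : (stdQuad (φ.pull F)).det = φ.space.det ^ 2 * S.mat.det := by
    rw [← hT, CameraPair.Frame.pullQuad, Matrix.det_mul, Matrix.det_mul, Matrix.det_transpose]
    ring
  -- A matrix of rank at most one gives a quadric of rank at most two, so for smooth quadrics and
  -- cones every root of the determinant counts.
  have hadj : 3 ≤ S.mat.rank → ∀ x : ℝ, (φ.pull F + x • stdFund).adjugate ≠ 0 := by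
    intro h3 x h0
    obtain ⟨c, hc, hφ⟩ := φ.exists_pull_fundamentalMatrix
    have e : φ.pull F + x • stdFund = φ.pull (F + (x * c⁻¹) • P.fundamentalMatrix) := by
      rw [φ.pull_add, φ.pull_smul, hφ, smul_smul, inv_mul_cancel_right₀ hc]
    rw [e, φ.adjugate_pull_eq_zero] at h0
    have := P.rank_quadMat_le_two h0
    rw [P.quadMat_add, P.quadMat_smul, P.quadMat_fundamentalMatrix, smul_zero, add_zero,
      ← hS] at this
    omega
  rw [hT] at hline hs₁ hs₂
  change _ ↔ φ.pull F 2 2 = 0 at hline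
  replace ht := ht.2.2
  generalize φ.pull F = g at *
  have hset : 3 ≤ S.mat.rank →
      rankTwoSet g = {x | g 2 2 * x ^ 2 + mix g stdFund * x + g.det = 0} := by
    intro h3
    ext x
    simp only [rankTwoSet, Set.mem_ofPred_eq, det_add_smul_stdFund, and_iff_left_iff_imp]
    exact fun _ => hadj h3 x
  have hdet := det_stdQuad g
  have hmix : S.mat.rank < 4 → g 2 2 = 0 → mix g stdFund = 0 := by
    intro h4 h0
    rw [h0] at hdet
    have : (stdQuad g).det = 0 := by
      by_contra hne
      have := rank_eq_of_det_ne_zero hne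
      omega
    rw [this] at hdet
    have : mix g stdFund ^ 2 = 0 := by linarith
    simpa using this
  have hinf : (rankTwoSet g).Infinite → (rankTwoSet g).encard = ⊤ := Set.encard_eq_top_iff.2
  have htwo : S.mat.rank ≤ 2 → g 2 2 = 0 → (rankTwoSet g).encard = ⊤ := by
    intro h2 h0
    have hm := hmix (by omega) h0
    exact hinf (infinite_rankTwoSet h0 hm (det_eq_zero_of_rank_stdQuad_le_two h0 hm (by omega)))
  have hon₁ : P.fst.center ∈ S.singularLocus → g 2 2 = 0 := fun h => hs₁.1 h 2
  have hon₂ : P.snd.center ∈ S.singularLocus → g 2 2 = 0 := fun h => hs₂.1 h 3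
  cases t
  case smoothNotOnLine =>
    obtain ⟨hr, ⟨W, hW, hiso⟩, hl⟩ := ht
    have hf : g 2 2 ≠ 0 := mt hline.2 hl
    have hr' : S.mat.rank = 4 := hr
    rw [hset (by omega)]
    -- The real line on the quadric makes the discriminant nonnegative and smoothness makes it
    -- nonzero, so there are two distinct real roots.
    have hpos : 0 < (stdQuad g).det := by
      apply lt_of_le_of_ne
      · rw [hdetS]
        exact mul_nonneg (sq_nonneg _) (det_nonneg_of_isotropic S.symm hW hiso)
      · intro h0
        have := rank_lt_of_det_eq_zero h0.symm
        omega
    rw [hdet] at hpos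
    obtain ⟨s, hs, hs'⟩ : ∃ s : ℝ, 0 < s ∧ s * s = mix g stdFund ^ 2 - 4 * g 2 2 * g.det :=
      ⟨_, Real.sqrt_pos.2 hpos, Real.mul_self_sqrt hpos.le⟩
    have : {x | g 2 2 * x ^ 2 + mix g stdFund * x + g.det = 0} =
        {(-mix g stdFund + s) / (2 * g 2 2), (-mix g stdFund - s) / (2 * g 2 2)} := by
      ext x
      rw [Set.mem_ofPred_eq, Set.mem_insert_iff, Set.mem_singleton_iff, sq,
        quadratic_eq_zero_iff hf (s := s) (by rw [discrim, hs'])]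
    rw [this, Set.encard_pair]
    · rfl
    · intro h
      field_simp at h
      linarith
  case smoothOnLine =>
    obtain ⟨hr, -, hl⟩ := ht
    have hf : g 2 2 = 0 := hline.1 hl
    have hr' : S.mat.rank = 4 := hr
    rw [hset (by omega)]
    have hm : mix g stdFund ≠ 0 := by
      intro h0
      rw [hf, h0] at hdet
      have := rank_lt_of_det_eq_zero (hdet.trans (by ring))
      omega
    have : {x | g 2 2 * x ^ 2 + mix g stdFund * x + g.det = 0} = {-g.det / mix g stdFund} := by
      ext x
      rw [Set.mem_ofPred_eq, Set.mem_singleton_iff, hf, eq_div_iff hm]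
      constructor <;> intro h <;> linarith
    rw [this, Set.encard_singleton]
    rfl
  case coneNotOnLine =>
    obtain ⟨hr, hl⟩ := ht
    have hf : g 2 2 ≠ 0 := mt hline.2 hl
    have hr' : S.mat.rank = 3 := hr
    rw [hset (by omega)]
    have h0 : (stdQuad g).det = 0 := by
      by_contra hne
      have := rank_eq_of_det_ne_zero hne
      omega
    have : {x | g 2 2 * x ^ 2 + mix g stdFund * x + g.det = 0} =
        {-mix g stdFund / (2 * g 2 2)} := by
      ext x
      rw [Set.mem_ofPred_eq, Set.mem_singleton_iff, sq,
        quadratic_eq_zero_iff_of_discrim_eq_zero hf (by rw [discrim, ← hdet, h0])]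
    rw [this, Set.encard_singleton]
    rfl
  case coneVertex =>
    obtain ⟨hr, hx⟩ := ht
    have hr' : S.mat.rank = 3 := hr
    have hf : g 2 2 = 0 := by
      rcases hx with ⟨h, -⟩ | ⟨h, -⟩
      · exact hon₁ h
      · exact hon₂ h
    refine hinf (infinite_rankTwoSet hf (hmix (by omega) hf) ?_)
    rcases hx with ⟨h, -⟩ | ⟨h, -⟩
    · have h0 : g 0 2 = 0 := hs₁.1 h 0
      have h1 : g 1 2 = 0 := hs₁.1 h 1
      rw [Matrix.det_fin_three, h0, h1, hf]; ring
    · have h0 : g 2 0 = 0 := hs₂.1 h 0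
      have h1 : g 2 1 = 0 := hs₂.1 h 1
      rw [Matrix.det_fin_three, h0, h1, hf]; ring
  case planesSamePlane =>
    obtain ⟨hr, hp, -⟩ := ht
    exact htwo (le_of_eq hr)
      (hline.1 (CameraPair.Frame.onCommonLine_of_inCommonPlane S _ _ hp))
  case planesOneSingular =>
    obtain ⟨hr, hx⟩ := ht
    refine htwo (le_of_eq hr) ?_
    rcases hx with ⟨h, -⟩ | ⟨h, -⟩
    · exact hon₁ h
    · exact hon₂ h
  case planesBothSingular => exact htwo (le_of_eq ht.1) (hon₁ ht.2.1)
  case doublePlane =>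
    have hr : S.mat.rank = 1 := ht
    refine htwo (by omega) ?_
    by_contra hf
    have : 2 ≤ (stdQuad g).rank := by
      refine le_rank_of_minor ![2, 3] ![2, 3] ?_
      rw [Matrix.det_fin_two]
      simpa [stdQuad] using hf
    omega

theorem Quadric.HasType.conjugateCount_eq {S : Quadric} {P : CameraPair} {t : QuadricType}
    (hS : S.HasType P t) : S.conjugateCount P = t.numConjugates := by
  obtain ⟨φ⟩ := P.nonempty_frame
  obtain ⟨F, hF⟩ := φ.exists_pullQuad_eq_stdQuad S ((φ.center_fst_mem_points S).1 hS.1)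
    ((φ.center_snd_mem_points S).1 hS.2.1)
  rw [TwoView.conjugateCount_eq φ S hF, encard_rankTwoSet φ hF hS]

lemma Quadric.HasType.conjugates_nonempty {S : Quadric} {P : CameraPair} {t : QuadricType}
    (hS : S.HasType P t) : (S.conjugates P).Nonempty := by
  by_contra h
  rw [Set.not_nonempty_iff_eq_empty] at h
  have := hS.conjugateCount_eq
  rw [Quadric.conjugateCount, h, Set.image_empty, Set.encard_empty] at this
  cases t <;> simp [QuadricType.numConjugates] at this

theorem nontriviallyCritical_iff (P : CameraPair) (X : Set Space) :
    (Configuration.mk P X).NontriviallyCritical ↔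
      ∃ S : Quadric, S.IsCritical P ∧
        P.fst.center ∈ S.points ∧ P.snd.center ∈ S.points ∧ X ⊆ S.points := by
  constructor
  · rintro ⟨d, hd⟩
    have hne : ¬ P.SameFundamental d.cameras := hd.2
    obtain ⟨t, ht⟩ := exists_pencilType P.fundamentalMatrix d.cameras.fundamentalMatrix
    have hS := hasType_criticalQuadric P d.cameras hne ht
    refine ⟨_, ⟨t, hS⟩, hS.1, hS.2.1, ?_⟩
    rw [points_criticalQuadric]
    exact hd.subset_criticalPoints.1
  · rintro ⟨S, ⟨t, ht⟩, -, -, hX⟩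
    obtain ⟨d, h₁, h₂, -⟩ := ht.conjugates_nonempty
    -- Keep the cameras of a conjugate of `S` and only the points sharing an image with a point of
    -- `X`; the common image set is cut down accordingly.
    refine ⟨⟨d.cameras, {y | ∃ x ∈ X, ∃ s, P.Sees x s ∧ d.cameras.Sees y s}⟩,
      ⟨⟨{s | (∃ x ∈ X, P.Sees x s) ∧ ∃ y, d.cameras.Sees y s}, ⟨?_, ?_⟩, ?_, ?_⟩,
        fun h => h₁ h.sameFundamental⟩, h₁⟩
    · intro x hx
      have hx' := hX hx
      rw [h₂] at hx'
      obtain ⟨y, s, hxs, hys⟩ := hx'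
      exact ⟨s, ⟨⟨x, hx, hxs⟩, ⟨y, hys⟩⟩, hxs⟩
    · rintro s ⟨⟨x, hx, hxs⟩, -⟩
      exact ⟨x, hx, hxs⟩
    · rintro y ⟨x, hx, s, hxs, hys⟩
      exact ⟨s, ⟨⟨x, hx, hxs⟩, ⟨y, hys⟩⟩, hys⟩
    · rintro s ⟨⟨x, hx, hxs⟩, ⟨y, hys⟩⟩
      exact ⟨y, ⟨x, hx, s, hxs, hys⟩, hys⟩

end

end TwoView

/-! ### The classification theorem. -/

theorem mainTheorem3 (P : TwoView.CameraPair) :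
    (∀ X : Set TwoView.Space,
      (TwoView.Configuration.mk P X).NontriviallyCritical ↔
        ∃ S : TwoView.Quadric, S.IsCritical P ∧
          P.fst.center ∈ S.points ∧ P.snd.center ∈ S.points ∧ X ⊆ S.points) ∧
    (∀ (S : TwoView.Quadric) (t : TwoView.QuadricType), S.HasType P t →
      (∀ d ∈ S.conjugates P,
        (TwoView.Configuration.mk P S.points).NontrivialConjugate d ∧
          ∃ S' : TwoView.Quadric, d.points = S'.points ∧ S'.HasType d.cameras t.conjugate) ∧
      (t ≠ TwoView.QuadricType.doublePlane →
        ∀ d : TwoView.Configuration,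
          (TwoView.Configuration.mk P S.points).NontrivialConjugate d →
            ∃ e ∈ S.conjugates P, e.cameras = d.cameras ∧ d.points ⊆ e.points) ∧
      S.conjugateCount P = t.numConjugates) := by
  refine ⟨TwoView.nontriviallyCritical_iff P, fun S t hS => ⟨fun d hd => ⟨?_, ?_⟩, fun ht d hd => ?_, ?_⟩⟩
  · exact TwoView.Quadric.nontrivialConjugate hd
  · exact TwoView.Quadric.conjugate_hasType hS hd
  · exact TwoView.Quadric.exists_conjugate_of_nontrivialConjugate (hS.two_le_rank ht) hd
  · exact hS.conjugateCount_eq
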